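/- Let $F$ be a nonarchimedean local field of characteristic zero with Weil group $W_F$, and let $\hat G\subset GL(N,\mathbb C)$ be one of $SO(2n+1,\mathbb C)$, $Sp(2n,\mathbb C)$, $O(2n,\mathbb C)$ (the complex dual group of $G=Sp(2n,F)$, $SO(2n+1,F)$, $O(2n,F)$ respectively). Let $$\psi: W_F\times SL(2,\mathbb C)\times SL(2,\mathbb C)\longrightarrow \hat G$$ be an $A$-parameter, i.e. a homomorphism whose restriction to $W_F$ is continuous with relatively compact image and whose restriction to $SL(2,\mathbb C)\times SL(2,\mathbb C)$ is algebraic. Regard $\psi$ as an $N$-dimensional representation. An irreducible representation is said to be of the same type as $\hat G$ if it preserves a nondegenerate bilinear form which is symmetric (for $\hat G=SO(2n+1,\mathbb C)$, $O(2n,\mathbb C)$), respectively alternating (for $\hat G=Sp(2n,\mathbb C)$). Write $\tilde\psi_i$ for the dual of $\psi_i$. Then $\psi$ can be written in the form $$\psi\cong\Big(\bigoplus_{i=1}^p (m_i\psi_i\oplus m_i\tilde\psi_i)\Big)\oplus\Big(\bigoplus_{i=p+1}^q 2m_i\psi_i\Big)\oplus\Big(\bigoplus_{i=q+1}^r (2m_i+1)\psi_i\Big)\oplus\Big(\bigoplus_{i=r+1}^s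 2m_i\psi_i\Big),$$ where $0\le p\le q\le r\le s$; the $m_i\ge 0$ are integers, with $m_i\geq 1$ unless $q<i\le r$; each $\psi_i$ is irreducible; $\psi_i\ncong\psi_j$ and $\psi_i\ncong\tilde\psi_j$ for $i\neq j$; $\psi_i\ncong\tilde\psi_i$ for $i\le p$; $\psi_i\cong\tilde\psi_i$ for $i>p$; $\psi_i$ is not of the same type as $\hat G$ for $p<i\le q$; and $\psi_i$ is of the same type as $\hat G$ for $i>q$. Let $S_\psi$ be the centralizer of the image of $\psi$ in $\hat G$, $S_\psi^0$ its identity component, $T_\psi$ a maximal torus of $S_\psi^0$, and put $$W_\psi=N_{S_\psi}(T_\psi)/Z_{S_\psi}(T_\psi),\qquad W_\psi^0=N_{S_\psi^0}(T_\psi)/Z_{S_\psi^0}(T_\psi),\qquad R_\psi=W_\psi/W_\psi^0,$$ where $W_\psi^0$ is identified with its image in $W_\psi$. Then for every such decomposition and every such $T_\psi$, $$R_\psi\cong\mathbb Z_2^{\,d},\qquad d=s-r,$$ that is, $d$ is the number of inequivalent self-dual irreducible constituents of $\psi$ of the same type as $\hat G$ that occur with even (positive) multiplicity. -/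

import Mathlib

open ValuativeRel Matrix

noncomputable section

/-! ### The Weil group of a nonarchimedean local field -/

section Weil

variable (F : Type*) [Field F] [ValuativeRel F] [TopologicalSpace F] [IsNonarchimedeanLocalField F]

/-- The ring of integers of the algebraic closure of `F`. -/
abbrev AlgIntegers : Type _ := integralClosure 𝒪[F] (AlgebraicClosure F)

/-- The maximal ideal of the (local) ring of integers of the algebraic closure of `F`. -/
def algMaximalIdeal : Ideal (AlgIntegers F) := Ideal.jacobson ⊥

/-- The absolute Galois group of `F`, with its Krull topology. -/
abbrev AbsGal : Type _ := AlgebraicClosure F ≃ₐ[F] AlgebraicClosure F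

/-- The inertia group: the automorphisms that act trivially on the residue field of the
algebraic closure. -/
def inertiaGroup : Subgroup (AbsGal F) := (algMaximalIdeal F).inertia (AbsGal F)

/-- The Weil group as a subgroup of the absolute Galois group: it is generated by the inertia
group and the Frobenius elements (the `σ` with `σ x ≡ x ^ q` modulo the maximal ideal, where `q` is
the order of the residue field of `F`), i.e. it consists of the elements which act on the
residue field of the algebraic closure as an integral power of Frobenius. -/
def weilSubgroup : Subgroup (AbsGal F) :=
  inertiaGroup F ⊔ Subgroup.closure {σ | IsArithFrobAt 𝒪[F] σ (algMaximalIdeal F)}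

/-- The Weil group of `F`. It is a type of its own because its topology is not the subspace
topology. -/
def WeilGroup : Type _ := weilSubgroup F

instance : Group (WeilGroup F) := inferInstanceAs (Group (weilSubgroup F))

/-- The inclusion of the inertia group in the Weil group. -/
def inertiaToWeil : inertiaGroup F →* WeilGroup F :=
  Subgroup.inclusion (le_sup_left : inertiaGroup F ≤ weilSubgroup F)

/-- The topology of the Weil group: a set `U` is open if and only if, for each `w`, the set of the
`i` in the inertia group with `w * i ∈ U` is open in the Krull topology. So the inertia group is
open and carries its profinite topology. -/
instance : TopologicalSpace (WeilGroup F) :=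
  ⨆ w : WeilGroup F, TopologicalSpace.coinduced (fun i : inertiaGroup F => w * inertiaToWeil F i)
    inferInstance

/-- The group `W_F × SL(2, ℂ) × SL(2, ℂ)`. -/
abbrev ArthurGroup : Type _ :=
  WeilGroup F × SpecialLinearGroup (Fin 2) ℂ × SpecialLinearGroup (Fin 2) ℂ

end Weil

/-! ### The complex dual groups -/

/-- The three families of complex dual groups: `SO(2n+1, ℂ)`, dual to `Sp(2n, F)`;
`Sp(2n, ℂ)`, dual to `SO(2n+1, F)`; and `O(2n, ℂ)`, attached to `O(2n, F)`. -/
inductive DualType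
  | oddSpecialOrthogonal
  | symplectic
  | evenOrthogonal

namespace DualType

/-- The size `N` of the matrices: the dual group lies in `GL(N, ℂ)`. -/
def size : DualType → ℕ → ℕ
  | oddSpecialOrthogonal, n => 2 * n + 1
  | symplectic, n => 2 * n
  | evenOrthogonal, n => 2 * n

/-- The symmetry of the form: `1` in the orthogonal cases and `-1` in the symplectic case. -/
def sign : DualType → ℂ
  | oddSpecialOrthogonal => 1
  | symplectic => -1
  | evenOrthogonal => 1

/-- The Gram matrix of the form: the antidiagonal matrix with entries `1` on and above the diagonal
and entries `1` (orthogonal case) or `-1` (symplectic case) below it. -/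
def form (t : DualType) (n : ℕ) : Matrix (Fin (t.size n)) (Fin (t.size n)) ℂ :=
  Matrix.of fun i j => if j = Fin.rev i then (if i ≤ j then 1 else t.sign) else 0

/-- The complex dual group, as a subgroup of `GL(N, ℂ)`. -/
def dualGroup (t : DualType) (n : ℕ) : Subgroup (GL (Fin (t.size n)) ℂ) where
  carrier := {g | (g : Matrix (Fin (t.size n)) (Fin (t.size n)) ℂ)ᵀ * t.form n * g.val = t.form n ∧
    (t = oddSpecialOrthogonal → g.val.det = 1)}
  one_mem' := by simp
  mul_mem' := by
    rintro a b ⟨ha, ha'⟩ ⟨hb, hb'⟩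
    refine ⟨?_, fun h => ?_⟩
    · calc ((a * b : GL _ ℂ).val)ᵀ * t.form n * (a * b : GL _ ℂ).val
          = b.valᵀ * (a.valᵀ * t.form n * a.val) * b.val := by
            simp [Matrix.transpose_mul, Matrix.mul_assoc]
        _ = t.form n := by rw [ha, hb]
    · simp [ha' h, hb' h]
  inv_mem' := by
    rintro a ⟨ha, ha'⟩
    have h1 : a.val * (a⁻¹ : GL _ ℂ).val = 1 := by rw [← Units.val_mul]; simp
    refine ⟨?_, fun h => ?_⟩
    · calc ((a⁻¹ : GL _ ℂ).val)ᵀ * t.form n * (a⁻¹ : GL _ ℂ).val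
          = ((a⁻¹ : GL _ ℂ).val)ᵀ * (a.valᵀ * t.form n * a.val) * (a⁻¹ : GL _ ℂ).val := by rw [ha]
        _ = (a.val * (a⁻¹ : GL _ ℂ).val)ᵀ * t.form n * (a.val * (a⁻¹ : GL _ ℂ).val) := by
            simp only [Matrix.transpose_mul, Matrix.mul_assoc]
        _ = t.form n := by rw [h1]; simp
    · have h2 := congrArg Matrix.det h1
      rw [Matrix.det_mul, ha' h, Matrix.det_one, one_mul] at h2
      exact h2

end DualType

/-! ### A-parameters -/

section Parameters

variable {F : Type*} [Field F] [ValuativeRel F] [TopologicalSpace F] [IsNonarchimedeanLocalField F]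
variable {t : DualType} {n : ℕ}

/-- The composition of `ψ` with the inclusion of the dual group in `GL(N, ℂ)`. -/
def paramGL (ψ : ArthurGroup F →* t.dualGroup n) : ArthurGroup F →* GL (Fin (t.size n)) ℂ :=
  (t.dualGroup n).subtype.comp ψ

/-- `ψ : W_F × SL(2, ℂ) × SL(2, ℂ) → Ĝ` is an A-parameter: on `W_F` it is continuous with
relatively compact image, and on `SL(2, ℂ) × SL(2, ℂ)` it is algebraic. -/
structure IsAParameter (ψ : ArthurGroup F →* t.dualGroup n) : Prop where
  continuous_weil : Continuous fun w : WeilGroup F => paramGL ψ (w, 1, 1)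
  bounded_weil : IsCompact (closure (Set.range fun w : WeilGroup F => paramGL ψ (w, 1, 1)))
  algebraic : ∃ P : Fin (t.size n) → Fin (t.size n) →
      MvPolynomial (Fin 2 × Fin 2 ⊕ Fin 2 × Fin 2) ℂ,
    ∀ (g h : SpecialLinearGroup (Fin 2) ℂ) (i j : Fin (t.size n)),
      (paramGL ψ (1, g, h)).val i j =
        MvPolynomial.eval (Sum.elim (fun x => g x.1 x.2) (fun x => h x.1 x.2)) (P i j)

/-- `ψ` as a representation on `ℂ^N`. -/
def paramRep (ψ : ArthurGroup F →* t.dualGroup n) :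
    Representation ℂ (ArthurGroup F) (Fin (t.size n) → ℂ) :=
  ((Matrix.toLinAlgEquiv' : Matrix (Fin (t.size n)) (Fin (t.size n)) ℂ ≃ₐ[ℂ] _) :
    Matrix (Fin (t.size n)) (Fin (t.size n)) ℂ →* Module.End ℂ (Fin (t.size n) → ℂ)).comp
    ((Units.coeHom _).comp (paramGL ψ))

/-- The centralizer `S_ψ` of the image of `ψ` in the dual group. -/
def centralizerOf (ψ : ArthurGroup F →* t.dualGroup n) : Subgroup (GL (Fin (t.size n)) ℂ) :=
  t.dualGroup n ⊓ Subgroup.centralizer ((paramGL ψ).range : Set (GL (Fin (t.size n)) ℂ))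

end Parameters

/-! ### Types of representations and decompositions -/

section Decomposition

variable {Γ : Type*} [Group Γ] {V : Type*} [AddCommGroup V] [Module ℂ V]

/-- The representation preserves a nondegenerate symmetric bilinear form. -/
def IsOrthogonalRep (ρ : Representation ℂ Γ V) : Prop :=
  ∃ B : LinearMap.BilinForm ℂ V, B.Nondegenerate ∧ B.IsSymm ∧
    ∀ g v w, B (ρ g v) (ρ g w) = B v w

/-- The representation preserves a nondegenerate alternating bilinear form. -/
def IsSymplecticRep (ρ : Representation ℂ Γ V) : Prop :=
  ∃ B : LinearMap.BilinForm ℂ V, B.Nondegenerate ∧ B.IsAlt ∧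
    ∀ g v w, B (ρ g v) (ρ g w) = B v w

/-- The representation is of the same type as the dual group. -/
def IsSameType (t : DualType) (ρ : Representation ℂ Γ V) : Prop :=
  match t with
  | .oddSpecialOrthogonal => IsOrthogonalRep ρ
  | .symplectic => IsSymplecticRep ρ
  | .evenOrthogonal => IsOrthogonalRep ρ

/-- A decomposition of a representation `ρ` into irreducibles, of the form
`⨁_{i < p} (m_i ψ_i ⊕ m_i ψ_i^∨) ⊕ ⨁_{p ≤ i < q} 2m_i ψ_i ⊕ ⨁_{q ≤ i < r} (2m_i+1) ψ_i ⊕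
⨁_{r ≤ i < s} 2m_i ψ_i`, where the `ψ_i` are pairwise inequivalent up to duality, those with
`i < p` are not self-dual, those with `p ≤ i < q` are self-dual and not of the same type as the dual
group, and those with `q ≤ i` are self-dual and of the same type as the dual group. All the
multiplicities are positive. -/
structure TypeDecomposition (t : DualType) (ρ : Representation ℂ Γ V) where
  (p q r s : ℕ)
  p_le_q : p ≤ q
  q_le_r : q ≤ r
  r_le_s : r ≤ s
  /-- the dimension of `ψ_i` -/
  dim : Fin s → ℕ
  /-- the constituent `ψ_i` -/
  rep : (i : Fin s) → Representation ℂ Γ (Fin (dim i) → ℂ)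
  m : Fin s → ℕ
  m_pos : ∀ i : Fin s, (i.val < q ∨ r ≤ i.val) → 0 < m i
  irreducible : ∀ i, (rep i).IsIrreducible
  not_equiv : ∀ i j, i ≠ j → IsEmpty ((rep i).Equiv (rep j))
  not_equiv_dual : ∀ i j, i ≠ j → IsEmpty ((rep i).Equiv (rep j).dual)
  not_selfDual : ∀ i : Fin s, i.val < p → IsEmpty ((rep i).Equiv (rep i).dual)
  selfDual : ∀ i : Fin s, p ≤ i.val → Nonempty ((rep i).Equiv (rep i).dual)
  not_sameType : ∀ i : Fin s, p ≤ i.val → i.val < q → ¬ IsSameType t (rep i)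
  sameType : ∀ i : Fin s, q ≤ i.val → IsSameType t (rep i)
  /-- the decomposition; `σ.finsupp (Fin k)` is the direct sum of `k` copies of `σ` -/
  equiv : ρ.Equiv (Representation.directSum fun i : Fin s =>
    ((rep i).finsupp (Fin (if i.val < p then m i
        else if q ≤ i.val ∧ i.val < r then 2 * m i + 1 else 2 * m i))).prod
      ((rep i).dual.finsupp (Fin (if i.val < p then m i else 0))))

end Decomposition

/-! ### Tori, Weyl groups and the R-group -/

/-- A subgroup of `GL(N, ℂ)` is a torus if it is the image of an injective algebraic homomorphism
`(ℂˣ)^k → GL(N, ℂ)`; the matrix entries of such a homomorphism are polynomials in the coordinates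
and their inverses. -/
def IsTorus {N : ℕ} (T : Subgroup (GL (Fin N) ℂ)) : Prop :=
  ∃ (k : ℕ) (f : (Fin k → ℂˣ) →* GL (Fin N) ℂ), Function.Injective f ∧ f.range = T ∧
    ∃ P : Fin N → Fin N → MvPolynomial (Fin k ⊕ Fin k) ℂ, ∀ z i j,
      (f z).val i j =
        MvPolynomial.eval (Sum.elim (fun a => (z a : ℂ)) (fun a => ((z a)⁻¹ : ℂˣ))) (P i j)

/-- `T` is a maximal torus of `H`. -/
def IsMaximalTorus {N : ℕ} (H T : Subgroup (GL (Fin N) ℂ)) : Prop :=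
  Maximal (fun T' => IsTorus T' ∧ T' ≤ H) T

section Weyl

variable {Γ : Type*} [Group Γ]

/-- The normalizer `N_H(T)`. -/
def relNormalizer (H T : Subgroup Γ) : Subgroup Γ := H ⊓ Subgroup.normalizer (T : Set Γ)

/-- The centralizer `Z_H(T)`. -/
def relCentralizer (H T : Subgroup Γ) : Subgroup Γ := H ⊓ Subgroup.centralizer (T : Set Γ)

instance relCentralizer_normal (H T : Subgroup Γ) :
    ((relCentralizer H T).subgroupOf (relNormalizer H T)).Normal := by
  refine ⟨fun x hx g => ?_⟩
  obtain ⟨hx1, hx2⟩ := Subgroup.mem_inf.1 (Subgroup.mem_subgroupOf.1 hx)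
  obtain ⟨hg1, hg2⟩ := Subgroup.mem_inf.1 g.2
  refine Subgroup.mem_subgroupOf.2 (Subgroup.mem_inf.2
    ⟨H.mul_mem (H.mul_mem hg1 hx1) (H.inv_mem hg1), ?_⟩)
  rw [Subgroup.mem_centralizer_iff] at hx2 ⊢
  intro y hy
  have hy' : (g : Γ)⁻¹ * y * g ∈ (T : Set Γ) := by
    have := (Subgroup.mem_normalizer_iff.1 (Subgroup.inv_mem _ hg2) y).1 hy
    simpa using this
  have h := hx2 _ hy'
  have h' : y * (g * x * (g : Γ)⁻¹) = g * ((g : Γ)⁻¹ * y * g * x) * (g : Γ)⁻¹ := by group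
  simp only [Subgroup.coe_mul, Subgroup.coe_inv]
  rw [h', h]
  group

/-- The Weyl group `W(H, T) = N_H(T) / Z_H(T)`. -/
abbrev WeylGroup (H T : Subgroup Γ) : Type _ :=
  relNormalizer H T ⧸ (relCentralizer H T).subgroupOf (relNormalizer H T)

/-- The (injective) homomorphism `W(H₀, T) → W(H, T)` induced by an inclusion `H₀ ≤ H`. -/
def weylMap {H₀ H : Subgroup Γ} (h : H₀ ≤ H) (T : Subgroup Γ) : WeylGroup H₀ T →* WeylGroup H T :=
  QuotientGroup.map _ _ (Subgroup.inclusion (inf_le_inf_right _ h)) (by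
    intro x hx
    obtain ⟨hx1, hx2⟩ := Subgroup.mem_inf.1 (Subgroup.mem_subgroupOf.1 hx)
    exact Subgroup.mem_subgroupOf.2 (Subgroup.mem_inf.2 ⟨h hx1, hx2⟩))

variable [TopologicalSpace Γ] [IsTopologicalGroup Γ]

/-- The identity component `S⁰` of a subgroup `S`, as a subgroup of the ambient group. -/
def identityComponent (S : Subgroup Γ) : Subgroup Γ :=
  (Subgroup.connectedComponentOfOne S).map S.subtype

lemma identityComponent_le (S : Subgroup Γ) : identityComponent S ≤ S := by
  rintro _ ⟨x, -, rfl⟩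
  exact x.2

lemma conj_mem_identityComponent (S : Subgroup Γ) {g x : Γ} (hg : g ∈ S)
    (hx : x ∈ identityComponent S) : g * x * g⁻¹ ∈ identityComponent S := by
  obtain ⟨y, hy, rfl⟩ := hx
  let c : S → S := fun z => ⟨g, hg⟩ * z * ⟨g, hg⟩⁻¹
  have hc : Continuous c := by fun_prop
  refine ⟨c y, ?_, rfl⟩
  have h1 : c 1 = 1 := by simp [c]
  have := hc.image_connectedComponent_subset 1 ⟨y, hy, rfl⟩
  rw [h1] at this
  exact this

instance weylMap_range_normal (S T : Subgroup Γ) :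
    (weylMap (identityComponent_le S) T).range.Normal := by
  refine ⟨?_⟩
  rintro _ ⟨x, rfl⟩ g
  induction x using QuotientGroup.induction_on with | _ x
  induction g using QuotientGroup.induction_on with | _ g
  have hmem : (g : Γ) * x * (g : Γ)⁻¹ ∈ relNormalizer (identityComponent S) T :=
    ⟨conj_mem_identityComponent S g.2.1 x.2.1,
      Subgroup.mul_mem _ (Subgroup.mul_mem _ g.2.2 x.2.2) (Subgroup.inv_mem _ g.2.2)⟩
  exact ⟨QuotientGroup.mk ⟨_, hmem⟩, rfl⟩

/-- The R-group `W(S, T) / W(S⁰, T)`. -/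
abbrev RGroup (S T : Subgroup Γ) : Type _ :=
  WeylGroup S T ⧸ (weylMap (identityComponent_le S) T).range

end Weyl

end

/-! Let `V = ℂ^N` carry the form of the dual group, of sign `ε`. If `σ` is irreducible with an
invariant form of sign `η`, then `Hom(σ, V)` inherits a nondegenerate form of sign `ε * η` which
every equivariant isometry of `V` preserves (`exists_multiplicityForm`). For `σ = ψ_i` of the same
type as the dual group this form is symmetric, so the determinant of the action on `Hom(ψ_i, V)` is
a character of `S_ψ` with values `±1`: the component character of `ψ_i`. The centralizer is never
written as a product of classical groups; three facts about these characters suffice.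

First, they cut out `S_ψ⁰`. By continuity they are trivial on it. Conversely, an equivariant
isometry without the eigenvalue `-1` is joined to `1` by its Cayley transform. Any isometry becomes
of this kind after multiplication by the reflection in its generalized eigenspace for `-1`.
Hyperbolic pieces of that reflection lie on one-parameter groups, which leaves the reflection in an
anisotropic space, one without nonzero stable isotropic subspaces. Its constituents are all of the
right type and occur once each, so each of their characters is `-1` on the reflection; if all
characters are `1`, the space is zero (`mem_of_homDet_eq_one`).

Second, the space fixed by a maximal torus `T` is anisotropic, and the reflection in its orthogonal
complement lies in `S_ψ⁰`. Hence `ψ_i` occurs in the fixed space exactly when its multiplicity is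
odd. The characters of even multiplicity are therefore trivial on the centralizer of `T`
(`homDet_eq_one_of_commute`), whereas each character of odd multiplicity can be made `-1` alone by
an isometry which commutes with `T` (`exists_commute_homDet`).

Third, if the multiplicity is even and positive, some copy of `ψ_i` is isotropic and scaled by `T`;
the reflection which exchanges it with its dual partner normalizes `T` and has only the character of
`ψ_i` equal to `-1` (`exists_normalize_homDet`).

So the characters of even multiplicity map `N(T)` onto `(ℤ/2)^(s - r)`, and an element of the kernel
lies in `S_ψ⁰` after multiplication by an element of `Z(T)`. This is the R-group
(`nonempty_rGroup_equiv`).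

All of this needs complete reducibility, also jointly with `T`. It follows from the unitary trick:
the Weil group has relatively compact image, `SL(2, ℂ)` is replaced by `SU(2)` and the torus by its
unit circles, and a projection is averaged over the resulting compact group. The existence of the
decomposition is then a count of multiplicities. -/

open ValuativeRel Matrix

noncomputable section

set_option linter.unusedSectionVars false

/-! ### Adjoints with respect to a symmetric or alternating form -/

section Adjoint

variable {V : Type*} [AddCommGroup V] [Module ℂ V] [FiniteDimensional ℂ V]

/-- A nondegenerate form which is symmetric (`ε = 1`) or alternating (`ε = -1`). -/
structure IsEpsForm (B : LinearMap.BilinForm ℂ V) (ε : ℂ) : Prop where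
  nondeg : B.Nondegenerate
  sq : ε * ε = 1
  symm : ∀ x y, B x y = ε * B y x

/-- The adjoint of an endomorphism with respect to a nondegenerate form. -/
def adj (B : LinearMap.BilinForm ℂ V) (f : Module.End ℂ V) : Module.End ℂ V :=
  open Classical in
  if h : B.Nondegenerate then B.leftAdjointOfNondegenerate h f else 0

namespace IsEpsForm

variable {B : LinearMap.BilinForm ℂ V} {ε : ℂ} (hB : IsEpsForm B ε)
include hB

lemma isRefl : B.IsRefl := fun x y h => by rw [hB.symm, h, mul_zero]

lemma ext_left {x y : V} (h : ∀ z, B x z = B y z) : x = y := by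
  rw [← sub_eq_zero]
  exact hB.nondeg.1 _ fun z => by simp [h z]

lemma ext_end {f g : Module.End ℂ V} (h : ∀ x y, B (f x) y = B (g x) y) : f = g :=
  LinearMap.ext fun x => hB.ext_left (h x)

lemma adj_left (f : Module.End ℂ V) (x y : V) : B (adj B f x) y = B x (f y) := by
  rw [adj, dif_pos hB.nondeg]
  exact LinearMap.BilinForm.isAdjointPairLeftAdjointOfNondegenerate B hB.nondeg f x y

lemma adj_right (f : Module.End ℂ V) (x y : V) : B x (adj B f y) = B (f x) y := by
  rw [hB.symm, hB.adj_left, ← hB.symm]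

lemma eq_adj {f g : Module.End ℂ V} (h : ∀ x y, B (g x) y = B x (f y)) : g = adj B f :=
  hB.ext_end fun x y => by rw [h, hB.adj_left]

lemma adj_adj (f : Module.End ℂ V) : adj B (adj B f) = f :=
  (hB.eq_adj fun x y => by rw [hB.adj_right]).symm

lemma adj_mul (f g : Module.End ℂ V) : adj B (f * g) = adj B g * adj B f :=
  (hB.eq_adj fun x y => by simp [hB.adj_left]).symm

lemma adj_one : adj B 1 = 1 := (hB.eq_adj fun x y => by simp).symm

lemma adj_add (f g : Module.End ℂ V) : adj B (f + g) = adj B f + adj B g :=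
  (hB.eq_adj fun x y => by simp [hB.adj_left]).symm

lemma adj_sub (f g : Module.End ℂ V) : adj B (f - g) = adj B f - adj B g :=
  (hB.eq_adj fun x y => by simp [hB.adj_left]).symm

lemma adj_smul (c : ℂ) (f : Module.End ℂ V) : adj B (c • f) = c • adj B f :=
  (hB.eq_adj fun x y => by simp [hB.adj_left]).symm

lemma adj_pow (f : Module.End ℂ V) (n : ℕ) : adj B (f ^ n) = adj B f ^ n := by
  induction n with
  | zero => simp [hB.adj_one]
  | succ n ih => rw [pow_succ, hB.adj_mul, ih, pow_succ']

/-- Isometries are handled through the identity `adj B g * g = 1`, so that products and reflections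
become computations in the ring of endomorphisms. -/
lemma isometry_iff {g : Module.End ℂ V} :
    adj B g * g = 1 ↔ ∀ x y, B (g x) (g y) = B x y := by
  constructor
  · intro h x y
    rw [← hB.adj_right, ← Module.End.mul_apply, h, Module.End.one_apply]
  · intro h
    exact hB.ext_end fun x y => by simp [hB.adj_left, h]

end IsEpsForm

lemma mul_eq_one_comm_end {f g : Module.End ℂ V} (h : f * g = 1) : g * f = 1 :=
  mul_eq_one_comm.1 h

/-- A self-adjoint idempotent. -/
structure IsSAProj (B : LinearMap.BilinForm ℂ V) (P : Module.End ℂ V) : Prop where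
  idem : P * P = P
  adj : adj B P = P

/-- An idempotent `Q` whose range is isotropic and such that the range of its adjoint is isotropic
too: the projection to one summand of a hyperbolic space. -/
structure IsHyp (B : LinearMap.BilinForm ℂ V) (Q : Module.End ℂ V) : Prop where
  idem : Q * Q = Q
  mul_adj : Q * adj B Q = 0
  adj_mul : adj B Q * Q = 0

/-- The reflection which is `-1` on the range of `P` and `1` on its kernel. -/
def invol (P : Module.End ℂ V) : Module.End ℂ V := 1 - (2 : ℂ) • P

/-- The isometry which is `z` on the range of `Q`, `z⁻¹` on the range of its adjoint and `1` on the
orthogonal complement of both. -/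
def hypScale (B : LinearMap.BilinForm ℂ V) (Q : Module.End ℂ V) (z : ℂˣ) : Module.End ℂ V :=
  1 + ((z : ℂ) - 1) • Q + ((z : ℂ)⁻¹ - 1) • adj B Q

section

variable {B : LinearMap.BilinForm ℂ V} {ε : ℂ} (hB : IsEpsForm B ε) {P P' Q : Module.End ℂ V}

lemma invol_mul_invol (hP : P * P = P) : invol P * invol P = 1 := by
  simp only [invol, mul_sub, sub_mul, mul_one, one_mul, smul_mul_smul_comm, hP]
  module

lemma invol_mul_invol_of_mul_eq_zero (h : P * P' = 0) : invol P * invol P' = invol (P + P') := by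
  simp only [invol, mul_sub, sub_mul, mul_one, one_mul, smul_mul_smul_comm, h]
  module

lemma commute_invol {f : Module.End ℂ V} (h : Commute P f) : Commute (invol P) f :=
  (Commute.one_left f).sub_left (h.smul_left _)

lemma invol_one : invol (1 : Module.End ℂ V) = -1 := by
  rw [invol]; module

lemma invol_zero : invol (0 : Module.End ℂ V) = 1 := by
  simp [invol]

include hB

lemma adj_invol (hP : IsSAProj B P) : adj B (invol P) = invol P := by
  rw [invol, hB.adj_sub, hB.adj_smul, hP.adj, hB.adj_one]

lemma invol_isometry (hP : IsSAProj B P) : adj B (invol P) * invol P = 1 := by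
  rw [adj_invol hB hP, invol_mul_invol hP.idem]

lemma IsSAProj.mul_comm_le (hP : IsSAProj B P) (hP' : IsSAProj B P') (h : P * P' = P') :
    P' * P = P' := by
  have := congrArg (_root_.adj B) h
  rwa [hB.adj_mul, hP.adj, hP'.adj] at this

lemma IsSAProj.sub (hP : IsSAProj B P) (hP' : IsSAProj B P') (h : P * P' = P') :
    IsSAProj B (P - P') := by
  refine ⟨?_, by rw [hB.adj_sub, hP.adj, hP'.adj]⟩
  simp only [mul_sub, sub_mul, hP.idem, h, IsSAProj.mul_comm_le hB hP hP' h, hP'.idem]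
  abel

lemma IsSAProj.one : IsSAProj B 1 := ⟨one_mul 1, hB.adj_one⟩

lemma IsHyp.adj_idem (hQ : IsHyp B Q) : adj B Q * adj B Q = adj B Q := by
  rw [← hB.adj_mul, hQ.idem]

lemma IsHyp.isSAProj (hQ : IsHyp B Q) : IsSAProj B (Q + adj B Q) := by
  refine ⟨?_, by rw [hB.adj_add, hB.adj_adj, add_comm]⟩
  simp only [mul_add, add_mul, hQ.idem, hQ.mul_adj, hQ.adj_mul, hQ.adj_idem hB]
  abel

lemma hypScale_mul (hQ : IsHyp B Q) (z w : ℂˣ) :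
    hypScale B Q (z * w) = hypScale B Q z * hypScale B Q w := by
  simp only [hypScale, mul_add, add_mul, mul_one, one_mul, smul_mul_smul_comm, hQ.idem,
    hQ.mul_adj, hQ.adj_mul, hQ.adj_idem hB, Units.val_mul, mul_inv, smul_zero]
  module

lemma hypScale_one : hypScale B Q 1 = 1 := by simp [hypScale]

/-- The reflection in a hyperbolic space lies on the one-parameter group `hypScale B Q`. This is why
hyperbolic pieces do not contribute to the component group. -/
lemma hypScale_neg_one : hypScale B Q (-1) = invol (Q + adj B Q) := by
  simp only [hypScale, invol, Units.val_neg, Units.val_one, inv_neg, inv_one]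
  module

lemma hypScale_mul_self (hQ : IsHyp B Q) (z : ℂˣ) : hypScale B Q z * Q = (z : ℂ) • Q := by
  simp only [hypScale, add_mul, one_mul, smul_mul_assoc, hQ.idem, hQ.adj_mul]
  module

lemma adj_hypScale (z : ℂˣ) : adj B (hypScale B Q z) = hypScale B Q z⁻¹ := by
  simp only [hypScale, hB.adj_add, hB.adj_smul, hB.adj_one, hB.adj_adj, Units.val_inv_eq_inv_val,
    inv_inv]
  abel

lemma hypScale_isometry (hQ : IsHyp B Q) (z : ℂˣ) :
    adj B (hypScale B Q z) * hypScale B Q z = 1 := by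
  rw [adj_hypScale hB, ← hypScale_mul hB hQ, inv_mul_cancel, hypScale_one hB]

end

/-! ### Stable subspaces -/

section Stable

variable {Γ : Type*} [Group Γ] (ρ : Representation ℂ Γ V)

/-- The subspace `W` is stable under `ρ`. -/
def IsStable (W : Submodule ℂ V) : Prop := ∀ g, ∀ v ∈ W, ρ g v ∈ W

/-- The endomorphism `f` commutes with `ρ`. -/
def IsEquivariant (f : Module.End ℂ V) : Prop := ∀ g, Commute f (ρ g)

/-- Every stable subspace is the range of an equivariant projection. -/
def HasProjections : Prop :=
  ∀ W, IsStable ρ W → ∃ R : Module.End ℂ V, IsEquivariant ρ R ∧ R * R = R ∧ LinearMap.range R = W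

/-- The form vanishes on `W`. -/
def IsIsotropic (B : LinearMap.BilinForm ℂ V) (W : Submodule ℂ V) : Prop :=
  ∀ x ∈ W, ∀ y ∈ W, B x y = 0

/-- `W` contains no stable isotropic subspace but zero. -/
def IsAnisotropic (B : LinearMap.BilinForm ℂ V) (W : Submodule ℂ V) : Prop :=
  ∀ U ≤ W, IsStable ρ U → IsIsotropic B U → U = ⊥

/-- The form is invariant under `ρ`. -/
def IsInvariantForm (B : LinearMap.BilinForm ℂ V) : Prop :=
  ∀ g x y, B (ρ g x) (ρ g y) = B x y

/-- `U` is a minimal nonzero stable subspace. -/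
structure IsMinimalStable (U : Submodule ℂ V) : Prop where
  stable : IsStable ρ U
  ne_bot : U ≠ ⊥
  minimal : ∀ W ≤ U, IsStable ρ W → W = ⊥ ∨ W = U

variable {ρ}

lemma IsStable.inf {W W' : Submodule ℂ V} (h : IsStable ρ W) (h' : IsStable ρ W') :
    IsStable ρ (W ⊓ W') := fun g v hv => ⟨h g v hv.1, h' g v hv.2⟩

lemma IsEquivariant.isStable_range {f : Module.End ℂ V} (h : IsEquivariant ρ f) :
    IsStable ρ (LinearMap.range f) := by
  rintro g _ ⟨v, rfl⟩
  exact ⟨ρ g v, congrArg (· v) (h g).eq⟩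

lemma IsEquivariant.one : IsEquivariant ρ 1 := fun _ => Commute.one_left _

lemma IsEquivariant.add {f f' : Module.End ℂ V} (h : IsEquivariant ρ f) (h' : IsEquivariant ρ f') :
    IsEquivariant ρ (f + f') := fun g => (h g).add_left (h' g)

lemma IsEquivariant.sub {f f' : Module.End ℂ V} (h : IsEquivariant ρ f) (h' : IsEquivariant ρ f') :
    IsEquivariant ρ (f - f') := fun g => (h g).sub_left (h' g)

lemma IsEquivariant.mul {f f' : Module.End ℂ V} (h : IsEquivariant ρ f) (h' : IsEquivariant ρ f') :
    IsEquivariant ρ (f * f') := fun g => (h g).mul_left (h' g)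

lemma IsEquivariant.smul {f : Module.End ℂ V} (h : IsEquivariant ρ f) (c : ℂ) :
    IsEquivariant ρ (c • f) := fun g => (h g).smul_left c

lemma IsEquivariant.invol {f : Module.End ℂ V} (h : IsEquivariant ρ f) :
    IsEquivariant ρ (invol f) := fun g => commute_invol (h g)

lemma exists_isMinimalStable {W : Submodule ℂ V} (hW : IsStable ρ W) (h0 : W ≠ ⊥) :
    ∃ U ≤ W, IsMinimalStable ρ U := by
  induction hn : Module.finrank ℂ W using Nat.strong_induction_on generalizing W with
  | _ n ih =>
  by_cases h : ∀ W' ≤ W, IsStable ρ W' → W' = ⊥ ∨ W' = W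
  · exact ⟨W, le_rfl, hW, h0, h⟩
  · push Not at h
    obtain ⟨W', hle, hst, hne, hne'⟩ := h
    obtain ⟨U, hU, hU'⟩ := ih _ (hn ▸ Submodule.finrank_lt_finrank_of_lt (lt_of_le_of_ne hle hne'))
      hst hne rfl
    exact ⟨U, hU.trans hle, hU'⟩

lemma range_le_iff_mul {P f : Module.End ℂ V} (hP : P * P = P) :
    LinearMap.range f ≤ LinearMap.range P ↔ P * f = f := by
  constructor
  · intro h
    ext v
    obtain ⟨w, hw⟩ := h ⟨v, rfl⟩
    rw [Module.End.mul_apply, ← hw, ← Module.End.mul_apply, hP]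
  · rintro h _ ⟨v, rfl⟩
    exact ⟨f v, congrArg (· v) h⟩

lemma mem_range_iff_of_idem {P : Module.End ℂ V} (hP : P * P = P) {v : V} :
    v ∈ LinearMap.range P ↔ P v = v := by
  constructor
  · rintro ⟨w, rfl⟩
    exact congrArg (· w) hP
  · intro h; exact ⟨v, h⟩

/-! ### Invariant forms: hyperbolic and anisotropic subspaces -/

section Form

variable {B : LinearMap.BilinForm ℂ V} {ε : ℂ} (hB : IsEpsForm B ε) (hρ : IsInvariantForm ρ B)
include hB hρ

lemma adj_rep (g : Γ) : adj B (ρ g) = ρ g⁻¹ := by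
  refine (hB.eq_adj fun x y => ?_).symm
  rw [← hρ g]
  simp

lemma IsEquivariant.adj {f : Module.End ℂ V} (hf : IsEquivariant ρ f) :
    IsEquivariant ρ (adj B f) := fun g => by
  have := congrArg (_root_.adj B) (hf g⁻¹).eq
  rw [hB.adj_mul, hB.adj_mul, adj_rep hB hρ, inv_inv] at this
  exact this.symm

lemma IsEquivariant.hypScale {Q : Module.End ℂ V} (hQ : IsEquivariant ρ Q) (z : ℂˣ) :
    IsEquivariant ρ (hypScale B Q z) :=
  (IsEquivariant.one.add (hQ.smul _)).add ((hQ.adj hB hρ).smul _)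

lemma IsStable.orthogonal {W : Submodule ℂ V} (hW : IsStable ρ W) :
    IsStable ρ (B.orthogonal W) := by
  intro g v hv
  rw [LinearMap.BilinForm.mem_orthogonal_iff] at hv ⊢
  intro w hw
  have := hv _ (hW g⁻¹ w hw)
  rw [← hρ g] at this
  simpa using this

/-- A stable isotropic subspace of the range of `P` is one half of a hyperbolic space. -/
lemma exists_isHyp (hcr : HasProjections ρ) {P : Module.End ℂ V} (hP : IsSAProj B P)
    (hPρ : IsEquivariant ρ P) {U : Submodule ℂ V} (hU : IsStable ρ U) (hUP : U ≤ LinearMap.range P)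
    (hiso : IsIsotropic B U) :
    ∃ Q, IsHyp B Q ∧ IsEquivariant ρ Q ∧ LinearMap.range Q = U ∧ P * Q = Q ∧ P * adj B Q = adj B Q
    := by
  obtain ⟨R₀, hR₀ρ, hR₀, hR₀U⟩ := hcr U hU
  -- Composing with `P` keeps the range `U` and makes the projection vanish on the kernel of `P`.
  -- Then the adjoint of `R` also maps into the range of `P`.
  obtain ⟨R, hRdef⟩ : ∃ R, R = R₀ * P := ⟨_, rfl⟩
  have hPR₀ : P * R₀ = R₀ := (range_le_iff_mul hP.idem).1 (hR₀U ▸ hUP)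
  have hR : R * R = R := by
    rw [hRdef, mul_assoc, ← mul_assoc P, hPR₀, ← mul_assoc, hR₀]
  have hR₀R : R * R₀ = R₀ := by rw [hRdef, mul_assoc, hPR₀, hR₀]
  have hRR₀ : R₀ * R = R := by rw [hRdef, ← mul_assoc, hR₀]
  have hRρ : IsEquivariant ρ R := hRdef ▸ hR₀ρ.mul hPρ
  have hRU : LinearMap.range R = U := by
    rw [← hR₀U]
    exact le_antisymm ((range_le_iff_mul hR₀).2 hRR₀) ((range_le_iff_mul hR).2 hR₀R)
  have hRP : R * P = R := by rw [hRdef, mul_assoc, hP.idem]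
  have hPR : P * R = R := by rw [hRdef, ← mul_assoc, hPR₀]
  have hPR' : P * adj B R = adj B R := by
    have := congrArg (_root_.adj B) hRP
    rwa [hB.adj_mul, hP.adj] at this
  have hRa : adj B R * R = 0 := hB.ext_end fun x y => by
    simpa [hB.adj_left] using hiso _ (hRU ▸ ⟨x, rfl⟩) _ (hRU ▸ ⟨y, rfl⟩)
  have hRa2 : adj B R * adj B R = adj B R := by rw [← hB.adj_mul, hR]
  set R' := adj B R with hR'
  -- The range of `R` is isotropic, but that of `adj B R` need not be. Subtracting half of `R * adj
  -- B R`, which is self-adjoint, makes the product of the new projection with its adjoint vanish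
  -- and does not change the range.
  have hadj : adj B (R - (1 / 2 : ℂ) • (R * R')) = R' - (1 / 2 : ℂ) • (R * R') := by
    rw [hB.adj_sub, hB.adj_smul, hB.adj_mul, hR', hB.adj_adj]
  have e1 : R * (R * R') = R * R' := by rw [← mul_assoc, hR]
  have e2 : R * R' * R = 0 := by rw [mul_assoc, hRa, mul_zero]
  have e3 : R * R' * (R * R') = 0 := by rw [← mul_assoc, e2, zero_mul]
  have e4 : R * R' * R' = R * R' := by rw [mul_assoc, hRa2]
  have e5 : R' * (R * R') = 0 := by rw [← mul_assoc, hRa, zero_mul]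
  have hQR : (R - (1 / 2 : ℂ) • (R * R')) * R = R := by
    rw [sub_mul, smul_mul_assoc, e2, hR, smul_zero, sub_zero]
  refine ⟨R - (1 / 2 : ℂ) • (R * R'), ⟨?_, ?_, ?_⟩, hRρ.sub ((hRρ.mul (hRρ.adj hB hρ)).smul _),
    ?_, ?_, ?_⟩
  · simp only [mul_sub, sub_mul, smul_mul_assoc, mul_smul_comm, hR, e1, e2, e3]
    module
  · rw [hadj]
    simp only [mul_sub, sub_mul, smul_mul_assoc, mul_smul_comm, e1, e3, e4]
    module
  · rw [hadj]
    simp only [mul_sub, sub_mul, smul_mul_assoc, mul_smul_comm, hRa, e2, e3, e5]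
    module
  · rw [← hRU]
    refine le_antisymm ((range_le_iff_mul hR).2 ?_) ?_
    · rw [mul_sub, mul_smul_comm, e1, hR]
    · intro v hv
      rw [mem_range_iff_of_idem hR] at hv
      refine ⟨v, ?_⟩
      conv_lhs => rw [← hv]
      rw [← Module.End.mul_apply, hQR, hv]
  · rw [mul_sub, mul_smul_comm, ← mul_assoc, hPR]
  · rw [hadj, mul_sub, mul_smul_comm, ← mul_assoc, hPR, hPR']

/-- Disjointness makes `V` the sum of `W` and its orthogonal complement. The complement is stable
because the form is invariant, so the orthogonal projection is equivariant. -/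
lemma exists_isSAProj_of_disjoint {W : Submodule ℂ V} (hW : IsStable ρ W)
    (hd : Disjoint W (B.orthogonal W)) :
    ∃ P, IsSAProj B P ∧ IsEquivariant ρ P ∧ LinearMap.range P = W := by
  have hc := (LinearMap.BilinForm.isCompl_orthogonal_iff_disjoint hB.isRefl).2 hd
  set P := Submodule.projection W (B.orthogonal W) hc with hPdef
  have hmem : ∀ v, P v ∈ W := fun v => by
    simp [hPdef]
  have hid : ∀ v ∈ W, P v = v := fun v hv => by
    simpa [hPdef] using Submodule.projection_apply_left hc ⟨v, hv⟩
  have hker : ∀ v ∈ B.orthogonal W, P v = 0 := fun v hv => by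
    simpa [hPdef] using hv
  have hsub : ∀ v, v - P v ∈ B.orthogonal W := fun v => by
    have : P (v - P v) = 0 := by rw [map_sub, hid _ (hmem v), sub_self]
    rwa [hPdef, Submodule.projection_apply_eq_zero_iff] at this
  have horth : ∀ x y, B (P x) y = B (P x) (P y) := fun x y => by
    have := (LinearMap.BilinForm.mem_orthogonal_iff.1 (hsub y)) _ (hmem x)
    rw [map_sub, sub_eq_zero] at this
    exact this
  refine ⟨P, ⟨LinearMap.ext fun v => hid _ (hmem v), (hB.eq_adj fun x y => ?_).symm⟩, fun g => ?_,
    le_antisymm ?_ fun v hv => ⟨v, hid v hv⟩⟩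
  · rw [horth, hB.symm x, horth y, ← hB.symm]
  · ext v
    have h1 : P (ρ g v) = P (ρ g (P v)) + P (ρ g (v - P v)) := by
      rw [← map_add, ← map_add, add_sub_cancel]
    rw [Module.End.mul_apply, Module.End.mul_apply, h1, hid _ (hW g _ (hmem v)),
      hker _ (hW.orthogonal hB hρ g _ (hsub v)), add_zero]
  · rintro _ ⟨v, rfl⟩; exact hmem v

omit hρ in
lemma IsIsotropic.inf_orthogonal (W : Submodule ℂ V) : IsIsotropic B (W ⊓ B.orthogonal W) :=
  fun x hx _ hy => LinearMap.BilinForm.mem_orthogonal_iff.1 hy.2 x hx.1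

/-- The intersection of `W'` with its orthogonal complement is stable and isotropic, hence zero: in
an anisotropic space every stable subspace splits off orthogonally. -/
lemma IsAnisotropic.exists_isSAProj {W W' : Submodule ℂ V} (h : IsAnisotropic ρ B W) (hle : W' ≤ W)
    (hW' : IsStable ρ W') : ∃ P, IsSAProj B P ∧ IsEquivariant ρ P ∧ LinearMap.range P = W' :=
  exists_isSAProj_of_disjoint hB hρ hW' (disjoint_iff.2 (h _ (inf_le_left.trans hle)
    (hW'.inf (hW'.orthogonal hB hρ)) (IsIsotropic.inf_orthogonal hB _)))

/-- Up to the isometries `hypScale`, the reflection attached to `P` is the reflection attached to a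
projection with anisotropic range. -/
lemma exists_invol_eq_mul_invol (hcr : HasProjections ρ) (K : Submonoid (Module.End ℂ V))
    (hK : ∀ Q, IsHyp B Q → IsEquivariant ρ Q → ∀ z, hypScale B Q z ∈ K)
    {P : Module.End ℂ V} (hP : IsSAProj B P) (hPρ : IsEquivariant ρ P) :
    ∃ P₀, IsSAProj B P₀ ∧ IsEquivariant ρ P₀ ∧ P * P₀ = P₀ ∧
      IsAnisotropic ρ B (LinearMap.range P₀) ∧ ∃ κ ∈ K, invol P = κ * invol P₀ := by
  induction hn : Module.finrank ℂ (LinearMap.range P) using Nat.strong_induction_on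
    generalizing P with
  | _ n ih =>
  by_cases h : IsAnisotropic ρ B (LinearMap.range P)
  · exact ⟨P, hP, hPρ, hP.idem, h, 1, K.one_mem, (one_mul _).symm⟩
  · rw [IsAnisotropic] at h
    push Not at h
    obtain ⟨U, hUP, hU, hiso, hne⟩ := h
    -- Remove from the range of `P` the hyperbolic space spanned by `U` and a dual partner. On it
    -- the reflection is `hypScale B Q (-1)`, which lies in `K`, and the rank drops.
    obtain ⟨Q, hQ, hQρ, hQU, hPQ, hPQ'⟩ := exists_isHyp hB hρ hcr hP hPρ hU hUP hiso
    have hH := hQ.isSAProj hB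
    have hle : P * (Q + adj B Q) = Q + adj B Q := by rw [mul_add, hPQ, hPQ']
    have h1 := hP.sub hB hH hle
    have h1ρ : IsEquivariant ρ (P - (Q + adj B Q)) := hPρ.sub (hQρ.add (hQρ.adj hB hρ))
    have h1P : P * (P - (Q + adj B Q)) = P - (Q + adj B Q) := by rw [mul_sub, hP.idem, hle]
    have hz : (Q + adj B Q) * (P - (Q + adj B Q)) = 0 := by
      rw [mul_sub, hP.mul_comm_le hB hH hle, hH.idem, sub_self]
    have hlt : Module.finrank ℂ (LinearMap.range (P - (Q + adj B Q))) < n := by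
      rw [← hn]
      refine Submodule.finrank_lt_finrank_of_lt (lt_of_le_of_ne ?_ fun he => hne ?_)
      · exact (range_le_iff_mul hP.idem).2 h1P
      · rw [eq_bot_iff]
        intro u hu
        have hu1 := hUP hu
        rw [← he, mem_range_iff_of_idem h1.idem] at hu1
        rw [← hQU, mem_range_iff_of_idem hQ.idem] at hu
        have h0 : (Q + adj B Q) u = 0 := by rw [← hu1, ← Module.End.mul_apply, hz]; rfl
        have h2 : adj B Q u = 0 := by rw [← hu, ← Module.End.mul_apply, hQ.adj_mul]; rfl
        rw [LinearMap.add_apply, h2, add_zero, hu] at h0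
        exact h0
    obtain ⟨P₀, hP₀, hP₀ρ, hle₀, han, κ, hκ, he⟩ := ih _ hlt h1 h1ρ rfl
    refine ⟨P₀, hP₀, hP₀ρ, ?_, han, hypScale B Q (-1) * κ, K.mul_mem (hK Q hQ hQρ _) hκ, ?_⟩
    · rw [← hle₀, ← mul_assoc, h1P]
    · rw [mul_assoc, ← he, hypScale_neg_one hB, invol_mul_invol_of_mul_eq_zero hz, add_sub_cancel]

end Form

end Stable

end Adjoint

/-! ### Removing the eigenvalue `-1` from an isometry -/

section EigenProjection

variable {V : Type*} [AddCommGroup V] [Module ℂ V] [FiniteDimensional ℂ V]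

/-- The projection to the generalized eigenspace of an isometry for the eigenvalue `-1`. -/
lemma exists_isSAProj_eigen {B : LinearMap.BilinForm ℂ V} {ε : ℂ} (hB : IsEpsForm B ε)
    {g : Module.End ℂ V} (hg : adj B g * g = 1) :
    ∃ P, IsSAProj B P ∧ (∀ f, Commute f g → Commute P f) ∧ ∀ v, g (invol P v) = -v → v = 0 := by
  -- Fitting decomposition for `1 + g`. The condition `1 ≤ n` guarantees that eigenvectors for `-1`
  -- lie in the kernel of `(1 + g) ^ n`.
  obtain ⟨n, hc, hn⟩ := ((LinearMap.eventually_isCompl_ker_pow_range_pow (1 + g)).and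
    (Filter.eventually_ge_atTop 1)).exists
  set a := (1 + g) ^ n with ha
  have hgg : g * adj B g = 1 := mul_eq_one_comm_end hg
  -- Since `adj B g` is the inverse of `g`, the adjoint of `1 + g` is `g⁻¹ * (1 + g)`. So `a` is
  -- self-adjoint up to a unit, and its kernel is orthogonal to its range.
  have hadj : adj B a = adj B g ^ n * a := by
    have h1 : adj B (1 + g) = adj B g * (1 + g) := by
      rw [hB.adj_add, hB.adj_one, mul_add, mul_one, hg, add_comm]
    have h2 : Commute (adj B g) (1 + g) :=
      (Commute.one_right _).add_right (hg.trans hgg.symm)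
    rw [ha, hB.adj_pow, h1, h2.mul_pow]
  set P := Submodule.projection (LinearMap.ker a) (LinearMap.range a) hc with hPdef
  have hmem : ∀ v, P v ∈ LinearMap.ker a := fun v => by
    rw [hPdef]; exact Submodule.projection_apply_mem hc v
  have hid : ∀ v ∈ LinearMap.ker a, P v = v := fun v hv => by
    simpa [hPdef] using Submodule.projection_apply_left hc ⟨v, hv⟩
  have hker : ∀ v ∈ LinearMap.range a, P v = 0 := fun v hv => by
    rwa [hPdef, Submodule.projection_apply_eq_zero_iff]
  have hsub : ∀ v, v - P v ∈ LinearMap.range a := fun v => by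
    have : P (v - P v) = 0 := by rw [map_sub, hid _ (hmem v), sub_self]
    rwa [hPdef, Submodule.projection_apply_eq_zero_iff] at this
  have horth : ∀ x ∈ LinearMap.ker a, ∀ y ∈ LinearMap.range a, B x y = 0 := by
    rintro x hx _ ⟨y, rfl⟩
    rw [← hB.adj_left, hadj, Module.End.mul_apply, LinearMap.mem_ker.1 hx]
    simp
  have horth' : ∀ x y, B (P x) y = B (P x) (P y) := fun x y => by
    have := horth _ (hmem x) _ (hsub y)
    rwa [map_sub, sub_eq_zero] at this
  have hcomm : ∀ f, Commute f g → Commute P f := fun f hf => by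
    have hfa : Commute f a := ((Commute.one_right f).add_right hf).pow_right n
    have hfk : ∀ v ∈ LinearMap.ker a, f v ∈ LinearMap.ker a := fun v hv => by
      rw [LinearMap.mem_ker, ← Module.End.mul_apply, ← hfa.eq, Module.End.mul_apply,
        LinearMap.mem_ker.1 hv, map_zero]
    have hfr : ∀ v ∈ LinearMap.range a, f v ∈ LinearMap.range a := by
      rintro _ ⟨v, rfl⟩
      exact ⟨f v, (congrArg (· v) hfa.eq).symm⟩
    ext v
    have h1 : P (f v) = P (f (P v)) + P (f (v - P v)) := by
      rw [← map_add, ← map_add, add_sub_cancel]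
    rw [Module.End.mul_apply, Module.End.mul_apply, h1, hid _ (hfk _ (hmem v)),
      hker _ (hfr _ (hsub v)), add_zero]
  have hidem : P * P = P := LinearMap.ext fun v => hid _ (hmem v)
  refine ⟨P, ⟨hidem, (hB.eq_adj fun x y => ?_).symm⟩, hcomm, fun v hv => ?_⟩
  · rw [horth', hB.symm x, horth' y, ← hB.symm]
  · have hPg : ∀ x, P (g x) = g (P x) := fun x => congrArg (· x) (hcomm g (Commute.refl g)).eq
    have hPP : ∀ x, P (P x) = P x := fun x => congrArg (· x) hidem
    -- Applying `P` to the equation shows that `g` fixes `P v`. Then `(1 + g) ^ n` multiplies `P v`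
    -- by `2 ^ n`, but it also kills it, so `P v = 0` and `v` itself is an eigenvector for `-1`.
    have h1 : g (P v) = P v := by
      have := congrArg P hv
      rw [hPg] at this
      simp only [invol, LinearMap.sub_apply, Module.End.one_apply, LinearMap.smul_apply, map_sub,
        map_smul, hPP, map_neg] at this
      have h2 : g (P v) - (2 : ℂ) • g (P v) = - g (P v) := by module
      rw [h2] at this
      exact neg_injective this
    have h2 : P v = 0 := by
      have h3 : ∀ m : ℕ, ((1 + g) ^ m) (P v) = (2 : ℂ) ^ m • P v := fun m => by
        induction m with
        | zero => simp
        | succ m ih =>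
          rw [pow_succ', Module.End.mul_apply, ih, map_smul, LinearMap.add_apply, h1,
            Module.End.one_apply, pow_succ']
          module
      have h4 := LinearMap.mem_ker.1 (hmem v)
      rw [ha, h3] at h4
      exact (smul_eq_zero.1 h4).resolve_left (by simp)
    have h5 : (1 + g) v = 0 := by
      simp only [invol, LinearMap.sub_apply, Module.End.one_apply, LinearMap.smul_apply, h2,
        smul_zero, sub_zero] at hv
      rw [LinearMap.add_apply, hv, Module.End.one_apply, add_neg_cancel]
    have h6 : v ∈ LinearMap.ker a := by
      obtain ⟨m, rfl⟩ : ∃ m, n = m + 1 := ⟨n - 1, by omega⟩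
      rw [LinearMap.mem_ker, ha, pow_succ, Module.End.mul_apply, h5, map_zero]
    rw [← hid v h6, h2]

end EigenProjection

/-! ### Schur's lemma for invariant pairings -/

section Schur

open Representation

variable {Γ : Type*} [Group Γ] {W : Type*} [AddCommGroup W] [Module ℂ W] [FiniteDimensional ℂ W]
  {W' : Type*} [AddCommGroup W'] [Module ℂ W'] [FiniteDimensional ℂ W']
  {σ' : Representation ℂ Γ W'} {σ : Representation ℂ Γ W}

/-- The pairing is invariant under the two representations. -/
def IsInvariantPairing (σ : Representation ℂ Γ W) (σ' : Representation ℂ Γ W')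
    (β : W →ₗ[ℂ] W' →ₗ[ℂ] ℂ) : Prop :=
  ∀ g x y, β (σ g x) (σ' g y) = β x y

lemma IsInvariantPairing.flip {β : W →ₗ[ℂ] W' →ₗ[ℂ] ℂ} (hβ : IsInvariantPairing σ σ' β) :
    IsInvariantPairing σ' σ β.flip := fun g x y => hβ g y x

/-- An invariant pairing as an intertwining map to the dual. -/
def pairingIntertwining {β : W →ₗ[ℂ] W' →ₗ[ℂ] ℂ} (hβ : IsInvariantPairing σ σ' β) :
    IntertwiningMap σ σ'.dual where
  toLinearMap := β
  isIntertwining' g := by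
    ext x y
    have := hβ g x (σ' g⁻¹ y)
    simpa [Module.Dual.transpose_apply] using this

lemma pairingIntertwining_injective (hσ : σ.IsIrreducible) {β : W →ₗ[ℂ] W' →ₗ[ℂ] ℂ}
    (hβ : IsInvariantPairing σ σ' β) (h0 : β ≠ 0) :
    Function.Injective (pairingIntertwining hβ) := by
  refine (IsIrreducible.injective_or_eq_zero _).resolve_right fun h => h0 ?_
  exact congrArg IntertwiningMap.toLinearMap h

lemma flip_ne_zero {β : W →ₗ[ℂ] W' →ₗ[ℂ] ℂ} (h0 : β ≠ 0) : β.flip ≠ 0 := fun h => h0 (by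
  rw [← LinearMap.flip_flip β, h]; rfl)

/-- The pairing and its flip are both injective into duals, so the two dimensions agree. -/
lemma pairingIntertwining_bijective (hσ : σ.IsIrreducible) (hσ' : σ'.IsIrreducible)
    {β : W →ₗ[ℂ] W' →ₗ[ℂ] ℂ} (hβ : IsInvariantPairing σ σ' β) (h0 : β ≠ 0) :
    Function.Bijective (pairingIntertwining hβ) := by
  have h1 := pairingIntertwining_injective hσ hβ h0
  have h2 := pairingIntertwining_injective hσ' hβ.flip (flip_ne_zero h0)
  have h3 := LinearMap.finrank_le_finrank_of_injective
    (f := (pairingIntertwining hβ).toLinearMap) h1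
  have h4 := LinearMap.finrank_le_finrank_of_injective
    (f := (pairingIntertwining hβ.flip).toLinearMap) h2
  rw [Subspace.dual_finrank_eq] at h3 h4
  exact ⟨h1, (LinearMap.injective_iff_surjective_of_finrank_eq_finrank
    (f := (pairingIntertwining hβ).toLinearMap)
    ((le_antisymm h3 h4).trans Subspace.dual_finrank_eq.symm)).1 h1⟩

lemma exists_eq_smul_of_isIrreducible (hσ : σ.IsIrreducible) (f : IntertwiningMap σ σ) :
    ∃ c : ℂ, ∀ x, f x = c • x := by
  obtain ⟨c, hc⟩ := (IsIrreducible.algebraMap_intertwiningMap_bijective_of_isAlgClosed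
    (ρ := σ)).2 f
  exact ⟨c, fun x => by rw [← hc]; rfl⟩

/-- Inverting the isomorphism given by `β` turns `β'` into an endomorphism of `σ`, which is a
scalar. -/
lemma exists_pairing_eq_smul (hσ : σ.IsIrreducible) (hσ' : σ'.IsIrreducible)
    {β β' : W →ₗ[ℂ] W' →ₗ[ℂ] ℂ} (hβ : IsInvariantPairing σ σ' β)
    (hβ' : IsInvariantPairing σ σ' β') (h0 : β ≠ 0) :
    ∃ c : ℂ, ∀ x y, β' x y = c * β x y := by
  let e := (pairingIntertwining hβ).ofBijective (pairingIntertwining_bijective hσ hσ' hβ h0)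
  obtain ⟨c, hc⟩ := exists_eq_smul_of_isIrreducible hσ
    (e.symm.toIntertwiningMap.comp (pairingIntertwining hβ'))
  refine ⟨c, fun x y => ?_⟩
  have h1 : e (e.symm (pairingIntertwining hβ' x)) = e (c • x) := congrArg e (hc x)
  rw [Representation.Equiv.apply_symm_apply, map_smul] at h1
  exact congrArg (· y) h1

lemma exists_pairing_ne_zero {β : W →ₗ[ℂ] W' →ₗ[ℂ] ℂ} (h0 : β ≠ 0) : ∃ x y, β x y ≠ 0 := by
  by_contra! h
  exact h0 (LinearMap.ext fun x => LinearMap.ext fun y => h x y)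

/-- A nonzero invariant form on an irreducible representation is symmetric or alternating. -/
lemma exists_sign_of_isIrreducible (hσ : σ.IsIrreducible) {β : LinearMap.BilinForm ℂ W}
    (hβ : IsInvariantForm σ β) (h0 : β ≠ 0) :
    ∃ η : ℂ, η * η = 1 ∧ ∀ x y, β x y = η * β y x := by
  -- The flipped form is again invariant, hence `c` times the form; flipping twice gives `c * c =
  -- 1`.
  obtain ⟨c, hc⟩ := exists_pairing_eq_smul hσ hσ hβ (IsInvariantPairing.flip hβ) h0
  have hc' : ∀ x y, β y x = c * β x y := hc
  refine ⟨c, ?_, fun x y => hc' y x⟩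
  obtain ⟨x, y, hxy⟩ := exists_pairing_ne_zero h0
  have h1 := hc' y x
  rw [hc' x y, ← mul_assoc] at h1
  exact mul_right_cancel₀ hxy (by rw [one_mul]; exact h1.symm)

lemma nondegenerate_of_isIrreducible (hσ : σ.IsIrreducible) {β : LinearMap.BilinForm ℂ W}
    (hβ : IsInvariantForm σ β) (h0 : β ≠ 0) : β.Nondegenerate :=
  ⟨fun x hx => pairingIntertwining_injective hσ hβ h0 (by
    rw [map_zero]; exact LinearMap.ext hx),
   fun x hx => pairingIntertwining_injective hσ (IsInvariantPairing.flip hβ) (flip_ne_zero h0) (by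
    rw [map_zero]; exact LinearMap.ext hx)⟩

end Schur

/-! ### Minimal stable subspaces as irreducible representations -/

section Minimal

open Representation

variable {Γ : Type*} [Group Γ] {V : Type*} [AddCommGroup V] [Module ℂ V] [FiniteDimensional ℂ V]
  {ρ : Representation ℂ Γ V}

/-- The representation on a stable subspace. -/
def subRep {U : Submodule ℂ V} (hU : IsStable ρ U) : Representation ℂ Γ U :=
  (⟨U, fun g _ hv => hU g _ hv⟩ : Subrepresentation ρ).toRepresentation

/-- The inclusion of a stable subspace. -/
def subRepIncl {U : Submodule ℂ V} (hU : IsStable ρ U) : IntertwiningMap (subRep hU) ρ where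
  toLinearMap := U.subtype
  isIntertwining' _ := rfl

lemma IsMinimalStable.isIrreducible {U : Submodule ℂ V} (hU : IsMinimalStable ρ U) :
    (subRep hU.stable).IsIrreducible := by
  have : Nontrivial (Subrepresentation (subRep hU.stable)) := by
    refine ⟨⊥, ⊤, fun h => hU.ne_bot ?_⟩
    have h' : (⊥ : Submodule ℂ U) = ⊤ := congrArg Subrepresentation.toSubmodule h
    rw [eq_bot_iff]
    intro u hu
    have : (⟨u, hu⟩ : U) ∈ (⊥ : Submodule ℂ U) := by rw [h']; trivial
    simpa using this
  refine ⟨fun X => ?_⟩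
  have hst : IsStable ρ (X.toSubmodule.map U.subtype) := by
    rintro g _ ⟨x, hx, rfl⟩
    exact ⟨_, X.apply_mem_toSubmodule g hx, rfl⟩
  rcases hU.minimal _ (Submodule.map_subtype_le U _) hst with h | h
  · left
    apply Subrepresentation.toSubmodule_injective
    refine eq_bot_iff.2 fun x hx => ?_
    have hx' : (x : V) ∈ X.toSubmodule.map U.subtype := ⟨x, hx, rfl⟩
    rw [h] at hx'
    exact Subtype.ext hx'
  · right
    apply Subrepresentation.toSubmodule_injective
    refine eq_top_iff.2 fun u _ => ?_
    have hu : (u : V) ∈ X.toSubmodule.map U.subtype := by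
      rw [h]; exact u.2
    obtain ⟨x, hx, hxu⟩ := hu
    rwa [← Subtype.ext hxu]

variable {W : Type*} [AddCommGroup W] [Module ℂ W] [FiniteDimensional ℂ W]
  {σ : Representation ℂ Γ W}

lemma IsStable.range (φ : IntertwiningMap σ ρ) : IsStable ρ (LinearMap.range φ.toLinearMap) := by
  rintro g _ ⟨w, rfl⟩
  exact ⟨σ g w, IntertwiningMap.isIntertwining _ _ φ g w⟩

lemma isMinimalStable_range (hσ : σ.IsIrreducible) {φ : IntertwiningMap σ ρ} (h0 : φ ≠ 0) :
    IsMinimalStable ρ (LinearMap.range φ.toLinearMap) := by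
  refine ⟨IsStable.range φ, fun h => h0 ?_, fun X hX hst => ?_⟩
  · exact IntertwiningMap.ext (LinearMap.range_eq_bot.1 h)
  · let Y : Subrepresentation σ := ⟨X.comap φ.toLinearMap, fun g w hw => by
      have := hst g _ hw
      rw [Submodule.mem_comap]
      exact (IntertwiningMap.isIntertwining _ _ φ g w).symm ▸ this⟩
    rcases eq_bot_or_eq_top Y with h | h
    · left
      rw [eq_bot_iff]
      intro x hx
      obtain ⟨w, rfl⟩ := hX hx
      have : w ∈ Y.toSubmodule := hx
      rw [h] at this
      have hw : w = 0 := this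
      simp [hw]
    · right
      refine le_antisymm hX ?_
      rintro _ ⟨w, rfl⟩
      have : w ∈ Y.toSubmodule := by rw [h]; trivial
      exact this

end Minimal

/-! ### The action of the commutant on a multiplicity space -/

section Multiplicity

open Representation

variable {Γ : Type*} [Group Γ] {V : Type*} [AddCommGroup V] [Module ℂ V] [FiniteDimensional ℂ V]
  {W : Type*} [AddCommGroup W] [Module ℂ W] [FiniteDimensional ℂ W]
  (σ : Representation ℂ Γ W) (ρ : Representation ℂ Γ V)

/-- The retraction extends the action on `Hom(σ, ρ)` to all endomorphisms, linearly in the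
endomorphism. This linearity gives the continuity of `homDet` in `continuous_homDet_glEnd`. -/
lemma exists_retraction_toLinearMapl : ∃ π : (W →ₗ[ℂ] V) →ₗ[ℂ] IntertwiningMap σ ρ,
    π ∘ₗ IntertwiningMap.toLinearMapl σ ρ = LinearMap.id :=
  LinearMap.exists_leftInverse_of_injective _
    (LinearMap.ker_eq_bot.2 (IntertwiningMap.toLinearMap_injective σ ρ))

/-- A linear retraction to the space of intertwining maps. -/
def homRetraction : (W →ₗ[ℂ] V) →ₗ[ℂ] IntertwiningMap σ ρ :=
  (exists_retraction_toLinearMapl σ ρ).choose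

lemma homRetraction_toLinearMap (φ : IntertwiningMap σ ρ) :
    homRetraction σ ρ φ.toLinearMap = φ :=
  LinearMap.congr_fun (exists_retraction_toLinearMapl σ ρ).choose_spec φ

/-- The action of an endomorphism of `V` on the multiplicity space `Hom(σ, ρ)`; it has a meaning
for equivariant endomorphisms only. -/
def homAct (f : Module.End ℂ V) : Module.End ℂ (IntertwiningMap σ ρ) :=
  homRetraction σ ρ ∘ₗ LinearMap.llcomp ℂ W V V f ∘ₗ IntertwiningMap.toLinearMapl σ ρ

/-- The determinant of the action on the multiplicity space. -/
def homDet (f : Module.End ℂ V) : ℂ := LinearMap.det (homAct σ ρ f)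

/-- The composition with an equivariant endomorphism. -/
def equivariantComp {ρ : Representation ℂ Γ V} {f : Module.End ℂ V} (hf : IsEquivariant ρ f)
    {σ : Representation ℂ Γ W} (φ : IntertwiningMap σ ρ) : IntertwiningMap σ ρ where
  toLinearMap := f ∘ₗ φ.toLinearMap
  isIntertwining' g := by
    ext w
    have h1 := IntertwiningMap.isIntertwining _ _ φ g w
    have h2 := congrArg (· (φ w)) (hf g).eq
    simpa [h1] using h2

@[simp] lemma equivariantComp_apply {ρ : Representation ℂ Γ V} {f : Module.End ℂ V}
    (hf : IsEquivariant ρ f) {σ : Representation ℂ Γ W} (φ : IntertwiningMap σ ρ) (w : W) :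
    equivariantComp hf φ w = f (φ w) := rfl

variable {σ ρ}

lemma IntertwiningMap.ext_apply {φ φ' : IntertwiningMap σ ρ} (h : ∀ w, φ w = φ' w) : φ = φ' :=
  DFunLike.ext _ _ h

lemma homAct_eq {f : Module.End ℂ V} (hf : IsEquivariant ρ f) (φ : IntertwiningMap σ ρ) :
    homAct σ ρ f φ = equivariantComp hf φ :=
  homRetraction_toLinearMap σ ρ (equivariantComp hf φ)

lemma homAct_mul {f f' : Module.End ℂ V} (hf : IsEquivariant ρ f) (hf' : IsEquivariant ρ f') :
    homAct σ ρ (f * f') = homAct σ ρ f * homAct σ ρ f' := by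
  ext1 φ
  rw [Module.End.mul_apply, homAct_eq hf', homAct_eq hf, homAct_eq (hf.mul hf')]
  rfl

lemma homDet_mul {f f' : Module.End ℂ V} (hf : IsEquivariant ρ f) (hf' : IsEquivariant ρ f') :
    homDet σ ρ (f * f') = homDet σ ρ f * homDet σ ρ f' := by
  rw [homDet, homAct_mul hf hf', map_mul, homDet, homDet]

lemma homDet_one : homDet σ ρ 1 = 1 := by
  have : homAct σ ρ 1 = 1 := by
    ext1 φ
    rw [homAct_eq IsEquivariant.one]
    rfl
  rw [homDet, this, map_one]

lemma homDet_neg_one : homDet σ ρ (-1) = (-1) ^ Module.finrank ℂ (IntertwiningMap σ ρ) := by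
  have h : IsEquivariant ρ (-1 : Module.End ℂ V) := fun g => (Commute.one_left _).neg_left
  have : homAct σ ρ (-1) = (-1 : ℂ) • 1 := by
    ext1 φ
    rw [homAct_eq h]
    refine IntertwiningMap.ext_apply fun w => ?_
    simp
  rw [homDet, this, LinearMap.det_smul, map_one, mul_one]

lemma homDet_invol_eq_one {P : Module.End ℂ V} (hP : IsEquivariant ρ P)
    (h : ∀ (φ : IntertwiningMap σ ρ) w, P (φ w) = 0) : homDet σ ρ (invol P) = 1 := by
  have : homAct σ ρ (invol P) = 1 := by
    ext1 φ
    rw [homAct_eq hP.invol]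
    refine IntertwiningMap.ext_apply fun w => ?_
    simp [invol, h]
  rw [homDet, this, map_one]

/-- On the multiplicity space `P` acts as a projection to the line of `φ₀`, so `invol P` acts as the
reflection in a line. As a transvection with functional `-2 l ∘ P` and vector `φ₀` it has
determinant `1 - 2`. -/
lemma homDet_invol_eq_neg_one {P : Module.End ℂ V} (hP : IsEquivariant ρ P)
    {φ₀ : IntertwiningMap σ ρ} (h0 : φ₀ ≠ 0) (h1 : ∀ w, P (φ₀ w) = φ₀ w)
    (h : ∀ φ : IntertwiningMap σ ρ, ∃ c : ℂ, ∀ w, P (φ w) = c • φ₀ w) :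
    homDet σ ρ (invol P) = -1 := by
  obtain ⟨l, hl⟩ := LinearMap.exists_leftInverse_of_injective
    (LinearMap.toSpanSingleton ℂ _ φ₀) (LinearMap.ker_toSpanSingleton ℂ h0)
  have hl1 : l φ₀ = 1 := by simpa using LinearMap.congr_fun hl 1
  have hcomp : ∀ φ, equivariantComp hP φ = l (equivariantComp hP φ) • φ₀ := fun φ => by
    obtain ⟨c, hc⟩ := h φ
    have : equivariantComp hP φ = c • φ₀ := IntertwiningMap.ext_apply hc
    rw [this, map_smul, hl1, smul_eq_mul, mul_one]
  have hl0 : l (homAct σ ρ P φ₀) = 1 := by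
    rw [homAct_eq hP, show equivariantComp hP φ₀ = φ₀ from IntertwiningMap.ext_apply h1, hl1]
  have : homAct σ ρ (invol P) = LinearMap.transvection ((-2 : ℂ) • (l ∘ₗ homAct σ ρ P)) φ₀ := by
    ext1 φ
    rw [homAct_eq hP.invol, LinearMap.transvection.apply, LinearMap.smul_apply,
      LinearMap.comp_apply, homAct_eq hP, smul_assoc, ← hcomp]
    refine IntertwiningMap.ext_apply fun w => ?_
    simp [invol, sub_eq_add_neg]
  rw [homDet, this, LinearMap.transvection.det, LinearMap.smul_apply, LinearMap.comp_apply, hl0]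
  norm_num

/-! ### Pairings of multiplicity spaces -/

section Form

variable {B : LinearMap.BilinForm ℂ V} {ε : ℂ} (hB : IsEpsForm B ε) (hρ : IsInvariantForm ρ B)
  {W' : Type*} [AddCommGroup W'] [Module ℂ W'] [FiniteDimensional ℂ W']
  {σ' : Representation ℂ Γ W'} {β : W →ₗ[ℂ] W' →ₗ[ℂ] ℂ}

lemma intertwining_injective (hσ : σ.IsIrreducible) {φ : IntertwiningMap σ ρ} (h0 : φ ≠ 0) :
    Function.Injective φ :=
  (IsIrreducible.injective_or_eq_zero φ).resolve_right h0

include hρ in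
lemma exists_pullback_form_eq (hσ : σ.IsIrreducible) (hσ' : σ'.IsIrreducible)
    (hβ : IsInvariantPairing σ σ' β) (h0 : β ≠ 0)
    (φ : IntertwiningMap σ ρ) (φ' : IntertwiningMap σ' ρ) :
    ∃ c : ℂ, ∀ x y, B (φ x) (φ' y) = c * β x y := by
  refine exists_pairing_eq_smul hσ hσ' hβ
    (β' := B.compl₁₂ φ.toLinearMap φ'.toLinearMap) (fun g x y => ?_) h0
  have h1 := IntertwiningMap.isIntertwining _ _ φ g x
  have h2 := IntertwiningMap.isIntertwining _ _ φ' g y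
  simpa [h1, h2] using hρ g (φ x) (φ' y)

include hB hρ

/-- An embedding of `σ` has a partner for the given pairing. -/
lemma exists_dual_intertwining (hcr : HasProjections ρ) (hσ : σ.IsIrreducible)
    (hβ : IsInvariantPairing σ σ' β) {φ : IntertwiningMap σ ρ} (h0 : φ ≠ 0) :
    ∃ φ' : IntertwiningMap σ' ρ, ∀ x y, B (φ x) (φ' y) = β x y := by
  obtain ⟨R, hRρ, hR, hRφ⟩ := hcr _ (IsStable.range φ)
  have hinj := intertwining_injective hσ h0
  let e := LinearEquiv.ofInjective φ.toLinearMap hinj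
  let r : V →ₗ[ℂ] W := e.symm.toLinearMap ∘ₗ
    R.codRestrict (LinearMap.range φ.toLinearMap) (fun v => hRφ ▸ ⟨v, rfl⟩)
  have hφr : ∀ v, φ (r v) = R v := fun v => by
    have := congrArg Subtype.val (e.apply_symm_apply ⟨R v, hRφ ▸ ⟨v, rfl⟩⟩)
    exact this
  have hrφ : ∀ x, r (φ x) = x := fun x => by
    refine hinj ?_
    rw [hφr]
    exact (mem_range_iff_of_idem hR).1 (hRφ ▸ ⟨x, rfl⟩)
  have hrρ : ∀ g v, r (ρ g v) = σ g (r v) := fun g v => by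
    refine hinj ?_
    rw [hφr, IntertwiningMap.isIntertwining _ _ φ, hφr]
    exact congrArg (· v) (hRρ g).eq
  let D := LinearMap.BilinForm.toDual B hB.nondeg
  -- The vector which represents the functional `β (r ·) y`, where `r` is an equivariant left
  -- inverse of `φ`. The factor `ε` is needed because `toDual` puts the vector in the first argument
  -- of `B`, while the conclusion has it in the second.
  let ψ : W' →ₗ[ℂ] V := ε • (D.symm.toLinearMap ∘ₗ (Module.Dual.transpose (R := ℂ) r) ∘ₗ β.flip)
  have hψ : ∀ y w, B (ψ y) w = ε * β (r w) y := fun y w => by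
    have h1 : D (D.symm (β.flip y ∘ₗ r)) w = β (r w) y := by
      rw [LinearEquiv.apply_symm_apply]; rfl
    rw [← h1]
    have h2 : ψ y = ε • D.symm (β.flip y ∘ₗ r) := rfl
    rw [h2, map_smul]
    rfl
  refine ⟨⟨ψ, fun g => LinearMap.ext fun y => hB.ext_left fun w => ?_⟩, fun x y => ?_⟩
  · have h1 : B (ρ g (ψ y)) w = B (ψ y) (ρ g⁻¹ w) := by
      rw [← hρ g⁻¹]; simp
    rw [LinearMap.comp_apply, LinearMap.comp_apply, h1, hψ, hψ, hrρ,
      ← hβ g (σ g⁻¹ (r w)) y]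
    simp
  · change B (φ x) (ψ y) = _
    rw [hB.symm, hψ, hrφ, ← mul_assoc, hB.sq, one_mul]

/-- Evaluation at vectors with `β x₀ y₀ ≠ 0` pairs the two multiplicity spaces. By
`exists_dual_intertwining` no nonzero `φ` pairs to zero with everything. Used in both directions,
this shows that a representation and its dual have equal multiplicities. -/
lemma finrank_hom_le (hcr : HasProjections ρ) (hσ : σ.IsIrreducible)
    (hβ : IsInvariantPairing σ σ' β) (h0 : β ≠ 0) :
    Module.finrank ℂ (IntertwiningMap σ ρ) ≤ Module.finrank ℂ (IntertwiningMap σ' ρ) := by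
  obtain ⟨x₀, y₀, hxy⟩ := exists_pairing_ne_zero h0
  let b : IntertwiningMap σ ρ →ₗ[ℂ] Module.Dual ℂ (IntertwiningMap σ' ρ) :=
    B.compl₁₂ ((LinearMap.applyₗ x₀) ∘ₗ IntertwiningMap.toLinearMapl σ ρ)
      ((LinearMap.applyₗ y₀) ∘ₗ IntertwiningMap.toLinearMapl σ' ρ)
  have hb : ∀ φ φ', b φ φ' = B (φ x₀) (φ' y₀) := fun _ _ => rfl
  rw [← Subspace.dual_finrank_eq (V := IntertwiningMap σ' ρ)]
  refine LinearMap.finrank_le_finrank_of_injective (f := b) ?_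
  rw [← LinearMap.ker_eq_bot, eq_bot_iff]
  intro φ hφ
  by_contra hne
  obtain ⟨φ', h⟩ := exists_dual_intertwining hB hρ hcr hσ hβ hne
  have : b φ φ' = 0 := by rw [LinearMap.mem_ker.1 hφ]; rfl
  rw [hb, h] at this
  exact hxy this

end Form

/-! ### The form on the multiplicity space of a self-dual constituent -/

section SelfDual

variable {B : LinearMap.BilinForm ℂ V} {ε η : ℂ} (hB : IsEpsForm B ε) (hρ : IsInvariantForm ρ B)
  {β : LinearMap.BilinForm ℂ W} (hβ : IsInvariantForm σ β) (h0 : β ≠ 0)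
  (hη : ∀ x y, β x y = η * β y x) (hcr : HasProjections ρ) (hσ : σ.IsIrreducible)
include hB hρ hβ h0 hη hcr hσ

/-- The form on the multiplicity space of a self-dual irreducible representation. -/
lemma exists_multiplicityForm : ∃ b : LinearMap.BilinForm ℂ (IntertwiningMap σ ρ),
    b.Nondegenerate ∧ (∀ φ φ' x y, B (φ x) (φ' y) = b φ φ' * β x y) ∧
      ∀ φ φ', b φ φ' = ε * η * b φ' φ := by
  obtain ⟨x₀, y₀, hxy⟩ := exists_pairing_ne_zero h0
  let b : LinearMap.BilinForm ℂ (IntertwiningMap σ ρ) := (β x₀ y₀)⁻¹ •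
    B.compl₁₂ ((LinearMap.applyₗ x₀) ∘ₗ IntertwiningMap.toLinearMapl σ ρ)
      ((LinearMap.applyₗ y₀) ∘ₗ IntertwiningMap.toLinearMapl σ ρ)
  have hb : ∀ φ φ', b φ φ' = (β x₀ y₀)⁻¹ * B (φ x₀) (φ' y₀) := fun _ _ => rfl
  have hmul : ∀ φ φ' x y, B (φ x) (φ' y) = b φ φ' * β x y := fun φ φ' x y => by
    obtain ⟨c, hc⟩ := exists_pullback_form_eq hρ hσ hσ hβ h0 φ φ'
    rw [hb, hc, hc]
    field_simp
  have hsymm : ∀ φ φ', b φ φ' = ε * η * b φ' φ := fun φ φ' => by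
    have h1 := hB.symm (φ x₀) (φ' y₀)
    rw [hmul, hmul, hη y₀] at h1
    have h2 : η * η = 1 := by
      have := hη x₀ y₀
      rw [hη y₀, ← mul_assoc] at this
      exact mul_right_cancel₀ hxy (by rw [one_mul]; exact this.symm)
    exact mul_right_cancel₀ hxy (by rw [h1]; ring)
  have hl : b.SeparatingLeft := fun φ hφ => by
    by_contra hne
    obtain ⟨φ', h⟩ := exists_dual_intertwining hB hρ hcr hσ hβ hne
    have := h x₀ y₀
    rw [hmul, hφ, zero_mul] at this
    exact hxy this.symm
  exact ⟨b, ⟨hl, fun φ hφ => hl φ fun φ' => by rw [hsymm, hφ, mul_zero]⟩, hmul, hsymm⟩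

/-- The induced map preserves the multiplicity form, so the Gram determinant is multiplied by the
square of `homDet` and does not change. -/
lemma homDet_mul_self {f : Module.End ℂ V} (hf : IsEquivariant ρ f) (hfi : adj B f * f = 1) :
    homDet σ ρ f * homDet σ ρ f = 1 := by
  obtain ⟨b, hb, hmul, -⟩ := exists_multiplicityForm hB hρ hβ h0 hη hcr hσ
  obtain ⟨x₀, y₀, hxy⟩ := exists_pairing_ne_zero h0
  have hinv : ∀ φ φ', b (homAct σ ρ f φ) (homAct σ ρ f φ') = b φ φ' := fun φ φ' => by
    have h1 := hmul (homAct σ ρ f φ) (homAct σ ρ f φ') x₀ y₀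
    rw [homAct_eq hf, homAct_eq hf, equivariantComp_apply, equivariantComp_apply,
      hB.isometry_iff.1 hfi, hmul] at h1
    rw [homAct_eq hf, homAct_eq hf]
    exact mul_right_cancel₀ hxy h1.symm
  let e := Module.finBasis ℂ (IntertwiningMap σ ρ)
  have hdet := (LinearMap.BilinForm.nondegenerate_iff_det_ne_zero e).1 hb
  have hcomp : b.comp (homAct σ ρ f) (homAct σ ρ f) = b :=
    LinearMap.ext fun φ => LinearMap.ext fun φ' => hinv φ φ'
  have h2 := LinearMap.BilinForm.toMatrix_comp e e b (homAct σ ρ f) (homAct σ ρ f)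
  rw [hcomp] at h2
  have h3 := congrArg Matrix.det h2
  rw [Matrix.det_mul, Matrix.det_mul, Matrix.det_transpose, LinearMap.det_toMatrix] at h3
  refine mul_right_cancel₀ hdet ?_
  rw [one_mul]
  conv_rhs => rw [h3]
  rw [homDet]; ring

/-- The Gram matrix of the multiplicity form is antisymmetric and invertible, which is impossible in
odd size. -/
lemma even_finrank_hom (h : ε * η = -1) : Even (Module.finrank ℂ (IntertwiningMap σ ρ)) := by
  obtain ⟨b, hb, -, hsymm⟩ := exists_multiplicityForm hB hρ hβ h0 hη hcr hσ
  let e := Module.finBasis ℂ (IntertwiningMap σ ρ)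
  have hdet := (LinearMap.BilinForm.nondegenerate_iff_det_ne_zero e).1 hb
  have h1 : (LinearMap.BilinForm.toMatrix e b)ᵀ = -LinearMap.BilinForm.toMatrix e b := by
    ext i j
    rw [Matrix.transpose_apply, Matrix.neg_apply, LinearMap.BilinForm.toMatrix_apply,
      LinearMap.BilinForm.toMatrix_apply, hsymm, h, neg_one_mul]
  have h2 := congrArg Matrix.det h1
  rw [Matrix.det_transpose, Matrix.det_neg, Fintype.card_fin] at h2
  by_contra hodd
  rw [Nat.not_even_iff_odd] at hodd
  rw [hodd.neg_one_pow, neg_one_mul] at h2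
  exact hdet (self_eq_neg.1 h2)

end SelfDual

section Anisotropic

variable {B : LinearMap.BilinForm ℂ V} {ε : ℂ} (hB : IsEpsForm B ε) (hρ : IsInvariantForm ρ B)
include hB hρ

/-- In an anisotropic space an irreducible representation occurs at most once. -/
lemma homDet_invol_of_anisotropic (hσ : σ.IsIrreducible) {P : Module.End ℂ V} (hP : IsSAProj B P)
    (hPρ : IsEquivariant ρ P) (han : IsAnisotropic ρ B (LinearMap.range P))
    {φ : IntertwiningMap σ ρ} (h0 : φ ≠ 0) (hφ : ∀ w, P (φ w) = φ w) :
    homDet σ ρ (invol P) = -1 := by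
  have hle : LinearMap.range φ.toLinearMap ≤ LinearMap.range P := by
    rintro _ ⟨w, rfl⟩; exact ⟨φ w, hφ w⟩
  obtain ⟨P₁, hP₁, hP₁ρ, hP₁φ⟩ := han.exists_isSAProj hB hρ hle (IsStable.range φ)
  have hPP₁ : P * P₁ = P₁ := (range_le_iff_mul hP.idem).1 (hP₁φ ▸ hle)
  have hP₁P := hP.mul_comm_le hB hP₁ hPP₁
  have hfix : ∀ w, P₁ (φ w) = φ w := fun w =>
    (mem_range_iff_of_idem hP₁.idem).1 (hP₁φ ▸ ⟨w, rfl⟩)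
  -- The form which `σ` inherits from this embedding. It is nonzero because the image is not
  -- isotropic.
  let β : LinearMap.BilinForm ℂ W := B.compl₁₂ φ.toLinearMap φ.toLinearMap
  have hβdef : ∀ x y, β x y = B (φ x) (φ y) := fun _ _ => rfl
  have hβ : IsInvariantForm σ β := fun g x y => by
    rw [hβdef, hβdef, IntertwiningMap.isIntertwining _ _ φ, IntertwiningMap.isIntertwining _ _ φ,
      hρ]
  have hne : ∀ {φ : IntertwiningMap σ ρ}, (∀ w, P (φ w) = φ w) →
      (∀ x y, B (φ x) (φ y) = 0) → φ = 0 := fun {φ} h hz => by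
    have := han (LinearMap.range φ.toLinearMap) (by rintro _ ⟨w, rfl⟩; exact ⟨φ w, h w⟩)
      (IsStable.range φ) (by rintro _ ⟨x, rfl⟩ _ ⟨y, rfl⟩; exact hz x y)
    exact IntertwiningMap.ext (LinearMap.range_eq_bot.1 this)
  have hβ0 : β ≠ 0 := fun h => h0 (hne hφ fun x y => by rw [← hβdef, h]; rfl)
  -- every embedding of `σ` in the range of `P` lands in the range of `P₁`
  have hkey : ∀ φ' : IntertwiningMap σ ρ, ∀ w, (P - P₁) (φ' w) = 0 := by
    intro φ'
    let φ₁ := equivariantComp (hPρ.sub hP₁ρ) φ'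
    have hP₁φ₁ : ∀ w, P₁ (φ₁ w) = 0 := fun w => by
      change P₁ ((P - P₁) (φ' w)) = 0
      rw [← Module.End.mul_apply, mul_sub, hP₁P, hP₁.idem, sub_self]; rfl
    have hPφ₁ : ∀ w, P (φ₁ w) = φ₁ w := fun w => by
      change P ((P - P₁) (φ' w)) = (P - P₁) (φ' w)
      rw [← Module.End.mul_apply, mul_sub, hPP₁, hP.idem]
    obtain ⟨c, hc⟩ := exists_pullback_form_eq hρ hσ hσ hβ hβ0 φ₁ φ₁
    have hcross : ∀ x y, B (φ x) (φ₁ y) = 0 := fun x y => by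
      rw [← hfix, ← hP₁.adj, hB.adj_left, hP₁φ₁, map_zero]
    have hcross' : ∀ x y, B (φ₁ x) (φ y) = 0 := fun x y => by
      rw [hB.symm, hcross, mul_zero]
    suffices h : φ₁ = 0 from fun w => congrArg (· w) h
    by_cases hc0 : c = 0
    · exact hne hPφ₁ fun x y => by rw [hc, hc0, zero_mul]
    · exfalso
      -- If `φ₁` pulls the form back to `c β` with `c ≠ 0`, choose `l` with `c l ^ 2 = -1`. Then `φ
      -- + l φ₁` pulls it back to `(1 + c l ^ 2) β = 0`, against anisotropy.
      obtain ⟨l, hl⟩ := IsAlgClosed.exists_pow_nat_eq (-c⁻¹) (n := 2) two_pos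
      have h1 : φ + l • φ₁ = 0 := by
        refine hne (fun w => ?_) fun x y => ?_
        · simp [hφ, hPφ₁]
        · have : c * l ^ 2 = -1 := by rw [hl]; field_simp
          simp only [IntertwiningMap.coe_add, IntertwiningMap.coe_smul, Pi.add_apply,
            Pi.smul_apply, map_add, map_smul, LinearMap.add_apply, LinearMap.smul_apply, hcross,
            hcross', hc, smul_eq_mul, ← hβdef]
          linear_combination (β x y) * this
      apply h0
      refine IntertwiningMap.ext_apply fun w => ?_
      have h2 := congrArg P₁ (congrArg (fun f : IntertwiningMap σ ρ => f w) h1)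
      simpa [hfix, hP₁φ₁] using h2
  have hd1 : homDet σ ρ (invol (P - P₁)) = 1 := homDet_invol_eq_one (hPρ.sub hP₁ρ) hkey
  -- By Schur's lemma `P₁ ∘ φ'` is a multiple of `φ`, so `P₁` acts on the multiplicity space with
  -- rank one.
  have hd2 : homDet σ ρ (invol P₁) = -1 := by
    refine homDet_invol_eq_neg_one hP₁ρ h0 hfix fun φ' => ?_
    have hinj := intertwining_injective hσ h0
    let e := LinearEquiv.ofInjective φ.toLinearMap hinj
    have he : ∀ w, φ w = e w := fun _ => rfl
    have hesymm : ∀ u, φ (e.symm u) = (u : V) := fun u => by rw [he, e.apply_symm_apply]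
    let f : IntertwiningMap σ σ :=
      { toLinearMap := e.symm.toLinearMap ∘ₗ
          (P₁ ∘ₗ φ'.toLinearMap).codRestrict (LinearMap.range φ.toLinearMap)
            (fun v => hP₁φ ▸ ⟨φ' v, rfl⟩)
        isIntertwining' := fun g => LinearMap.ext fun w => hinj (by
          change φ (e.symm _) = φ (σ g (e.symm _))
          rw [IntertwiningMap.isIntertwining _ _ φ, hesymm, hesymm]
          change P₁ (φ' (σ g w)) = ρ g (P₁ (φ' w))
          rw [IntertwiningMap.isIntertwining _ _ φ']
          exact congrArg (· (φ' w)) (hP₁ρ g).eq) }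
    obtain ⟨c, hc⟩ := exists_eq_smul_of_isIrreducible hσ f
    refine ⟨c, fun w => ?_⟩
    have h1 : φ (f w) = P₁ (φ' w) := hesymm _
    rw [← h1, hc, map_smul]
  have hz : P₁ * (P - P₁) = 0 := by rw [mul_sub, hP₁P, hP₁.idem, sub_self]
  have := invol_mul_invol_of_mul_eq_zero hz
  rw [add_sub_cancel] at this
  rw [← this, homDet_mul hP₁ρ.invol (hPρ.sub hP₁ρ).invol, hd1, hd2, mul_one]

end Anisotropic

end Multiplicity

/-! ### Tori which commute with a representation -/

section Torus

open Representation

variable {Γ : Type*} [Group Γ] {V : Type*} [AddCommGroup V] [Module ℂ V] [FiniteDimensional ℂ V]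
  {Z : Type*} [CommGroup Z] {ρ : Representation ℂ Γ V} {f : Representation ℂ Z V}

/-- The representation of `Γ × Z` given by commuting representations of `Γ` and `Z`. -/
def prodRep (h : ∀ g z, Commute (ρ g) (f z)) : Representation ℂ (Γ × Z) V :=
  MonoidHom.noncommCoprod ρ f h

variable (h : ∀ g z, Commute (ρ g) (f z))

lemma prodRep_apply (g : Γ) (z : Z) : prodRep h (g, z) = ρ g * f z := rfl

lemma isStable_prodRep_iff {W : Submodule ℂ V} :
    IsStable (prodRep h) W ↔ IsStable ρ W ∧ IsStable f W := by
  refine ⟨fun hW => ⟨fun g v hv => ?_, fun z v hv => ?_⟩, fun hW p v hv => ?_⟩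
  · simpa [prodRep_apply] using hW (g, 1) v hv
  · simpa [prodRep_apply] using hW (1, z) v hv
  · exact hW.1 p.1 _ (hW.2 p.2 v hv)

lemma isEquivariant_prodRep_iff {P : Module.End ℂ V} :
    IsEquivariant (prodRep h) P ↔ IsEquivariant ρ P ∧ IsEquivariant f P := by
  refine ⟨fun hW => ⟨fun g => ?_, fun z => ?_⟩, fun hW p => ?_⟩
  · simpa [prodRep_apply] using hW (g, 1)
  · simpa [prodRep_apply] using hW (1, z)
  · exact (hW.1 p.1).mul_right (hW.2 p.2)

variable {B : LinearMap.BilinForm ℂ V} {ε : ℂ} (hB : IsEpsForm B ε) (hρ : IsInvariantForm ρ B)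
  (hf : IsInvariantForm f B)

include hρ hf in
lemma isInvariantForm_prodRep : IsInvariantForm (prodRep h) B := fun p x y => by
  change B (ρ p.1 (f p.2 x)) (ρ p.1 (f p.2 y)) = _
  rw [hρ, hf]

/-- As `Z` is commutative and commutes with `Γ`, the operator `f z` is an endomorphism of an
irreducible representation of `Γ × Z`. -/
lemma IsMinimalStable.exists_smul {U : Submodule ℂ V} (hU : IsMinimalStable (prodRep h) U) (z : Z) :
    ∃ c : ℂ, ∀ u ∈ U, f z u = c • u := by
  have hst := (isStable_prodRep_iff h).1 hU.stable
  let e : IntertwiningMap (subRep hU.stable) (subRep hU.stable) :=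
    { toLinearMap := (f z).restrict (fun u hu => hst.2 z u hu)
      isIntertwining' := fun p => by
        ext u
        change f z (ρ p.1 (f p.2 u)) = ρ p.1 (f p.2 (f z u))
        have h1 : f z * (ρ p.1 * f p.2) = ρ p.1 * f p.2 * f z := by
          rw [← mul_assoc, ← (h p.1 z).eq, mul_assoc, mul_assoc, ← map_mul, ← map_mul, mul_comm]
        exact congrArg (· (u : V)) h1 }
  obtain ⟨c, hc⟩ := exists_eq_smul_of_isIrreducible hU.isIrreducible e
  exact ⟨c, fun u hu => congrArg Subtype.val (hc ⟨u, hu⟩)⟩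

include hB hρ hf in
/-- A divisible group acts trivially on an anisotropic space. -/
lemma apply_mul_eq_of_anisotropic (hdiv : ∀ z : Z, ∃ w, w * w = z) {P : Module.End ℂ V}
    (hP : IsSAProj B P) (hPρ : IsEquivariant (prodRep h) P)
    (han : IsAnisotropic (prodRep h) B (LinearMap.range P)) (z : Z) : f z * P = P := by
  have hinv := isInvariantForm_prodRep h hρ hf
  let X : Submodule ℂ V := LinearMap.range P ⊓ ⨅ z, LinearMap.ker (f z - 1)
  have hXmem : ∀ {v}, v ∈ X ↔ v ∈ LinearMap.range P ∧ ∀ z, f z v = v := by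
    intro v
    simp [X, Submodule.mem_iInf, sub_eq_zero]
  have hXst : IsStable (prodRep h) X := by
    intro p v hv
    have hv' := hXmem.1 hv
    refine hXmem.2 ⟨hPρ.isStable_range p v hv'.1, fun z => ?_⟩
    change f z (ρ p.1 (f p.2 v)) = ρ p.1 (f p.2 v)
    rw [hv'.2]
    have := congrArg (· v) (h p.1 z).eq
    simp only [Module.End.mul_apply, hv'.2] at this
    exact this.symm
  obtain ⟨P₁, hP₁, hP₁ρ, hP₁X⟩ : ∃ P₁, IsSAProj B P₁ ∧ IsEquivariant (prodRep h) P₁ ∧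
      LinearMap.range P₁ = X := han.exists_isSAProj hB hinv inf_le_left hXst
  have hPP₁ : P * P₁ = P₁ := (range_le_iff_mul hP.idem).1 (hP₁X ▸ inf_le_left)
  have hP₁P := hP.mul_comm_le hB hP₁ hPP₁
  have hd := hP.sub hB hP₁ hPP₁
  -- `P₁` projects to the fixed vectors in the range of `P`; it remains to exclude a minimal stable
  -- subspace `U` in their orthogonal complement.
  suffices h0 : LinearMap.range (P - P₁) = ⊥ by
    have h1 : P = P₁ := sub_eq_zero.1 (LinearMap.range_eq_bot.1 h0)
    ext v
    have : P v ∈ X := by rw [← hP₁X, ← h1]; exact ⟨v, rfl⟩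
    exact (hXmem.1 this).2 z
  by_contra hne
  obtain ⟨U, hUle, hU⟩ := exists_isMinimalStable (hPρ.sub hP₁ρ).isStable_range hne
  have hUP : U ≤ LinearMap.range P := hUle.trans ((range_le_iff_mul hP.idem).2 (by
    rw [mul_sub, hP.idem, hPP₁]))
  have hni : ¬ IsIsotropic B U := fun hi => hU.ne_bot (han U hUP hU.stable hi)
  rw [IsIsotropic] at hni
  push Not at hni
  obtain ⟨x, hx, y, hy, hxy⟩ := hni
  apply hU.ne_bot
  rw [eq_bot_iff]
  intro u hu
  have huX : u ∈ X := by
    refine hXmem.2 ⟨hUP hu, fun z => ?_⟩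
    -- The square root `w` of `z` acts on `U` by a scalar `c`. As the form is invariant and nonzero
    -- on `U`, `c * c = 1`, so `z` acts trivially.
    obtain ⟨w, rfl⟩ := hdiv z
    obtain ⟨c, hc⟩ := IsMinimalStable.exists_smul h hU w
    have h1 := hf w x y
    rw [hc x hx, hc y hy, map_smul, map_smul, LinearMap.smul_apply, smul_eq_mul, smul_eq_mul,
      ← mul_assoc] at h1
    have h2 : c * c = 1 := mul_right_cancel₀ hxy (by rw [h1, one_mul])
    rw [map_mul, Module.End.mul_apply, hc u hu, map_smul, hc u hu, smul_smul, h2, one_smul]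
  rw [← hP₁X, mem_range_iff_of_idem hP₁.idem] at huX
  have h3 := (mem_range_iff_of_idem hd.idem).1 (hUle hu)
  rw [Submodule.mem_bot, ← huX, ← h3, ← Module.End.mul_apply, mul_sub, hP₁P, hP₁.idem, sub_self]
  rfl

/-- A torus of isometries in `K` which act trivially on the kernel of `P`, and which contains the
restrictions of the operators `f z` to the range of `P`. -/
structure IsSplitTorus (f : Representation ℂ Z V) (K : Submonoid (Module.End ℂ V))
    (P : Module.End ℂ V) {n : ℕ} (t : (Fin n → ℂˣ) →* Module.End ℂ V) : Prop where
  inj : Function.Injective t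
  mem : ∀ y, t y ∈ K
  left : ∀ y, P * (t y - 1) = t y - 1
  right : ∀ y, (t y - 1) * P = t y - 1
  -- This makes the matrix entries polynomials in the coordinates and their inverses, as the
  -- definition of a torus requires.
  linear : ∃ Q Q' : Fin n → Module.End ℂ V, ∀ y, t y =
    1 + ∑ a, (((y a : ℂ) - 1) • Q a + (((y a)⁻¹ : ℂˣ) - 1 : ℂ) • Q' a)
  fits : ∀ z, ∃ y, t y = 1 + P * (f z - 1)

-- Invariance of the form forces inverse scalars on two subspaces that it pairs.
include hB hρ hf in
lemma apply_mul_adj_eq {Q : Module.End ℂ V} (hQρ : IsEquivariant f Q) {z : Z} {c : ℂˣ}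
    (hz : f z * Q = (c : ℂ) • Q) : f z * adj B Q = (c : ℂ)⁻¹ • adj B Q := by
  have h1 : Q * f z = (c : ℂ) • Q := by rw [(hQρ z).eq, hz]
  have h2 := congrArg (adj B) h1
  rw [hB.adj_mul, hB.adj_smul, adj_rep hB hf] at h2
  have h3 : adj B Q = (c : ℂ) • (f z * adj B Q) := by
    rw [← mul_smul_comm, ← h2, ← mul_assoc, ← map_mul, mul_inv_cancel, map_one, one_mul]
  rw [h3, smul_smul, inv_mul_cancel₀ c.ne_zero, one_smul]
  rw [← h3]

-- The hyperbolic space of `Q` is orthogonal to the range of `P - (Q + adj B Q)`. So the scalings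
-- commute with the torus `t`, and the product is a torus with one more coordinate, placed at index
-- `0`.
include hB hρ hf in
lemma exists_isSplitTorus_succ {K : Submonoid (Module.End ℂ V)}
    {P Q : Module.End ℂ V} (hP : IsSAProj B P)
    (hQ : IsHyp B Q) (hQρ : IsEquivariant (prodRep h) Q) (hQ0 : Q ≠ 0)
    (hK : ∀ z, hypScale B Q z ∈ K)
    (hPQ : P * Q = Q) (hPQ' : P * adj B Q = adj B Q) (hsc : ∀ z, ∃ c : ℂ, f z * Q = c • Q) {n : ℕ}
    {t : (Fin n → ℂˣ) →* Module.End ℂ V} (ht : IsSplitTorus f K (P - (Q + adj B Q)) t) :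
    ∃ t' : (Fin (n + 1) → ℂˣ) →* Module.End ℂ V, IsSplitTorus f K P t' ∧
      ∀ w, hypScale B Q w ∈ Set.range t' := by
  have hinv := isInvariantForm_prodRep h hρ hf
  set P₁ := P - (Q + adj B Q) with hP₁
  have hH := hQ.isSAProj hB
  have hle : P * (Q + adj B Q) = Q + adj B Q := by rw [mul_add, hPQ, hPQ']
  have hQP : Q * P = Q := by
    have := congrArg (adj B) hPQ'
    rwa [hB.adj_mul, hB.adj_adj, hP.adj] at this
  have hQ'P : adj B Q * P = adj B Q := by
    have := congrArg (adj B) hPQ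
    rwa [hB.adj_mul, hP.adj] at this
  have hQP₁ : Q * P₁ = 0 := by
    rw [hP₁, mul_sub, mul_add, hQP, hQ.idem, hQ.mul_adj, add_zero, sub_self]
  have hQ'P₁ : adj B Q * P₁ = 0 := by
    rw [hP₁, mul_sub, mul_add, hQ'P, hQ.adj_mul, hQ.adj_idem hB, zero_add, sub_self]
  have hP₁Q : P₁ * Q = 0 := by
    rw [hP₁, sub_mul, add_mul, hPQ, hQ.idem, hQ.adj_mul, add_zero, sub_self]
  have hP₁Q' : P₁ * adj B Q = 0 := by
    rw [hP₁, sub_mul, add_mul, hPQ', hQ.adj_idem hB, hQ.mul_adj, zero_add, sub_self]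
  have hPP₁ : P * P₁ = P₁ := by rw [hP₁, mul_sub, hP.idem, hle]
  have hP₁P : P₁ * P = P₁ := by rw [hP₁, sub_mul, add_mul, hP.idem, hQP, hQ'P]
  have e1 : ∀ y, Q * (t y - 1) = 0 := fun y => by rw [← ht.left, ← mul_assoc, hQP₁, zero_mul]
  have e2 : ∀ y, adj B Q * (t y - 1) = 0 := fun y => by
    rw [← ht.left, ← mul_assoc, hQ'P₁, zero_mul]
  have e3 : ∀ y, (t y - 1) * Q = 0 := fun y => by rw [← ht.right, mul_assoc, hP₁Q, mul_zero]
  have e4 : ∀ y, (t y - 1) * adj B Q = 0 := fun y => by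
    rw [← ht.right, mul_assoc, hP₁Q', mul_zero]
  -- The two factors differ from `1` on orthogonal subspaces only, so their product is additive in
  -- the differences from `1`.
  have e5 : ∀ x y, hypScale B Q x * t y = hypScale B Q x + (t y - 1) := fun x y => by
    have : t y = 1 + (t y - 1) := by abel
    conv_lhs => rw [this]
    simp only [mul_add, mul_one, hypScale, add_mul, smul_mul_assoc, e1, e2, one_mul]
    module
  have e6 : ∀ x y, t y * hypScale B Q x = hypScale B Q x + (t y - 1) := fun x y => by
    have : t y = 1 + (t y - 1) := by abel
    conv_lhs => rw [this]
    simp only [add_mul, one_mul, hypScale, mul_add, mul_smul_comm, e3, e4, mul_one]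
    module
  have hmul : ∀ x x' : Fin (n + 1) → ℂˣ, hypScale B Q ((x * x') 0) * t (Fin.tail (x * x')) =
      hypScale B Q (x 0) * t (Fin.tail x) * (hypScale B Q (x' 0) * t (Fin.tail x')) := by
    intro x x'
    have h1 : t (Fin.tail (x * x')) = t (Fin.tail x) * t (Fin.tail x') := by
      rw [← map_mul]; rfl
    rw [h1, Pi.mul_apply, hypScale_mul hB hQ, mul_assoc, mul_assoc,
      ← mul_assoc (hypScale B Q (x' 0)), e5, ← e6, mul_assoc]
  let t' : (Fin (n + 1) → ℂˣ) →* Module.End ℂ V :=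
    { toFun := fun x => hypScale B Q (x 0) * t (Fin.tail x)
      map_one' := by
        have h1 : Fin.tail (1 : Fin (n + 1) → ℂˣ) = 1 := rfl
        rw [h1, map_one, Pi.one_apply, hypScale_one hB, mul_one]
      map_mul' := hmul }
  have ht' : ∀ x, t' x = hypScale B Q (x 0) * t (Fin.tail x) := fun _ => rfl
  have hcons : ∀ x y, t' (Fin.cons x y) = hypScale B Q x * t y := fun x y => by
    rw [ht', Fin.cons_zero, Fin.tail_cons]
  have hPsc : ∀ x, P * (hypScale B Q x - 1) = hypScale B Q x - 1 := fun x => by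
    simp only [hypScale, mul_add, mul_sub, mul_one, mul_smul_comm, hPQ, hPQ']
    abel
  have hscP : ∀ x, (hypScale B Q x - 1) * P = hypScale B Q x - 1 := fun x => by
    simp only [hypScale, add_mul, sub_mul, one_mul, smul_mul_assoc, hQP, hQ'P]
    abel
  have hsplit : ∀ x, t' x - 1 = (hypScale B Q (x 0) - 1) + (t (Fin.tail x) - 1) := fun x => by
    rw [ht', e5]; abel
  refine ⟨t', ⟨?_, fun y => ?_, fun y => ?_, fun y => ?_, ?_, fun z => ?_⟩, fun w => ?_⟩
  · rw [injective_iff_map_eq_one]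
    intro x hx
    have h1 : (x 0 : ℂ) • Q = Q := by
      have h2 := congrArg (· * Q) hx
      simp only [ht', e5, add_mul, e3, hypScale_mul_self hB hQ, add_zero, one_mul] at h2
      exact h2
    have hx0 : x 0 = 1 := by
      have h2 : ((x 0 : ℂ) - 1) • Q = 0 := by rw [sub_smul, h1, one_smul, sub_self]
      have h3 := (smul_eq_zero.1 h2).resolve_right hQ0
      exact Units.ext (sub_eq_zero.1 h3)
    rw [ht', hx0, hypScale_one hB, one_mul] at hx
    have h4 := (injective_iff_map_eq_one t).1 ht.inj _ hx
    funext i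
    refine Fin.cases hx0 (fun j => ?_) i
    exact congrFun h4 j
  · exact K.mul_mem (hK _) (ht.mem _)
  · have h1 := ht.left (Fin.tail y)
    rw [hsplit, mul_add, hPsc]
    congr 1
    conv_lhs => rw [← h1]
    rw [← mul_assoc, hPP₁, h1]
  · have h1 := ht.right (Fin.tail y)
    rw [hsplit, add_mul, hscP]
    congr 1
    conv_lhs => rw [← h1]
    rw [mul_assoc, hP₁P, h1]
  · obtain ⟨q, q', hq⟩ := ht.linear
    refine ⟨Fin.cons Q q, Fin.cons (adj B Q) q', fun y => ?_⟩
    rw [ht', e5, hq, Fin.sum_univ_succ]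
    simp only [Fin.cons_zero, Fin.cons_succ, hypScale, Fin.tail, Units.val_inv_eq_inv_val]
    abel
  · obtain ⟨y, hy⟩ := ht.fits z
    obtain ⟨c, hc⟩ := hsc z
    have hc0 : c ≠ 0 := by
      rintro rfl
      apply hQ0
      have := congrArg (f z⁻¹ * ·) hc
      simpa [← mul_assoc, ← map_mul] using this
    have hc' := apply_mul_adj_eq hB hρ hf ((isEquivariant_prodRep_iff h).1 hQρ).2
      (c := Units.mk0 c hc0) hc
    have hcm : Q * f z = c • Q := by
      rw [(((isEquivariant_prodRep_iff h).1 hQρ).2 z).eq, hc]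
    have hcm' : adj B Q * f z = c⁻¹ • adj B Q := by
      rw [((((isEquivariant_prodRep_iff h).1 (hQρ.adj hB hinv)).2 z)).eq, hc']
      rfl
    -- The new coordinate is the scalar by which `f z` acts on the range of `Q`.
    refine ⟨Fin.cons (Units.mk0 c hc0) y, ?_⟩
    rw [hcons, e5, hy]
    have : P = P₁ + (Q + adj B Q) := by rw [hP₁]; abel
    rw [this]
    simp only [hypScale, add_mul, mul_sub, mul_one, hcm, hcm', Units.val_mk0]
    module
  · exact ⟨Fin.cons w 1, by rw [hcons, map_one, mul_one]⟩

-- Hyperbolic spaces are split off one at a time, by induction on the rank of `P`. On an anisotropic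
-- remainder the divisible group acts trivially, so the torus of rank zero suffices there.
include hB hρ hf in
lemma exists_isSplitTorus (hcr : HasProjections (prodRep h)) (hdiv : ∀ z : Z, ∃ w, w * w = z)
    {K : Submonoid (Module.End ℂ V)}
    (hK : ∀ Q, IsHyp B Q → IsEquivariant (prodRep h) Q → ∀ z, hypScale B Q z ∈ K)
    {P : Module.End ℂ V} (hP : IsSAProj B P) (hPρ : IsEquivariant (prodRep h) P) :
    ∃ (n : ℕ) (t : (Fin n → ℂˣ) →* Module.End ℂ V), IsSplitTorus f K P t := by
  have hinv := isInvariantForm_prodRep h hρ hf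
  induction hn : Module.finrank ℂ (LinearMap.range P) using Nat.strong_induction_on
    generalizing P with
  | _ n ih =>
  by_cases han : IsAnisotropic (prodRep h) B (LinearMap.range P)
  · refine ⟨0, 1, ⟨fun _ _ _ => Subsingleton.elim _ _, fun y => K.one_mem, by simp, by simp,
      ⟨fun _ => 0, fun _ => 0, fun y => by simp⟩, fun z => ⟨1, ?_⟩⟩⟩
    have h1 := apply_mul_eq_of_anisotropic h hB hρ hf hdiv hP hPρ han z
    rw [← (((isEquivariant_prodRep_iff h).1 hPρ).2 z).eq] at h1
    simp [mul_sub, h1]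
  · rw [IsAnisotropic] at han
    push Not at han
    obtain ⟨U₀, hUP₀, hU₀, hiso₀, hne₀⟩ := han
    -- Minimality for `Γ × Z` is needed so that each `f z` acts on `U` by a scalar.
    obtain ⟨U, hUU₀, hU⟩ := exists_isMinimalStable hU₀ hne₀
    have hUP := hUU₀.trans hUP₀
    have hiso : IsIsotropic B U := fun x hx y hy => hiso₀ x (hUU₀ hx) y (hUU₀ hy)
    obtain ⟨Q, hQ, hQρ, hQU, hPQ, hPQ'⟩ := exists_isHyp hB hinv hcr hP hPρ hU.stable hUP hiso
    have hH := hQ.isSAProj hB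
    have hle : P * (Q + adj B Q) = Q + adj B Q := by rw [mul_add, hPQ, hPQ']
    have h1 := hP.sub hB hH hle
    have h1ρ : IsEquivariant (prodRep h) (P - (Q + adj B Q)) :=
      hPρ.sub (hQρ.add (hQρ.adj hB hinv))
    have h1P : P * (P - (Q + adj B Q)) = P - (Q + adj B Q) := by rw [mul_sub, hP.idem, hle]
    have hz : (P - (Q + adj B Q)) * Q = 0 := by
      rw [sub_mul, hPQ, add_mul, hQ.idem, hQ.adj_mul, add_zero, sub_self]
    have hQ0 : Q ≠ 0 := by
      rintro rfl
      exact hU.ne_bot (by rw [← hQU, LinearMap.range_zero])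
    have hlt : Module.finrank ℂ (LinearMap.range (P - (Q + adj B Q))) < n := by
      rw [← hn]
      refine Submodule.finrank_lt_finrank_of_lt (lt_of_le_of_ne ?_ fun he => hQ0 ?_)
      · exact (range_le_iff_mul hP.idem).2 h1P
      · have h2 := (range_le_iff_mul h1.idem).1 (he ▸ hQU ▸ hUP)
        rw [hz] at h2
        exact h2.symm
    obtain ⟨m, t, ht⟩ := ih _ hlt h1 h1ρ rfl
    obtain ⟨t', ht', -⟩ := exists_isSplitTorus_succ h hB hρ hf hP hQ hQρ hQ0 (hK Q hQ hQρ)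
      hPQ hPQ' (fun z => by
        obtain ⟨c, hc⟩ := IsMinimalStable.exists_smul h hU z
        refine ⟨c, LinearMap.ext fun v => hc _ (hQU ▸ ⟨v, rfl⟩)⟩) ht
    exact ⟨m + 1, t', ht'⟩

include hB hρ hf in
/-- The torus generated by the `f z` and a one-parameter group which commutes with them is contained
in a torus. -/
lemma exists_isSplitTorus_of_isHyp (hcr : HasProjections (prodRep h))
    (hdiv : ∀ z : Z, ∃ w, w * w = z) {K : Submonoid (Module.End ℂ V)}
    (hK : ∀ Q, IsHyp B Q → IsEquivariant (prodRep h) Q → ∀ z, hypScale B Q z ∈ K)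
    {Q : Module.End ℂ V} (hQ : IsHyp B Q) (hQρ : IsEquivariant (prodRep h) Q) (hQ0 : Q ≠ 0)
    (hsc : ∀ z, ∃ c : ℂ, f z * Q = c • Q) :
    ∃ (n : ℕ) (t : (Fin n → ℂˣ) →* Module.End ℂ V), IsSplitTorus f K 1 t ∧
      ∀ w, hypScale B Q w ∈ Set.range t := by
  have hinv := isInvariantForm_prodRep h hρ hf
  obtain ⟨n, t, ht⟩ := exists_isSplitTorus h hB hρ hf hcr hdiv hK
    ((IsSAProj.one hB).sub hB (hQ.isSAProj hB) (one_mul _))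
    (IsEquivariant.one.sub (hQρ.add (hQρ.adj hB hinv)))
  exact ⟨n + 1, exists_isSplitTorus_succ h hB hρ hf (IsSAProj.one hB) hQ hQρ hQ0 (hK Q hQ hQρ)
    (one_mul _) (one_mul _) hsc ht⟩

end Torus

/-! ### Component characters of the group of equivariant isometries -/

section Components

open Representation

variable {Γ : Type*} [Group Γ] {V : Type*} [AddCommGroup V] [Module ℂ V] [FiniteDimensional ℂ V]

/-- A monoid of equivariant isometries which contains those without the eigenvalue `-1`. -/
structure IsCayleyMonoid (ρ : Representation ℂ Γ V) (B : LinearMap.BilinForm ℂ V)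
    (K : Submonoid (Module.End ℂ V)) : Prop where
  equivariant : ∀ κ ∈ K, IsEquivariant ρ κ
  isometry : ∀ κ ∈ K, adj B κ * κ = 1
  cayley : ∀ g, IsEquivariant ρ g → adj B g * g = 1 → (∀ v, g v = -v → v = 0) → g ∈ K

variable {J : Type*} {W : J → Type*} [∀ j, AddCommGroup (W j)] [∀ j, Module ℂ (W j)]
  [∀ j, FiniteDimensional ℂ (W j)]

/-- A complete family of pairwise inequivalent irreducible representations which occur in `ρ` in
nondegenerate subspaces. -/
structure IsTypeFamily (ρ : Representation ℂ Γ V) (B : LinearMap.BilinForm ℂ V) (ε : ℂ)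
    (σ : ∀ j, Representation ℂ Γ (W j)) (β : ∀ j, LinearMap.BilinForm ℂ (W j)) : Prop where
  irreducible : ∀ j, (σ j).IsIrreducible
  not_equiv : ∀ i j, i ≠ j → IsEmpty ((σ i).Equiv (σ j))
  invariant : ∀ j, IsInvariantForm (σ j) (β j)
  ne_zero : ∀ j, β j ≠ 0
  symm : ∀ j x y, β j x y = ε * β j y x
  complete : ∀ U, IsMinimalStable ρ U → ¬ IsIsotropic B U →
    ∃ j, ∃ φ : IntertwiningMap (σ j) ρ, φ ≠ 0 ∧ ∀ w, φ w ∈ U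

variable {ρ : Representation ℂ Γ V} {B : LinearMap.BilinForm ℂ V} {ε : ℂ}
  {σ : ∀ j, Representation ℂ Γ (W j)} {β : ∀ j, LinearMap.BilinForm ℂ (W j)}
  {K : Submonoid (Module.End ℂ V)}
  (hB : IsEpsForm B ε) (hρ : IsInvariantForm ρ B) (hK : IsCayleyMonoid ρ B K)
  (hσ : IsTypeFamily ρ B ε σ β)

-- The possible eigenvalues of the scaling are `z`, `z⁻¹` and `1`, so for `z ≠ -1` the Cayley
-- condition applies. The scaling by `-1` is the square of the scaling by `Complex.I`.
include hB hρ hK in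
lemma IsCayleyMonoid.hypScale_mem {Q : Module.End ℂ V} (hQ : IsHyp B Q) (hQρ : IsEquivariant ρ Q)
    (z : ℂˣ) : hypScale B Q z ∈ K := by
  have key : ∀ z : ℂˣ, z ≠ -1 → hypScale B Q z ∈ K := fun z hz => by
    refine hK.cayley _ (hQρ.hypScale hB hρ z) (hypScale_isometry hB hQ z) fun v hv => ?_
    have hz1 : (z : ℂ) + 1 ≠ 0 := fun h => hz (Units.ext (by
      rw [Units.val_neg, Units.val_one]; linear_combination h))
    have hz2 : (z : ℂ)⁻¹ + 1 ≠ 0 := fun h => hz1 (by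
      have h0 := z.ne_zero
      field_simp at h
      linear_combination h)
    have e1 : Q * hypScale B Q z = (z : ℂ) • Q := by
      simp only [hypScale, mul_add, mul_one, mul_smul_comm, hQ.idem, hQ.mul_adj]
      module
    have e2 : adj B Q * hypScale B Q z = (z : ℂ)⁻¹ • adj B Q := by
      simp only [hypScale, mul_add, mul_one, mul_smul_comm, hQ.adj_idem hB, hQ.adj_mul]
      module
    have h1 : Q v = 0 := by
      have := congrArg (· v) e1
      simp only [Module.End.mul_apply, hv, map_neg, LinearMap.smul_apply] at this
      refine (smul_eq_zero.1 (?_ : ((z : ℂ) + 1) • Q v = 0)).resolve_left hz1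
      rw [add_smul, ← this, one_smul, neg_add_cancel]
    have h2 : adj B Q v = 0 := by
      have := congrArg (· v) e2
      simp only [Module.End.mul_apply, hv, map_neg, LinearMap.smul_apply] at this
      refine (smul_eq_zero.1 (?_ : ((z : ℂ)⁻¹ + 1) • adj B Q v = 0)).resolve_left hz2
      rw [add_smul, ← this, one_smul, neg_add_cancel]
    simp only [hypScale, LinearMap.add_apply, Module.End.one_apply, LinearMap.smul_apply, h1, h2,
      smul_zero, add_zero] at hv
    refine (smul_eq_zero.1 (?_ : (2 : ℂ) • v = 0)).resolve_left two_ne_zero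
    rw [two_smul]
    nth_rw 1 [hv]
    exact neg_add_cancel v
  by_cases hz : z = -1
  · have hI : Complex.I ≠ 0 := Complex.I_ne_zero
    have h1 : z = Units.mk0 Complex.I hI * Units.mk0 Complex.I hI := by
      rw [hz]
      ext
      simp
    rw [h1, hypScale_mul hB hQ]
    have h2 : Units.mk0 Complex.I hI ≠ -1 := fun h => by
      have := congrArg (fun u : ℂˣ => (u : ℂ).im) h
      simp at this
    exact K.mul_mem (key _ h2) (key _ h2)
  · exact key z hz

/-- A minimal stable subspace which is not isotropic is anisotropic. -/
lemma IsMinimalStable.isAnisotropic {U : Submodule ℂ V} (hU : IsMinimalStable ρ U)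
    (h : ¬ IsIsotropic B U) : IsAnisotropic ρ B U := fun X hX hst hiso =>
  (hU.minimal X hX hst).resolve_right fun he => h (he ▸ hiso)

lemma IsAnisotropic.mono {U U' : Submodule ℂ V} (h : IsAnisotropic ρ B U) (hle : U' ≤ U) :
    IsAnisotropic ρ B U' := fun X hX => h X (hX.trans hle)

-- The range of `P` is one copy of `σ i`. By Schur's lemma `P` kills every embedding of an
-- inequivalent `σ j`.
include hB hρ hσ in
lemma homDet_invol_of_range_eq {i j : J} {P : Module.End ℂ V} (hP : IsSAProj B P)
    (hPρ : IsEquivariant ρ P) {φ : IntertwiningMap (σ i) ρ} (h0 : φ ≠ 0)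
    (hrange : LinearMap.range P = LinearMap.range φ.toLinearMap)
    (han : IsAnisotropic ρ B (LinearMap.range P)) [Decidable (j = i)] :
    homDet (σ j) ρ (invol P) = if j = i then -1 else 1 := by
  have hfix : ∀ w, P (φ w) = φ w := fun w =>
    (mem_range_iff_of_idem hP.idem).1 (hrange ▸ ⟨w, rfl⟩)
  split_ifs with hij
  · subst hij
    exact homDet_invol_of_anisotropic hB hρ (hσ.irreducible _) hP hPρ han h0 hfix
  · refine homDet_invol_eq_one hPρ fun φ' w => ?_
    by_contra hne
    have hinj := intertwining_injective (hσ.irreducible i) h0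
    let e := LinearEquiv.ofInjective φ.toLinearMap hinj
    have he : ∀ w, φ w = e w := fun _ => rfl
    have hesymm : ∀ u, φ (e.symm u) = (u : V) := fun u => by rw [he, e.apply_symm_apply]
    let f : IntertwiningMap (σ j) (σ i) :=
      { toLinearMap := e.symm.toLinearMap ∘ₗ
          (P ∘ₗ φ'.toLinearMap).codRestrict (LinearMap.range φ.toLinearMap)
            (fun v => hrange ▸ ⟨φ' v, rfl⟩)
        isIntertwining' := fun g => LinearMap.ext fun w => hinj (by
          change φ (e.symm _) = φ (σ i g (e.symm _))
          rw [IntertwiningMap.isIntertwining _ _ φ, hesymm, hesymm]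
          change P (φ' (σ j g w)) = ρ g (P (φ' w))
          rw [IntertwiningMap.isIntertwining _ _ φ']
          exact congrArg (· (φ' w)) (hPρ g).eq) }
    have hf : ∀ w, φ (f w) = P (φ' w) := fun w => hesymm _
    have := hσ.irreducible i
    have := hσ.irreducible j
    rcases IsIrreducible.bijective_or_eq_zero f with h | h
    · exact (hσ.not_equiv j i hij).false (f.ofBijective h)
    · apply hne
      rw [← hf, h]
      simp

include hB hρ hK hσ in
/-- The component characters detect the monoid `K`. -/
lemma mem_of_homDet_eq_one (hcr : HasProjections ρ)
    (hK1 : ∀ j, ∀ κ ∈ K, homDet (σ j) ρ κ = 1) {g : Module.End ℂ V}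
    (hg : IsEquivariant ρ g) (hgi : adj B g * g = 1) (h1 : ∀ j, homDet (σ j) ρ g = 1) : g ∈ K := by
  -- Multiplied by the reflection in its eigenspace for `-1`, `g` falls under the Cayley condition.
  -- So modulo `K` it equals `invol P`, and then `invol P₀` with anisotropic `P₀`.
  obtain ⟨P, hP, hPg, hPe⟩ := exists_isSAProj_eigen hB hgi
  have hPρ : IsEquivariant ρ P := fun x => hPg _ (hg x).symm
  have hmem : g * invol P ∈ K := by
    refine hK.cayley _ (hg.mul hPρ.invol) ?_ hPe
    rw [hB.adj_mul, adj_invol hB hP, mul_assoc, ← mul_assoc _ g, hgi, one_mul,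
      invol_mul_invol hP.idem]
  obtain ⟨P₀, hP₀, hP₀ρ, hPP₀, han, κ, hκ, he⟩ := exists_invol_eq_mul_invol hB hρ hcr K
    (fun Q hQ hQρ z => hK.hypScale_mem hB hρ hQ hQρ z) hP hPρ
  have hgeq : g = g * invol P * (κ * invol P₀) := by
    rw [← he, mul_assoc, invol_mul_invol hP.idem, mul_one]
  -- A minimal stable subspace of the range of `P₀` would contain some `σ j`, and the character of
  -- `σ j` would be `-1` on `g`.
  have hP₀0 : P₀ = 0 := by
    by_contra hne
    obtain ⟨U, hUle, hU⟩ := exists_isMinimalStable hP₀ρ.isStable_range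
      (fun h => hne (LinearMap.range_eq_bot.1 h))
    obtain ⟨j, φ, hφ0, hφ⟩ := hσ.complete U hU fun hi => hU.ne_bot (han U hUle hU.stable hi)
    have h2 := homDet_invol_of_anisotropic hB hρ (hσ.irreducible j) hP₀ hP₀ρ han hφ0
      (fun w => (mem_range_iff_of_idem hP₀.idem).1 (hUle (hφ w)))
    have h3 := h1 j
    rw [hgeq, homDet_mul (hK.equivariant _ hmem) ((hK.equivariant _ hκ).mul hP₀ρ.invol),
      homDet_mul (hK.equivariant _ hκ) hP₀ρ.invol, hK1 j _ hmem, hK1 j _ hκ, h2] at h3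
    norm_num at h3
  rw [hgeq, hP₀0, invol_zero, mul_one]
  exact K.mul_mem hmem hκ

/-! ### Exchanging the two halves of a hyperbolic space -/

section Swap

/-- The involution which exchanges the two halves of a hyperbolic space conjugates `hypScale` to
its inverse. -/
lemma invol_mul_hypScale {Q n : Module.End ℂ V} (hn : n * n = 1)
    (hnQ : n * Q = adj B Q * n) (c : ℂˣ) : n * hypScale B Q c = hypScale B Q c⁻¹ * n := by
  have h1 : n * adj B Q = Q * n := by
    have : n * adj B Q = n * (adj B Q * n) * n := by
      rw [mul_assoc, mul_assoc, hn, mul_one]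
    rw [this, ← hnQ, ← mul_assoc, hn, one_mul]
  simp only [hypScale, mul_add, mul_one, mul_smul_comm, hnQ, h1, add_mul, one_mul, smul_mul_assoc,
    Units.val_inv_eq_inv_val, inv_inv]
  abel

include hB hρ in
/-- A self-dual constituent `φ₁` of one half of a hyperbolic space yields an involution which
exchanges both halves. -/
lemma exists_hyp_swap {τ : Type*} [AddCommGroup τ] [Module ℂ τ] [FiniteDimensional ℂ τ]
    {θ : Representation ℂ Γ τ} (hθ : θ.IsIrreducible) {b : LinearMap.BilinForm ℂ τ}
    (hb : IsInvariantForm θ b) (hb0 : b ≠ 0) (hbs : ∀ x y, b x y = ε * b y x)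
    (hcr : HasProjections ρ) {Q : Module.End ℂ V} (hQ : IsHyp B Q) (hQρ : IsEquivariant ρ Q)
    {φ₁ : IntertwiningMap θ ρ} (hφ₁ : LinearMap.range φ₁.toLinearMap = LinearMap.range Q)
    (h0 : φ₁ ≠ 0) :
    ∃ (P : Module.End ℂ V) (φ : IntertwiningMap θ ρ), IsSAProj B P ∧ IsEquivariant ρ P ∧ φ ≠ 0 ∧
      LinearMap.range P = LinearMap.range φ.toLinearMap ∧
      IsAnisotropic ρ B (LinearMap.range P) ∧ (Q + adj B Q) * P = P ∧
      invol P * Q = adj B Q * invol P := by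
  obtain ⟨φ', hφ'⟩ := exists_dual_intertwining hB hρ hcr hθ (β := b) hb h0
  have hQφ₁ : ∀ x, Q (φ₁ x) = φ₁ x := fun x =>
    (mem_range_iff_of_idem hQ.idem).1 (hφ₁ ▸ ⟨x, rfl⟩)
  have hQ'φ₁ : ∀ x, adj B Q (φ₁ x) = 0 := fun x => by
    rw [← hQφ₁, ← Module.End.mul_apply, hQ.adj_mul]; rfl
  -- The partner of `φ₁` is moved into the range of `adj B Q`; its pairing with `φ₁` does not change
  -- because `Q` fixes `φ₁`.
  set φ₂ := equivariantComp (hQρ.adj hB hρ) φ' with hφ₂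
  have hQ'φ₂ : ∀ x, adj B Q (φ₂ x) = φ₂ x := fun x => congrArg (· (φ' x)) (hQ.adj_idem hB)
  have hQφ₂ : ∀ x, Q (φ₂ x) = 0 := fun x => by
    rw [← hQ'φ₂, ← Module.End.mul_apply, hQ.mul_adj]; rfl
  have b12 : ∀ x y, B (φ₁ x) (φ₂ y) = b x y := fun x y => by
    rw [hφ₂, equivariantComp_apply, hB.adj_right, hQφ₁, hφ']
  -- Here `b` must have the same sign as `B`. With the opposite sign `φ₁ - φ₂` would have isotropic
  -- image and would define no reflection.
  have b21 : ∀ x y, B (φ₂ x) (φ₁ y) = b x y := fun x y => by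
    rw [hB.symm, b12, ← hbs]
  have b11 : ∀ x y, B (φ₁ x) (φ₁ y) = 0 := fun x y => by
    rw [← hQφ₁ x, ← hB.adj_right, hQ'φ₁, map_zero]
  have b22 : ∀ x y, B (φ₂ x) (φ₂ y) = 0 := fun x y => by
    rw [← hQ'φ₂ x, hB.adj_left, hQφ₂, map_zero]
  have hbm : ∀ x y, B ((φ₁ - φ₂) x) ((φ₁ - φ₂) y) = -2 * b x y := fun x y => by
    simp only [IntertwiningMap.coe_sub, Pi.sub_apply, map_sub, LinearMap.sub_apply, b11, b12, b21,
      b22]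
    ring
  have hbpm : ∀ x y, B ((φ₁ - φ₂) x) ((φ₁ + φ₂) y) = 0 := fun x y => by
    simp only [IntertwiningMap.coe_sub, IntertwiningMap.coe_add, Pi.sub_apply, Pi.add_apply,
      map_sub, map_add, LinearMap.sub_apply, b11, b12, b21, b22]
    ring
  obtain ⟨x₀, y₀, hxy⟩ := exists_pairing_ne_zero hb0
  have hφ0 : φ₁ - φ₂ ≠ 0 := fun hz => hxy (by
    have h1 := hbm x₀ y₀
    rw [hz] at h1
    simpa using h1)
  have hmin := isMinimalStable_range hθ hφ0
  have hani : IsAnisotropic ρ B (LinearMap.range (φ₁ - φ₂).toLinearMap) :=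
    hmin.isAnisotropic fun hiso => hxy (by
      have h1 := (hbm x₀ y₀).symm.trans (hiso _ ⟨x₀, rfl⟩ _ ⟨y₀, rfl⟩)
      simpa using h1)
  obtain ⟨P, hP, hPρ, hPφ⟩ := hani.exists_isSAProj hB hρ le_rfl hmin.stable
  have hPm : ∀ x, P (φ₁ x - φ₂ x) = φ₁ x - φ₂ x := fun x =>
    (mem_range_iff_of_idem hP.idem).1 (hPφ ▸ ⟨x, rfl⟩)
  have hPp : ∀ x, P (φ₁ x + φ₂ x) = 0 := fun x => by
    refine hB.ext_left fun v => ?_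
    obtain ⟨y, hy⟩ : P v ∈ LinearMap.range (φ₁ - φ₂).toLinearMap := hPφ ▸ ⟨v, rfl⟩
    have hy' : P v = (φ₁ - φ₂) y := hy.symm
    have hswap : B (φ₁ x + φ₂ x) (P v) = 0 := by
      have h2 := hbpm y x
      rw [hB.symm, hy', show φ₁ x + φ₂ x = (φ₁ + φ₂) x from rfl, h2, mul_zero]
    rw [← hP.adj, hB.adj_left, hswap, map_zero, LinearMap.zero_apply]
  -- The reflection negates `φ₁ - φ₂` and fixes the orthogonal `φ₁ + φ₂`, so it exchanges `φ₁` and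
  -- `φ₂`.
  have hn1 : ∀ x, invol P (φ₁ x) = φ₂ x := fun x => by
    have h1 : φ₁ x = (1 / 2 : ℂ) • ((φ₁ x - φ₂ x) + (φ₁ x + φ₂ x)) := by module
    have h2 : P (φ₁ x) = (1 / 2 : ℂ) • (φ₁ x - φ₂ x) := by
      conv_lhs => rw [h1]
      rw [map_smul, map_add, hPm, hPp, add_zero]
    simp only [invol, LinearMap.sub_apply, Module.End.one_apply, LinearMap.smul_apply, h2]
    module
  refine ⟨P, φ₁ - φ₂, hP, hPρ, hφ0, hPφ, hPφ ▸ hani, ?_, ?_⟩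
  · ext v
    obtain ⟨y, hy⟩ : P v ∈ LinearMap.range (φ₁ - φ₂).toLinearMap := hPφ ▸ ⟨v, rfl⟩
    have hy' : P v = φ₁ y - φ₂ y := hy.symm
    rw [Module.End.mul_apply, hy']
    simp [hQφ₁, hQ'φ₁, hQ'φ₂, hQφ₂, sub_eq_add_neg]
  · have h1 : adj B Q * (invol P * Q) = invol P * Q := by
      ext v
      obtain ⟨y, hy⟩ : Q v ∈ LinearMap.range φ₁.toLinearMap := hφ₁ ▸ ⟨v, rfl⟩
      have hy' : Q v = φ₁ y := hy.symm
      simp only [Module.End.mul_apply, hy', hn1, hQ'φ₂]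
    -- The adjoint of `Q' n Q = n Q`, with `Q'` the adjoint of `Q` and `n` the reflection, is `Q' n
    -- Q = Q' n`. Together they give `n Q = Q' n`.
    have h2 := congrArg (adj B) h1
    rw [hB.adj_mul, hB.adj_mul, hB.adj_adj, adj_invol hB hP] at h2
    rw [← h1, ← mul_assoc, h2]

end Swap

/-! ### Component characters relative to a maximal torus -/

section WithTorus

variable {Z : Type*} [CommGroup Z] {f : Representation ℂ Z V}
  (h : ∀ g z, Commute (ρ g) (f z)) (hf : IsInvariantForm f B)
  (hcr : HasProjections ρ) (hcr' : HasProjections (prodRep h)) (hdiv : ∀ z : Z, ∃ w, w * w = z)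
  -- Maximality of the torus in the form in which it is used: it already contains the scalings of
  -- each hyperbolic space on whose halves it acts by scalars.
  (hmax : ∀ Q, IsHyp B Q → IsEquivariant (prodRep h) Q → Q ≠ 0 →
    (∀ z, ∃ c : ℂ, f z * Q = c • Q) → ∀ w, hypScale B Q w ∈ Set.range f)
include hB hρ hf hcr' hdiv hmax

/-- The projection to the space of vectors fixed by a maximal torus; this space is anisotropic. -/
lemma exists_fixed_proj : ∃ P, IsSAProj B P ∧ IsEquivariant (prodRep h) P ∧
    (∀ v, P v = v ↔ ∀ z, f z v = v) ∧ IsAnisotropic ρ B (LinearMap.range P) := by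
  have hinv := isInvariantForm_prodRep h hρ hf
  let X : Submodule ℂ V := ⨅ z, LinearMap.ker (f z - 1)
  have hXmem : ∀ {v}, v ∈ X ↔ ∀ z, f z v = v := by
    intro v
    simp [X, Submodule.mem_iInf, sub_eq_zero]
  have hX : ∀ U ≤ X, IsStable ρ U → IsStable (prodRep h) U := fun U hU hst =>
    (isStable_prodRep_iff h).2 ⟨hst, fun z v hv => by rwa [hXmem.1 (hU hv)]⟩
  have hXst : IsStable ρ X := fun g v hv => hXmem.2 fun z => by
    have := congrArg (· v) (h g z).eq
    simp only [Module.End.mul_apply, hXmem.1 hv z] at this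
    exact this.symm
  have han : IsAnisotropic ρ B X := by
    intro U hU hst hiso
    by_contra hne
    obtain ⟨Q, hQ, hQρ, hQU, -, -⟩ := exists_isHyp hB hinv hcr' (IsSAProj.one hB)
      IsEquivariant.one (hX U hU hst) (by rw [LinearMap.range_eq_top.2 (fun v => ⟨v, rfl⟩)]
                                          exact le_top) hiso
    have hQ0 : Q ≠ 0 := by
      rintro rfl
      exact hne (by rw [← hQU, LinearMap.range_zero])
    have hfQ : ∀ z, f z * Q = Q := fun z => LinearMap.ext fun v =>
      hXmem.1 (hU (hQU ▸ ⟨v, rfl⟩)) z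
    have h2 : (2 : ℂ) ≠ 0 := two_ne_zero
    -- By maximality the scaling by `2` on an isotropic space of fixed vectors would belong to the
    -- torus, which fixes these vectors. Any scalar other than `1` would do.
    obtain ⟨z, hz⟩ := hmax Q hQ hQρ hQ0 (fun z => ⟨1, by rw [hfQ, one_smul]⟩) (Units.mk0 2 h2)
    have h3 := hypScale_mul_self hB hQ (Units.mk0 2 h2)
    rw [← hz, hfQ, Units.val_mk0] at h3
    apply hQ0
    have : (2 : ℂ) • Q - Q = Q := by module
    rw [← this, ← h3, sub_self]
  obtain ⟨P, hP, hPρ, hPX⟩ : ∃ P, IsSAProj B P ∧ IsEquivariant (prodRep h) P ∧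
      LinearMap.range P = X :=
    IsAnisotropic.exists_isSAProj hB hinv
      (fun U hU hst => han U hU ((isStable_prodRep_iff h).1 hst).1) le_rfl (hX X le_rfl hXst)
  exact ⟨P, hP, hPρ, fun v => by rw [← mem_range_iff_of_idem hP.idem, hPX, hXmem], hPX ▸ han⟩

variable {P : Module.End ℂ V} (hP : IsSAProj B P) (hPρ : IsEquivariant (prodRep h) P)
  (hfix : ∀ v, P v = v ↔ ∀ z, f z v = v) (han : IsAnisotropic ρ B (LinearMap.range P))
include hP hPρ hfix han hK

/-- This is the reduction of `exists_invol_eq_mul_invol` for `Γ × Z`. The anisotropic remainder is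
fixed by the divisible group `Z`, hence lies in the range of `P`. -/
lemma exists_invol_eq_mul_of_torus {P' : Module.End ℂ V} (hP' : IsSAProj B P')
    (hP'ρ : IsEquivariant (prodRep h) P') :
    ∃ P₀, IsSAProj B P₀ ∧ IsEquivariant (prodRep h) P₀ ∧ P' * P₀ = P₀ ∧ P * P₀ = P₀ ∧
      ∃ κ ∈ K, invol P' = κ * invol P₀ := by
  have hinv := isInvariantForm_prodRep h hρ hf
  obtain ⟨P₀, hP₀, hP₀ρ, hle, han₀, hκ⟩ := exists_invol_eq_mul_invol hB hinv hcr' K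
    (fun Q hQ hQρ z => hK.hypScale_mem hB hρ hQ ((isEquivariant_prodRep_iff h).1 hQρ).1 z) hP' hP'ρ
  refine ⟨P₀, hP₀, hP₀ρ, hle, LinearMap.ext fun v => (hfix _).2 fun z => ?_, hκ⟩
  exact congrArg (· v) (apply_mul_eq_of_anisotropic h hB hρ hf hdiv hP₀ hP₀ρ han₀ z)

/-- The remainder `P₀` lies in the range of `P` and in that of `1 - P`, so it vanishes: the
complement of the fixed space is hyperbolic. -/
lemma invol_one_sub_mem : invol (1 - P) ∈ K := by
  obtain ⟨P₀, hP₀, hP₀ρ, hle, hPle, κ, hκ, he⟩ := exists_invol_eq_mul_of_torus hB hρ hK h hf hcr'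
    hdiv hmax hP hPρ hfix han ((IsSAProj.one hB).sub hB hP (one_mul _)) (IsEquivariant.one.sub hPρ)
  have : P₀ = 0 := by
    rw [sub_mul, one_mul, hPle, sub_self] at hle
    exact hle.symm
  rw [he, this, invol_zero, mul_one]
  exact hκ

variable (hK1 : ∀ j, ∀ κ ∈ K, homDet (σ j) ρ κ = 1)
include hσ hK1

/-- The scalar `-1` is the product of the reflections in the fixed space and in its complement, and
the latter lies in `K`. -/
lemma homDet_invol_fixed (j : J) : homDet (σ j) ρ (invol P) =
    (-1) ^ Module.finrank ℂ (IntertwiningMap (σ j) ρ) := by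
  have hPρ' := ((isEquivariant_prodRep_iff h).1 hPρ).1
  have hmem := invol_one_sub_mem hB hρ hK h hf hcr' hdiv hmax hP hPρ hfix han
  have h1 : invol P * invol (1 - P) = -1 := by
    rw [invol_mul_invol_of_mul_eq_zero (by rw [mul_sub, mul_one, hP.idem, sub_self]),
      add_sub_cancel, invol_one]
  rw [← homDet_neg_one, ← h1, homDet_mul hPρ'.invol (hK.equivariant _ hmem), hK1 j _ hmem, mul_one]

/-- A constituent of even multiplicity does not occur in the fixed space. -/
lemma fixed_proj_apply_eq_zero {j : J}
    (hj : Even (Module.finrank ℂ (IntertwiningMap (σ j) ρ))) (φ : IntertwiningMap (σ j) ρ)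
    (w : W j) : P (φ w) = 0 := by
  by_contra hne
  have hPρ' := ((isEquivariant_prodRep_iff h).1 hPρ).1
  -- Parity makes this determinant `1`, whereas an occurrence of `σ j` in the anisotropic fixed
  -- space would make it `-1`.
  have h1 := homDet_invol_fixed hB hρ hK hσ h hf hcr' hdiv hmax hP hPρ hfix han hK1 j
  rw [hj.neg_one_pow, homDet_invol_of_anisotropic hB hρ (hσ.irreducible j) hP hPρ' han
    (φ := equivariantComp hPρ' φ) (fun h0 => hne ?_) (fun w => ?_)] at h1
  · norm_num at h1
  · exact congrArg (fun φ' : IntertwiningMap (σ j) ρ => φ' w) h0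
  · exact congrArg (· (φ w)) hP.idem

/-- A constituent of odd multiplicity occurs in the fixed space. -/
lemma exists_fixed_intertwining {j : J}
    (hj : Odd (Module.finrank ℂ (IntertwiningMap (σ j) ρ))) :
    ∃ φ : IntertwiningMap (σ j) ρ, φ ≠ 0 ∧ ∀ w, P (φ w) = φ w := by
  by_contra! hne
  have hPρ' := ((isEquivariant_prodRep_iff h).1 hPρ).1
  have h1 := homDet_invol_fixed hB hρ hK hσ h hf hcr' hdiv hmax hP hPρ hfix han hK1 j
  rw [hj.neg_one_pow, homDet_invol_eq_one hPρ' (fun φ w => ?_)] at h1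
  · norm_num at h1
  · by_contra h0
    obtain ⟨w', hw'⟩ := hne (equivariantComp hPρ' φ) (fun hz => h0
      (congrArg (fun φ' : IntertwiningMap (σ j) ρ => φ' w) hz))
    exact hw' (congrArg (· (φ w')) hP.idem)

/-- The component characters of the constituents of even multiplicity are trivial on the
centralizer of the torus. -/
lemma homDet_eq_one_of_commute {j : J}
    (hj : Even (Module.finrank ℂ (IntertwiningMap (σ j) ρ))) {g : Module.End ℂ V}
    (hg : IsEquivariant ρ g) (hgi : adj B g * g = 1) (hgf : IsEquivariant f g) :
    homDet (σ j) ρ g = 1 := by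
  obtain ⟨P', hP', hPg, hPe⟩ := exists_isSAProj_eigen hB hgi
  have hP'ρ : IsEquivariant ρ P' := fun x => hPg _ (hg x).symm
  have hP'f : IsEquivariant f P' := fun x => hPg _ (hgf x).symm
  have hmem : g * invol P' ∈ K := by
    refine hK.cayley _ (hg.mul hP'ρ.invol) ?_ hPe
    rw [hB.adj_mul, adj_invol hB hP', mul_assoc, ← mul_assoc _ g, hgi, one_mul,
      invol_mul_invol hP'.idem]
  obtain ⟨P₀, hP₀, hP₀ρ, -, hPP₀, κ, hκ, he⟩ := exists_invol_eq_mul_of_torus hB hρ hK h hf hcr'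
    hdiv hmax hP hPρ hfix han hP' ((isEquivariant_prodRep_iff h).2 ⟨hP'ρ, hP'f⟩)
  have hP₀ρ' := ((isEquivariant_prodRep_iff h).1 hP₀ρ).1
  have hgeq : g = g * invol P' * (κ * invol P₀) := by
    rw [← he, mul_assoc, invol_mul_invol hP'.idem, mul_one]
  -- `P₀` projects into the fixed space, where `σ j` does not occur.
  have h1 : homDet (σ j) ρ (invol P₀) = 1 := homDet_invol_eq_one hP₀ρ' fun φ w => by
    have h2 := fixed_proj_apply_eq_zero hB hρ hK hσ h hf hcr' hdiv hmax hP hPρ hfix han hK1 hj φ w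
    rw [← hP.mul_comm_le hB hP₀ hPP₀, Module.End.mul_apply, h2, map_zero]
  rw [hgeq, homDet_mul (hK.equivariant _ hmem) ((hK.equivariant _ hκ).mul hP₀ρ'.invol),
    homDet_mul (hK.equivariant _ hκ) hP₀ρ'.invol, hK1 j _ hmem, hK1 j _ hκ, h1]
  norm_num

/-- For each constituent of odd multiplicity there is an isometry which commutes with the torus
and on which exactly the component character of that constituent is nontrivial. -/
lemma exists_commute_homDet [DecidableEq J] {i : J}
    (hi : Odd (Module.finrank ℂ (IntertwiningMap (σ i) ρ))) :
    ∃ g, IsEquivariant ρ g ∧ adj B g * g = 1 ∧ IsEquivariant f g ∧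
      ∀ j, homDet (σ j) ρ g = if j = i then -1 else 1 := by
  obtain ⟨φ, hφ0, hφ⟩ := exists_fixed_intertwining hB hρ hK hσ h hf hcr' hdiv hmax hP hPρ hfix han
    hK1 hi
  have hle : LinearMap.range φ.toLinearMap ≤ LinearMap.range P := by
    rintro _ ⟨w, rfl⟩; exact ⟨φ w, hφ w⟩
  obtain ⟨P₁, hP₁, hP₁ρ, hP₁φ⟩ := han.exists_isSAProj hB hρ hle (IsStable.range φ)
  refine ⟨invol P₁, hP₁ρ.invol, invol_isometry hB hP₁, IsEquivariant.invol fun z => ?_,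
    fun j => homDet_invol_of_range_eq hB hρ hσ hP₁ hP₁ρ hφ0 hP₁φ (hP₁φ ▸ han.mono hle)⟩
  -- The range of `P₁` consists of vectors fixed by the torus; the adjoint identity shows that `P₁`
  -- commutes with it.
  have h1 : ∀ z, f z * P₁ = P₁ := fun z => LinearMap.ext fun v => by
    have : P₁ v ∈ LinearMap.range P := hle (hP₁φ ▸ ⟨v, rfl⟩)
    exact (hfix _).1 ((mem_range_iff_of_idem hP.idem).1 this) z
  have h2 : P₁ * f z = P₁ := by
    have := congrArg (adj B) (h1 z⁻¹)
    rwa [hB.adj_mul, adj_rep hB hf, inv_inv, hP₁.adj] at this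
  rw [Commute, SemiconjBy, h1, h2]

/-- For each constituent of even multiplicity there is an isometric involution which normalizes the
torus and on which exactly the component character of that constituent is nontrivial. -/
lemma exists_normalize_homDet [DecidableEq J] (hcr : HasProjections ρ) {i : J}
    (hi : Even (Module.finrank ℂ (IntertwiningMap (σ i) ρ)))
    (hi0 : Module.finrank ℂ (IntertwiningMap (σ i) ρ) ≠ 0) :
    ∃ g, IsEquivariant ρ g ∧ adj B g * g = 1 ∧ g * g = 1 ∧ (∀ z, ∃ z', g * f z = f z' * g) ∧
      ∀ j, homDet (σ j) ρ g = if j = i then -1 else 1 := by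
  have hinv := isInvariantForm_prodRep h hρ hf
  have hzero := fixed_proj_apply_eq_zero hB hρ hK hσ h hf hcr' hdiv hmax hP hPρ hfix han hK1 hi
  obtain ⟨φ₀, hφ₀⟩ : ∃ φ : IntertwiningMap (σ i) ρ, φ ≠ 0 := by
    by_contra! hz
    have : Subsingleton (IntertwiningMap (σ i) ρ) := ⟨fun a b => by rw [hz a, hz b]⟩
    exact hi0 Module.finrank_zero_of_subsingleton
  -- the isotypic subspace
  let X : Submodule ℂ V := ⨆ φ : IntertwiningMap (σ i) ρ, LinearMap.range φ.toLinearMap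
  have hXle : ∀ φ : IntertwiningMap (σ i) ρ, LinearMap.range φ.toLinearMap ≤ X := fun φ =>
    le_iSup (fun φ : IntertwiningMap (σ i) ρ => LinearMap.range φ.toLinearMap) φ
  have hXst : IsStable (prodRep h) X := by
    have key : ∀ a : Module.End ℂ V, (∀ φ : IntertwiningMap (σ i) ρ,
        ∀ w, a (φ w) ∈ X) → ∀ v ∈ X, a v ∈ X := fun a ha => by
      have : X ≤ X.comap a := iSup_le fun φ => by
        rintro _ ⟨w, rfl⟩
        exact ha φ w
      exact this
    refine (isStable_prodRep_iff h).2 ⟨fun g => key _ fun φ w => ?_, fun z => key _ fun φ w => ?_⟩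
    · exact hXle φ (IsStable.range φ g _ ⟨w, rfl⟩)
    · exact hXle (equivariantComp (fun g => (h g z).symm) φ) ⟨w, rfl⟩
  have hX0 : X ≠ ⊥ := fun hb => hφ₀ (IntertwiningMap.ext
    (LinearMap.range_eq_bot.1 (eq_bot_iff.2 (hb ▸ hXle φ₀))))
  have hPX : ∀ v ∈ X, P v = 0 := by
    have : X ≤ LinearMap.ker P := iSup_le fun φ => by
      rintro _ ⟨w, rfl⟩
      exact hzero φ w
    exact this
  obtain ⟨U, hUX, hU⟩ := exists_isMinimalStable hXst hX0
  have hUst := (isStable_prodRep_iff h).1 hU.stable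
  have hsc := IsMinimalStable.exists_smul h hU
  -- Otherwise the torus would act on `U` by signs, hence trivially by divisibility, and `U` would
  -- be in the fixed space, which contains no copy of `σ i`.
  have hiso : IsIsotropic B U := by
    by_contra hni
    rw [IsIsotropic] at hni
    push Not at hni
    obtain ⟨x, hx, y, hy, hxy⟩ := hni
    apply hU.ne_bot
    rw [eq_bot_iff]
    intro u hu
    have hPu : P u = u := (hfix u).2 fun z => by
      obtain ⟨w, rfl⟩ := hdiv z
      obtain ⟨c, hc⟩ := hsc w
      have h1 := hf w x y
      rw [hc x hx, hc y hy, map_smul, map_smul, LinearMap.smul_apply, smul_eq_mul, smul_eq_mul,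
        ← mul_assoc] at h1
      have h2 : c * c = 1 := mul_right_cancel₀ hxy (by rw [h1, one_mul])
      rw [map_mul, Module.End.mul_apply, hc u hu, map_smul, hc u hu, smul_smul, h2, one_smul]
    rw [hPX u (hUX hu)] at hPu
    exact hPu.symm
  -- The torus acts on `U` by scalars, so `U` is already minimal for `Γ`; hence it is a copy of `σ
  -- i`.
  have hUmin : ∀ Y ≤ U, IsStable ρ Y → Y = ⊥ ∨ Y = U := fun Y hY hst => by
    refine hU.minimal Y hY ((isStable_prodRep_iff h).2 ⟨hst, fun z v hv => ?_⟩)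
    obtain ⟨c, hc⟩ := hsc z
    rw [hc v (hY hv)]
    exact Y.smul_mem c hv
  obtain ⟨Q, hQ, hQρ, hQU, -, -⟩ := exists_isHyp hB hinv hcr' (IsSAProj.one hB)
    IsEquivariant.one hU.stable (by rw [LinearMap.range_eq_top.2 (fun v => ⟨v, rfl⟩)]
                                    exact le_top) hiso
  have hQρ' := (isEquivariant_prodRep_iff h).1 hQρ
  have hQ0 : Q ≠ 0 := by
    rintro rfl
    exact hU.ne_bot (by rw [← hQU, LinearMap.range_zero])
  -- If `Q` killed all embeddings of `σ i`, it would vanish on `X`, which contains its own range.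
  obtain ⟨φ, hφ⟩ : ∃ φ : IntertwiningMap (σ i) ρ, equivariantComp hQρ'.1 φ ≠ 0 := by
    by_contra! hz
    have : X ≤ LinearMap.ker Q := iSup_le fun φ => by
      rintro _ ⟨w, rfl⟩
      exact congrArg (fun φ' : IntertwiningMap (σ i) ρ => φ' w) (hz φ)
    apply hQ0
    ext v
    have h1 : Q (Q v) = 0 := this (hUX (hQU ▸ ⟨v, rfl⟩))
    rwa [← Module.End.mul_apply, hQ.idem] at h1
  have hφ₁ : LinearMap.range (equivariantComp hQρ'.1 φ).toLinearMap = LinearMap.range Q := by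
    rw [hQU]
    refine (hUmin _ ?_ (IsStable.range _)).resolve_left fun hb => hφ
      (IntertwiningMap.ext (LinearMap.range_eq_bot.1 hb))
    rintro _ ⟨w, rfl⟩
    exact hQU ▸ ⟨φ w, rfl⟩
  have hscQ : ∀ z, ∃ c : ℂ, f z * Q = c • Q := fun z => by
    obtain ⟨c, hc⟩ := hsc z
    exact ⟨c, LinearMap.ext fun v => hc _ (hQU ▸ ⟨v, rfl⟩)⟩
  obtain ⟨P₁, φ₂, hP₁, hP₁ρ, hφ₂, hP₁φ, han₁, hQP₁, hsw⟩ := exists_hyp_swap hB hρ (hσ.irreducible i)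
    (hσ.invariant i) (hσ.ne_zero i) (hσ.symm i) hcr hQ hQρ'.1 hφ₁ hφ
  refine ⟨invol P₁, hP₁ρ.invol, invol_isometry hB hP₁, invol_mul_invol hP₁.idem, fun z => ?_,
    fun j => homDet_invol_of_range_eq hB hρ hσ hP₁ hP₁ρ hφ₂ hP₁φ han₁⟩
  obtain ⟨c, hc⟩ := hscQ z
  have hc0 : c ≠ 0 := by
    rintro rfl
    apply hQ0
    have := congrArg (f z⁻¹ * ·) hc
    simpa [← mul_assoc, ← map_mul] using this
  obtain ⟨w₀, hw₀⟩ := hmax Q hQ hQρ hQ0 hscQ (Units.mk0 c hc0)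
  have hw₀' : f w₀⁻¹ = hypScale B Q (Units.mk0 c hc0)⁻¹ := by
    rw [← adj_hypScale hB, ← hw₀, adj_rep hB hf]
  -- `f (w₀⁻¹ * z)` acts trivially on the hyperbolic space
  have hz1 : f (w₀⁻¹ * z) * Q = Q := by
    rw [map_mul, mul_assoc, hc, mul_smul_comm, hw₀', hypScale_mul_self hB hQ, smul_smul,
      Units.val_inv_eq_inv_val, Units.val_mk0, mul_inv_cancel₀ hc0, one_smul]
  have hz2 : f (w₀⁻¹ * z) * adj B Q = adj B Q := by
    have := apply_mul_adj_eq hB hρ hf hQρ'.2 (z := w₀⁻¹ * z) (c := 1) (by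
      rw [hz1, Units.val_one, one_smul])
    simpa using this
  have hz3 : f (w₀⁻¹ * z) * P₁ = P₁ := by
    rw [← hQP₁, ← mul_assoc, mul_add, hz1, hz2]
  have hz4 : P₁ * f (w₀⁻¹ * z) = P₁ := by
    have h1 := congrArg (adj B) hz3
    rw [hB.adj_mul, adj_rep hB hf, hP₁.adj] at h1
    conv_lhs => rw [← h1]
    rw [mul_assoc, ← map_mul, inv_mul_cancel, map_one, mul_one]
  have hcomm : invol P₁ * f (w₀⁻¹ * z) = f (w₀⁻¹ * z) * invol P₁ :=
    commute_invol (hz4.trans hz3.symm)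
  -- Write `z = w₀ * (w₀⁻¹ * z)`. The swap inverts `f w₀`, which is a scaling of the hyperbolic
  -- space, and commutes with the other factor.
  refine ⟨w₀⁻¹ * (w₀⁻¹ * z), ?_⟩
  have hz5 : f z = f w₀ * f (w₀⁻¹ * z) := by rw [← map_mul, mul_inv_cancel_left]
  rw [hz5, ← mul_assoc, hw₀, invol_mul_hypScale (invol_mul_invol hP₁.idem) hsw, mul_assoc, hcomm,
    ← mul_assoc, ← hw₀', ← map_mul]

end WithTorus

end Components

/-! ### Complete reducibility -/

section Average

open MeasureTheory

variable {N : ℕ}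

/-- A subspace which is stable under a relatively compact group of matrices is the range of an
equivariant projection. -/
theorem exists_proj_of_isCompact (H : Subgroup (GL (Fin N) ℂ))
    (hc : IsCompact (closure (H : Set (GL (Fin N) ℂ)))) (W : Submodule ℂ (Fin N → ℂ))
    (hW : ∀ h ∈ H, ∀ v ∈ W, h.val *ᵥ v ∈ W) :
    ∃ R : Module.End ℂ (Fin N → ℂ), R * R = R ∧ LinearMap.range R = W ∧
      ∀ h ∈ H, ∀ v, R (h.val *ᵥ v) = h.val *ᵥ R v := by
  obtain ⟨W', hWW'⟩ := Submodule.exists_isCompl W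
  let P : Module.End ℂ (Fin N → ℂ) := Submodule.projection W W' hWW'
  have hPmem : ∀ v, P v ∈ W := fun v => Submodule.projection_apply_mem hWW' v
  have hPid : ∀ v ∈ W, P v = v := fun v hv => by
    simpa [P] using Submodule.projection_apply_left hWW' ⟨v, hv⟩
  let K := H.topologicalClosure
  have : CompactSpace K := isCompact_iff_compactSpace.1 hc
  have hval : Continuous fun k : K => k.1.val := Units.continuous_val.comp continuous_subtype_val
  have hWc : IsClosed (W : Set (Fin N → ℂ)) := W.closed_of_finiteDimensional
  have hKW : ∀ k ∈ K, ∀ v ∈ W, k.val *ᵥ v ∈ W := by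
    intro k hk v hv
    have hcl : IsClosed {g : GL (Fin N) ℂ | g.val *ᵥ v ∈ W} :=
      hWc.preimage (Units.continuous_val.matrix_mulVec continuous_const)
    exact closure_minimal (fun h hh => hW h hh v hv) hcl hk
  let _ : MeasurableSpace K := borel K
  have : BorelSpace K := ⟨rfl⟩
  let μ : Measure K := Measure.haarMeasure ⊤
  have : IsProbabilityMeasure μ := ⟨Measure.haarMeasure_self (K₀ := ⊤)⟩
  -- The conjugates `k P k⁻¹` of an arbitrary projection to `W`, to be averaged over the compact
  -- closure of `H`.
  let F : (Fin N → ℂ) → K → (Fin N → ℂ) := fun v k => k.1.val *ᵥ P ((k⁻¹).1.val *ᵥ v)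
  have hFc : ∀ v, Continuous (F v) := fun v => by
    refine hval.matrix_mulVec ((LinearMap.continuous_of_finiteDimensional P).comp ?_)
    exact (hval.comp continuous_inv).matrix_mulVec continuous_const
  have hFi : ∀ v, Integrable (F v) μ := fun v =>
    (hFc v).integrable_of_hasCompactSupport (HasCompactSupport.of_compactSpace _)
  let R : Module.End ℂ (Fin N → ℂ) :=
    { toFun := fun v => ∫ k, F v k ∂μ
      map_add' := fun v w => by
        rw [← integral_add (hFi v) (hFi w)]
        refine integral_congr_ae (Filter.Eventually.of_forall fun k => ?_)
        simp only [F, Matrix.mulVec_add, map_add]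
      map_smul' := fun c v => by
        rw [RingHom.id_apply, ← integral_smul]
        refine integral_congr_ae (Filter.Eventually.of_forall fun k => ?_)
        simp only [F, Matrix.mulVec_smul, map_smul] }
  have hR : ∀ v, R v = ∫ k, F v k ∂μ := fun _ => rfl
  have hinv : ∀ (k : K) v, k.1.val *ᵥ ((k⁻¹).1.val *ᵥ v) = v := fun k v => by
    rw [Matrix.mulVec_mulVec, ← Units.val_mul, ← Subgroup.coe_mul, mul_inv_cancel]
    simp
  have hRid : ∀ v ∈ W, R v = v := fun v hv => by
    have h1 : ∀ k, F v k = v := fun k => by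
      simp only [F]
      rw [hPid _ (hKW _ (k⁻¹).2 v hv), hinv]
    rw [hR]
    simp only [h1]
    simp
  -- The integral commutes with the map to the quotient by `W`, where the integrand vanishes.
  have hRmem : ∀ v, R v ∈ W := fun v => by
    have h1 : (Submodule.mkQ W).toContinuousLinearMap (R v) = 0 := by
      rw [hR, ← ContinuousLinearMap.integral_comp_comm _ (hFi v)]
      have h2 : ∀ k, (Submodule.mkQ W).toContinuousLinearMap (F v k) = 0 := fun k => by
        have : F v k ∈ W := hKW _ k.2 _ (hPmem _)
        simpa using this
      simp only [h2]
      simp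
    simpa using h1
  refine ⟨R, LinearMap.ext fun v => hRid _ (hRmem v), le_antisymm ?_ fun v hv => ⟨v, hRid v hv⟩,
    fun h hh v => ?_⟩
  · rintro _ ⟨v, rfl⟩; exact hRmem v
  · let k₀ : K := ⟨h, H.le_topologicalClosure hh⟩
    have h1 : h.val *ᵥ R v = ∫ k, h.val *ᵥ F v k ∂μ := by
      have := ContinuousLinearMap.integral_comp_comm
        (Matrix.toLin' h.val).toContinuousLinearMap (hFi v)
      simpa [hR] using this.symm
    rw [h1, hR, ← integral_mul_left_eq_self _ k₀]
    refine integral_congr_ae (Filter.Eventually.of_forall fun k => ?_)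
    have h2 : (k₀ * k).1.val = h.val * k.1.val := rfl
    have h3 : ((k₀ * k)⁻¹).1.val * h.val = (k⁻¹).1.val := by
      have : ((k₀ * k)⁻¹).1 * k₀.1 = (k⁻¹).1 := by
        rw [← Subgroup.coe_mul, _root_.mul_inv_rev, inv_mul_cancel_right]
      exact congrArg Units.val this
    simp only [F]
    rw [h2, Matrix.mulVec_mulVec, h3, ← Matrix.mulVec_mulVec]

/-- If the stable subspaces are those which are stable under a relatively compact subgroup, then
equivariant projections exist. -/
theorem hasProjections_of_isCompact {Γ : Type*} [Group Γ] {ρ : Representation ℂ Γ (Fin N → ℂ)}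
    (Φ : Γ →* GL (Fin N) ℂ) (hΦ : ∀ g v, ρ g v = (Φ g).val *ᵥ v) (C : Subgroup Γ)
    (hc : IsCompact (closure (Φ '' C)))
    (hst : ∀ W : Submodule ℂ (Fin N → ℂ), (∀ c ∈ C, ∀ v ∈ W, ρ c v ∈ W) → IsStable ρ W) :
    HasProjections ρ := by
  intro W hW
  obtain ⟨R, hR, hRW, hRC⟩ := exists_proj_of_isCompact (C.map Φ) (by simpa using hc) W (by
    rintro _ ⟨c, -, rfl⟩ v hv
    rw [← hΦ]
    exact hW c v hv)
  -- So far `R` commutes with `C` only. Its kernel is stable under `C`, hence under `Γ`, and a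
  -- projection with stable range and kernel is equivariant.
  have hker : IsStable ρ (LinearMap.ker R) := hst _ fun c hcC v hv => by
    rw [LinearMap.mem_ker, hΦ, hRC _ ⟨c, hcC, rfl⟩, LinearMap.mem_ker.1 hv, Matrix.mulVec_zero]
  have hid : ∀ v ∈ W, R v = v := fun v hv => (mem_range_iff_of_idem hR).1 (hRW.symm ▸ hv)
  have hmem : ∀ v, R v ∈ W := fun v => hRW ▸ ⟨v, rfl⟩
  refine ⟨R, fun g => LinearMap.ext fun v => ?_, hR, hRW⟩
  have h0 : R (v - R v) = 0 := by rw [map_sub, hid _ (hmem v), sub_self]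
  have h1 : R (ρ g v) = R (ρ g (R v)) + R (ρ g (v - R v)) := by
    rw [← map_add, ← map_add, add_sub_cancel]
  rw [Module.End.mul_apply, Module.End.mul_apply, h1, hid _ (hW g _ (hmem v)),
    LinearMap.mem_ker.1 (hker g _ h0), add_zero]

end Average

/-! ### Laurent polynomials and Zariski density of the unit circle -/

section Laurent

/-- A function on `ℂˣ` which is a Laurent polynomial. -/
def IsLaurent (F : ℂˣ → ℂ) : Prop :=
  ∃ (p : Polynomial ℂ) (m : ℕ), ∀ z : ℂˣ, (z : ℂ) ^ m * F z = p.eval (z : ℂ)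

namespace IsLaurent

lemma const (c : ℂ) : IsLaurent fun _ => c := ⟨Polynomial.C c, 0, fun z => by simp⟩

lemma coe : IsLaurent fun z => (z : ℂ) := ⟨Polynomial.X, 0, fun z => by simp⟩

lemma inv : IsLaurent fun z => ((z⁻¹ : ℂˣ) : ℂ) := ⟨1, 1, fun z => by simp⟩

lemma add {F G : ℂˣ → ℂ} (hF : IsLaurent F) (hG : IsLaurent G) :
    IsLaurent fun z => F z + G z := by
  obtain ⟨p, m, hp⟩ := hF
  obtain ⟨q, n, hq⟩ := hG
  refine ⟨Polynomial.X ^ n * p + Polynomial.X ^ m * q, m + n, fun z => ?_⟩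
  simp only [Polynomial.eval_add, Polynomial.eval_mul, Polynomial.eval_pow, Polynomial.eval_X,
    ← hp, ← hq]
  ring

lemma mul {F G : ℂˣ → ℂ} (hF : IsLaurent F) (hG : IsLaurent G) :
    IsLaurent fun z => F z * G z := by
  obtain ⟨p, m, hp⟩ := hF
  obtain ⟨q, n, hq⟩ := hG
  refine ⟨p * q, m + n, fun z => ?_⟩
  simp only [Polynomial.eval_mul, ← hp, ← hq]
  ring

lemma sum {ι : Type*} (s : Finset ι) {F : ι → ℂˣ → ℂ} (h : ∀ i, IsLaurent (F i)) :
    IsLaurent fun z => ∑ i ∈ s, F i z := by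
  classical
  induction s using Finset.induction_on with
  | empty => simpa using const 0
  | insert i s hi ih =>
    simp only [Finset.sum_insert hi]
    exact (h i).add ih

lemma eval {ι : Type*} {x : ℂˣ → ι → ℂ} (hx : ∀ i, IsLaurent fun z => x z i)
    (P : MvPolynomial ι ℂ) : IsLaurent fun z => MvPolynomial.eval (x z) P := by
  induction P using MvPolynomial.induction_on with
  | C c => simpa using const c
  | add p q hp hq => simpa using hp.add hq
  | mul_X p i hp => simpa using hp.mul (hx i)

/-- A Laurent polynomial which vanishes on the unit circle is zero. -/
lemma eq_zero {F : ℂˣ → ℂ} (hF : IsLaurent F) (h : ∀ z : ℂˣ, ‖(z : ℂ)‖ = 1 → F z = 0) (z : ℂˣ) :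
    F z = 0 := by
  obtain ⟨p, m, hp⟩ := hF
  have h0 : p = 0 := by
    refine Polynomial.eq_zero_of_infinite_isRoot p ?_
    -- The points `exp(i arctan x)` are infinitely many roots of `p` on the unit circle.
    have hinj : Function.Injective fun x : ℝ => Complex.exp (Real.arctan x * Complex.I) := by
      intro x y hxy
      have h1 := congrArg Complex.arg hxy
      have hx := Real.arctan_lt_pi_div_two x
      have hx' := Real.neg_pi_div_two_lt_arctan x
      have hy := Real.arctan_lt_pi_div_two y
      have hy' := Real.neg_pi_div_two_lt_arctan y
      have hpi := Real.pi_pos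
      simp only [Complex.arg_exp_mul_I, toIocMod_eq_self Real.two_pi_pos |>.2
        (show Real.arctan x ∈ Set.Ioc (-Real.pi) (-Real.pi + 2 * Real.pi) from
          ⟨by linarith, by linarith⟩), toIocMod_eq_self Real.two_pi_pos |>.2
        (show Real.arctan y ∈ Set.Ioc (-Real.pi) (-Real.pi + 2 * Real.pi) from
          ⟨by linarith, by linarith⟩)] at h1
      exact Real.arctan_injective h1
    refine (Set.infinite_range_of_injective hinj).mono ?_
    rintro _ ⟨x, rfl⟩
    have := hp (Units.mk0 _ (Complex.exp_ne_zero (Real.arctan x * Complex.I)))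
    rw [h _ (by rw [Units.val_mk0, Complex.norm_exp_ofReal_mul_I]), mul_zero] at this
    exact this.symm
  have := hp z
  rw [h0, Polynomial.eval_zero] at this
  exact (mul_eq_zero.1 this).resolve_left (pow_ne_zero _ z.ne_zero)

end IsLaurent

/-- A subspace which is stable under the unit circle of an algebraic one-parameter family is stable
under the whole family. -/
lemma mulVec_mem_of_isLaurent {N : ℕ} {a : ℂˣ → Matrix (Fin N) (Fin N) ℂ}
    (ha : ∀ i j, IsLaurent fun z => a z i j) {W : Submodule ℂ (Fin N → ℂ)}
    (hW : ∀ z : ℂˣ, ‖(z : ℂ)‖ = 1 → ∀ v ∈ W, a z *ᵥ v ∈ W) (z : ℂˣ) (v : Fin N → ℂ)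
    (hv : v ∈ W) : a z *ᵥ v ∈ W := by
  by_contra hne
  -- A functional which separates `a z *ᵥ v` from `W` gives a Laurent polynomial that vanishes on
  -- the unit circle but not at `z`.
  obtain ⟨l, hl, hlW⟩ := Submodule.exists_le_ker_of_notMem hne
  have hF : IsLaurent fun z => l (a z *ᵥ v) := by
    have h1 : ∀ z, l (a z *ᵥ v) = ∑ i, ∑ j, a z i j * (v j * l (Pi.single i 1)) := fun z => by
      conv_lhs => rw [← Finset.univ_sum_single (a z *ᵥ v)]
      rw [map_sum]
      refine Finset.sum_congr rfl fun i _ => ?_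
      have h2 : (Pi.single i ((a z *ᵥ v) i) : Fin N → ℂ) = (a z *ᵥ v) i • Pi.single i 1 := by
        rw [← Pi.single_smul, smul_eq_mul, mul_one]
      rw [h2, map_smul, smul_eq_mul, Matrix.mulVec, dotProduct, Finset.sum_mul]
      exact Finset.sum_congr rfl fun j _ => mul_assoc _ _ _
    simp only [h1]
    exact IsLaurent.sum _ fun i => IsLaurent.sum _ fun j => (ha i j).mul (IsLaurent.const _)
  exact hl (hF.eq_zero (fun z hz => hlW (hW z hz v hv)) z)

end Laurent

/-! ### Polar decomposition in `SL(2, ℂ)` -/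

section UnitaryTrick

/-- The special unitary group as a subgroup of `SL(2, ℂ)`. -/
def specialUnitary : Subgroup (SpecialLinearGroup (Fin 2) ℂ) where
  carrier := {g | g.val * star g.val = 1}
  one_mem' := by simp
  mul_mem' := by
    intro a b (ha : a.val * star a.val = 1) (hb : b.val * star b.val = 1)
    change (a.val * b.val) * star (a.val * b.val) = 1
    rw [star_mul, mul_assoc, ← mul_assoc b.val, hb, one_mul, ha]
  inv_mem' := by
    intro a (ha : a.val * star a.val = 1)
    have h1 : (a⁻¹).val * a.val = 1 := congrArg Subtype.val (inv_mul_cancel a)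
    have h2 : (a⁻¹).val = star a.val := by
      calc (a⁻¹).val = (a⁻¹).val * (a.val * star a.val) := by rw [ha, mul_one]
        _ = star a.val := by rw [← mul_assoc, h1, one_mul]
    change (a⁻¹).val * star (a⁻¹).val = 1
    rw [h2, star_star, ← h2, h1]

lemma mem_specialUnitary {g : SpecialLinearGroup (Fin 2) ℂ} :
    g ∈ specialUnitary ↔ g.val * star g.val = 1 := Iff.rfl

lemma isCompact_specialUnitary :
    IsCompact (specialUnitary : Set (SpecialLinearGroup (Fin 2) ℂ)) := by
  let S : Set (Matrix (Fin 2) (Fin 2) ℂ) := {A | A * star A = 1}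
  have hS : IsCompact S := by
    have h1 : IsCompact (Set.pi Set.univ fun _ : Fin 2 => Set.pi Set.univ fun _ : Fin 2 =>
        Metric.closedBall (0 : ℂ) 1) :=
      isCompact_univ_pi fun _ => isCompact_univ_pi fun _ => isCompact_closedBall 0 1
    have h2 : IsClosed S := isClosed_singleton.preimage
      (continuous_id.mul continuous_star :
        Continuous fun A : Matrix (Fin 2) (Fin 2) ℂ => A * star A)
    refine IsCompact.of_isClosed_subset h1 h2 fun A hA => ?_
    intro i _ j _
    rw [mem_closedBall_zero_iff]
    exact entry_norm_bound_of_unitary (Matrix.mem_unitaryGroup_iff.2 hA) i j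
  exact SpecialLinearGroup.isClosedEmbedding_val.isCompact_preimage hS

/-- The element of `SL(2, ℂ)` with eigenvalues `z` and `z⁻¹` and with the columns of the given
unitary matrix as eigenvectors. -/
def conjDiag (U : unitaryGroup (Fin 2) ℂ) (z : ℂˣ) : SpecialLinearGroup (Fin 2) ℂ :=
  ⟨U.val * diagonal ![(z : ℂ), ((z⁻¹ : ℂˣ) : ℂ)] * star U.val, by
    have h1 : U.val.det * (star U.val).det = 1 := by
      rw [← det_mul, Matrix.mem_unitaryGroup_iff.1 U.2, det_one]
    rw [det_mul, det_mul, det_diagonal, Fin.prod_univ_two]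
    simp only [cons_val_zero, cons_val_one, Units.mul_inv, mul_one]
    exact h1⟩

lemma coe_conjDiag (U : unitaryGroup (Fin 2) ℂ) (z : ℂˣ) : (conjDiag U z).val =
    U.val * diagonal ![(z : ℂ), ((z⁻¹ : ℂˣ) : ℂ)] * star U.val := rfl

lemma isLaurent_conjDiag (U : unitaryGroup (Fin 2) ℂ) (i j : Fin 2) :
    IsLaurent fun z => (conjDiag U z).val i j := by
  have h1 : ∀ z, (conjDiag U z).val i j = U.val i 0 * z * star U.val 0 j +
      U.val i 1 * ((z⁻¹ : ℂˣ) : ℂ) * star U.val 1 j := fun z => by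
    rw [coe_conjDiag, Matrix.mul_apply, Fin.sum_univ_two]
    simp [Matrix.mul_diagonal]
  simp only [h1]
  exact (((IsLaurent.const _).mul IsLaurent.coe).mul (IsLaurent.const _)).add
    (((IsLaurent.const _).mul IsLaurent.inv).mul (IsLaurent.const _))

lemma conjDiag_mem_specialUnitary (U : unitaryGroup (Fin 2) ℂ) {z : ℂˣ} (hz : ‖(z : ℂ)‖ = 1) :
    conjDiag U z ∈ specialUnitary := by
  have hU : star U.val * U.val = 1 := Matrix.mem_unitaryGroup_iff'.1 U.2
  have hU' : U.val * star U.val = 1 := Matrix.mem_unitaryGroup_iff.1 U.2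
  have hz' : (z : ℂ) * star (z : ℂ) = 1 := by
    rw [Complex.star_def, Complex.mul_conj, Complex.normSq_eq_norm_sq, hz]; simp
  have hd : diagonal ![(z : ℂ), ((z⁻¹ : ℂˣ) : ℂ)] *
      star (diagonal ![(z : ℂ), ((z⁻¹ : ℂˣ) : ℂ)]) = 1 := by
    rw [star_eq_conjTranspose, diagonal_conjTranspose, diagonal_mul_diagonal, ← diagonal_one]
    congr 1
    funext i
    fin_cases i
    · simpa using hz'
    · have : (z : ℂ)⁻¹ * star (z : ℂ)⁻¹ = 1 := by
        rw [star_inv₀, ← mul_inv, hz', inv_one]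
      simpa using this
  rw [mem_specialUnitary, coe_conjDiag, star_mul, star_mul, star_star]
  calc U.val * diagonal ![(z : ℂ), ((z⁻¹ : ℂˣ) : ℂ)] * star U.val *
        (U.val * (star (diagonal ![(z : ℂ), ((z⁻¹ : ℂˣ) : ℂ)]) * star U.val))
      = U.val * (diagonal ![(z : ℂ), ((z⁻¹ : ℂˣ) : ℂ)] * (star U.val * U.val) *
        star (diagonal ![(z : ℂ), ((z⁻¹ : ℂˣ) : ℂ)])) * star U.val := by
          simp only [Matrix.mul_assoc]
    _ = 1 := by rw [hU, Matrix.mul_one, hd, Matrix.mul_one, hU']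

open scoped ComplexOrder in
/-- The polar decomposition in `SL(2, ℂ)`. -/
lemma exists_eq_conjDiag_mul (g : SpecialLinearGroup (Fin 2) ℂ) :
    ∃ (U : unitaryGroup (Fin 2) ℂ) (z : ℂˣ), ∃ k ∈ specialUnitary, g = conjDiag U z * k := by
  let A : Matrix (Fin 2) (Fin 2) ℂ := g.val * star g.val
  have hpos : A.PosSemidef := Matrix.posSemidef_self_mul_conjTranspose g.val
  have hA := hpos.isHermitian
  let U := hA.eigenvectorUnitary
  let l := hA.eigenvalues
  have hU : star U.val * U.val = 1 := Matrix.mem_unitaryGroup_iff'.1 U.2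
  have hdet : A.det = 1 := by
    simp only [A]
    rw [det_mul, star_eq_conjTranspose, det_conjTranspose]
    simp
  have hl : (l 0 : ℂ) * l 1 = 1 := by
    have := hA.det_eq_prod_eigenvalues
    rw [hdet, Fin.prod_univ_two] at this
    exact this.symm
  have hlr : l 0 * l 1 = 1 := by exact_mod_cast hl
  have hl0 : 0 < l 0 := lt_of_le_of_ne (hpos.eigenvalues_nonneg 0) fun h => by
    rw [← h, zero_mul] at hlr
    exact zero_ne_one hlr
  have hs : (Real.sqrt (l 0) : ℂ) ≠ 0 := by
    exact_mod_cast (Real.sqrt_pos.2 hl0).ne'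
  have hs2 : (Real.sqrt (l 0) : ℂ) * Real.sqrt (l 0) = l 0 := by
    exact_mod_cast Real.mul_self_sqrt hl0.le
  -- The eigenvalues of `g g*` are positive with product `1`. So its positive square root has
  -- eigenvalues `z` and `z⁻¹` with `z` the root of the first one, and equals `conjDiag U z`.
  let z : ℂˣ := Units.mk0 (Real.sqrt (l 0) : ℂ) hs
  have hl0c : (l 0 : ℂ) ≠ 0 := by exact_mod_cast hl0.ne'
  let d : Matrix (Fin 2) (Fin 2) ℂ := diagonal ![(z : ℂ), ((z⁻¹ : ℂˣ) : ℂ)]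
  have hdd : d * d = diagonal (RCLike.ofReal ∘ l) := by
    simp only [d]
    rw [diagonal_mul_diagonal]
    congr 1
    funext i
    fin_cases i
    · simpa [z] using hs2
    · have h1 : (Real.sqrt (l 0) : ℂ)⁻¹ * (Real.sqrt (l 0) : ℂ)⁻¹ = l 1 := by
        rw [← mul_inv, hs2]
        field_simp
        exact hl.symm
      simpa [z] using h1
  have hds : star d = d := by
    simp only [d]
    rw [star_eq_conjTranspose, diagonal_conjTranspose]
    congr 1
    funext i
    fin_cases i <;> simp [z, Complex.conj_ofReal]
  have hAeq : A = U.val * diagonal (RCLike.ofReal ∘ l) * star U.val := by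
    conv_lhs => rw [hA.spectral_theorem]
    rw [Unitary.conjStarAlgAut_apply]
  let h := conjDiag U z
  have hh : h.val = U.val * d * star U.val := rfl
  have hhs : star h.val = h.val := by
    rw [hh, star_mul, star_mul, star_star, hds, Matrix.mul_assoc]
  have hhh : h.val * h.val = A := by
    rw [hAeq, hh, ← hdd]
    calc U.val * d * star U.val * (U.val * d * star U.val)
        = U.val * (d * (star U.val * U.val) * d) * star U.val := by simp only [Matrix.mul_assoc]
      _ = _ := by rw [hU, Matrix.mul_one]
  refine ⟨U, z, h⁻¹ * g, ?_, (mul_inv_cancel_left h g).symm⟩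
  have e1 : (h⁻¹).val * h.val = 1 := congrArg Subtype.val (inv_mul_cancel h)
  have e2 : h.val * (h⁻¹).val = 1 := congrArg Subtype.val (mul_inv_cancel h)
  have e3 : star (h⁻¹).val = (h⁻¹).val := by
    have h1 := congrArg star e2
    rw [star_mul, hhs, star_one] at h1
    calc star (h⁻¹).val = star (h⁻¹).val * (h.val * (h⁻¹).val) := by rw [e2, Matrix.mul_one]
      _ = (h⁻¹).val := by rw [← Matrix.mul_assoc, h1, Matrix.one_mul]
  rw [mem_specialUnitary]
  change (h⁻¹).val * g.val * star ((h⁻¹).val * g.val) = 1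
  rw [star_mul, e3]
  calc (h⁻¹).val * g.val * (star g.val * (h⁻¹).val)
      = (h⁻¹).val * (h.val * h.val) * (h⁻¹).val := by rw [hhh]; simp only [A, Matrix.mul_assoc]
    _ = ((h⁻¹).val * h.val) * (h.val * (h⁻¹).val) := by simp only [Matrix.mul_assoc]
    _ = 1 := by rw [e1, e2, Matrix.one_mul]

end UnitaryTrick

/-! ### Representations by matrices and algebraic tori -/

section GLRep

variable {N : ℕ} {Γ : Type*} [Group Γ]

/-- The representation on column vectors attached to a homomorphism to `GL(N, ℂ)`. -/
def glRep (Φ : Γ →* GL (Fin N) ℂ) : Representation ℂ Γ (Fin N → ℂ) :=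
  ((Matrix.toLinAlgEquiv' : Matrix (Fin N) (Fin N) ℂ ≃ₐ[ℂ] _) :
    Matrix (Fin N) (Fin N) ℂ →* Module.End ℂ (Fin N → ℂ)).comp ((Units.coeHom _).comp Φ)

lemma glRep_apply (Φ : Γ →* GL (Fin N) ℂ) (g : Γ) (v : Fin N → ℂ) :
    glRep Φ g v = (Φ g).val *ᵥ v := rfl

lemma commute_glRep {Γ' : Type*} [Group Γ'] {Φ : Γ →* GL (Fin N) ℂ} {Φ' : Γ' →* GL (Fin N) ℂ}
    (h : ∀ g z, Commute (Φ g) (Φ' z)) (g : Γ) (z : Γ') : Commute (glRep Φ g) (glRep Φ' z) :=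
  (h g z).map (((Matrix.toLinAlgEquiv' : Matrix (Fin N) (Fin N) ℂ ≃ₐ[ℂ] _) :
    Matrix (Fin N) (Fin N) ℂ →* Module.End ℂ (Fin N → ℂ)).comp (Units.coeHom _))

/-- The matrix entries of `f` are polynomials in the coordinates and their inverses. -/
def IsAlgebraicTorusHom {k : ℕ} (f : (Fin k → ℂˣ) →* GL (Fin N) ℂ) : Prop :=
  ∃ P : Fin N → Fin N → MvPolynomial (Fin k ⊕ Fin k) ℂ, ∀ z i j,
    (f z).val i j =
      MvPolynomial.eval (Sum.elim (fun a => (z a : ℂ)) (fun a => ((z a)⁻¹ : ℂˣ))) (P i j)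

lemma continuous_mvPolynomial_eval {X ι : Type*} [TopologicalSpace X] {x : X → ι → ℂ}
    (hx : ∀ i, Continuous fun z => x z i) (P : MvPolynomial ι ℂ) :
    Continuous fun z => MvPolynomial.eval (x z) P := by
  induction P using MvPolynomial.induction_on with
  | C c => simpa using continuous_const
  | add p q hp hq => simp only [map_add]; exact hp.add hq
  | mul_X p i hp => simp only [map_mul, MvPolynomial.eval_X]; exact hp.mul (hx i)

lemma continuous_hom_gl {G : Type*} [Group G] [TopologicalSpace G] [ContinuousInv G]
    {Φ : G →* GL (Fin N) ℂ} (h : ∀ i j, Continuous fun g => (Φ g).val i j) : Continuous Φ := by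
  have h1 : Continuous fun g => (Φ g).val := continuous_matrix h
  rw [Units.continuous_iff]
  refine ⟨h1, ?_⟩
  simp only [← map_inv]
  exact h1.comp continuous_inv

lemma IsAlgebraicTorusHom.isCompact_image {k : ℕ} {f : (Fin k → ℂˣ) →* GL (Fin N) ℂ}
    (hf : IsAlgebraicTorusHom f) :
    IsCompact (Set.range fun x : Fin k → Circle => f fun a => Circle.toUnits (x a)) := by
  refine isCompact_range ?_
  have hc : Continuous f := by
    obtain ⟨P, hP⟩ := hf
    refine continuous_hom_gl fun i j => ?_
    simp only [hP]
    refine continuous_mvPolynomial_eval (fun a => ?_) _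
    rcases a with a | a
    · exact Units.continuous_val.comp (continuous_apply a)
    · exact Units.continuous_val.comp (continuous_inv.comp (continuous_apply a))
  refine hc.comp (continuous_pi fun a => ?_)
  have : Continuous Circle.toUnits := by
    rw [Units.continuous_iff]
    refine ⟨continuous_subtype_val, ?_⟩
    simp only [← map_inv]
    exact continuous_subtype_val.comp continuous_inv
  exact this.comp (continuous_apply a)

/-- A subspace which is stable under the maximal compact subgroup of a torus is stable. -/
lemma IsAlgebraicTorusHom.mulVec_mem {k : ℕ} {f : (Fin k → ℂˣ) →* GL (Fin N) ℂ}
    (hf : IsAlgebraicTorusHom f) {W : Submodule ℂ (Fin N → ℂ)}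
    (hW : ∀ z : Fin k → ℂˣ, (∀ a, ‖(z a : ℂ)‖ = 1) → ∀ v ∈ W, (f z).val *ᵥ v ∈ W)
    (z : Fin k → ℂˣ) : ∀ v ∈ W, (f z).val *ᵥ v ∈ W := by
  -- One coordinate at a time, since the density argument is in one variable; the coordinate
  -- subgroups generate the torus.
  have h1 : ∀ a (x : ℂˣ), ∀ v ∈ W, (f (Pi.mulSingle a x)).val *ᵥ v ∈ W := fun a x v hv => by
    obtain ⟨P, hP⟩ := hf
    refine mulVec_mem_of_isLaurent (a := fun x => (f (Pi.mulSingle a x)).val) (fun i j => ?_)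
      (fun x hx => hW _ fun b => ?_) x v hv
    · simp only [hP]
      refine IsLaurent.eval (fun b => ?_) _
      rcases b with b | b
      · by_cases hab : b = a
        · subst hab; simpa using IsLaurent.coe
        · simpa [Pi.mulSingle_eq_of_ne hab] using IsLaurent.const 1
      · by_cases hab : b = a
        · subst hab; simpa using IsLaurent.inv
        · simpa [Pi.mulSingle_eq_of_ne hab] using IsLaurent.const 1
    · by_cases hab : b = a
      · subst hab; simpa using hx
      · simp [Pi.mulSingle_eq_of_ne hab]
  have h2 : ∀ s : Finset (Fin k), ∀ v ∈ W,
      (f (∏ a ∈ s, Pi.mulSingle a (z a))).val *ᵥ v ∈ W := fun s => by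
    induction s using Finset.induction_on with
    | empty => intro v hv; simpa using hv
    | insert a s ha ih =>
      intro v hv
      rw [Finset.prod_insert ha, map_mul, Units.val_mul, ← Matrix.mulVec_mulVec]
      exact h1 _ _ _ (ih v hv)
  simpa [Finset.univ_prod_mulSingle] using h2 Finset.univ

end GLRep

/-! ### Complete reducibility of A-parameters -/

section ParameterReducible

variable {F : Type*} [Field F] [ValuativeRel F] [TopologicalSpace F] [IsNonarchimedeanLocalField F]
variable {t : DualType} {n : ℕ} {ψ : ArthurGroup F →* t.dualGroup n}

/-- A homomorphism of `SL(2, ℂ)` whose entries are polynomials. -/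
def IsPolynomialHom {N : ℕ} (Φ : SpecialLinearGroup (Fin 2) ℂ →* GL (Fin N) ℂ) : Prop :=
  ∃ P : Fin N → Fin N → MvPolynomial (Fin 2 × Fin 2) ℂ, ∀ g i j,
    (Φ g).val i j = MvPolynomial.eval (fun x => g x.1 x.2) (P i j)

lemma IsPolynomialHom.continuous {N : ℕ} {Φ : SpecialLinearGroup (Fin 2) ℂ →* GL (Fin N) ℂ}
    (hΦ : IsPolynomialHom Φ) : Continuous Φ := by
  obtain ⟨P, hP⟩ := hΦ
  refine continuous_hom_gl fun i j => ?_
  simp only [hP]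
  refine continuous_mvPolynomial_eval (fun a => ?_) _
  exact (continuous_apply_apply a.1 a.2).comp continuous_subtype_val

lemma IsPolynomialHom.isLaurent {N : ℕ} {Φ : SpecialLinearGroup (Fin 2) ℂ →* GL (Fin N) ℂ}
    (hΦ : IsPolynomialHom Φ) {a : ℂˣ → SpecialLinearGroup (Fin 2) ℂ}
    (ha : ∀ i j, IsLaurent fun z => (a z).val i j) (i j : Fin N) :
    IsLaurent fun z => (Φ (a z)).val i j := by
  obtain ⟨P, hP⟩ := hΦ
  have h1 := IsLaurent.eval (x := fun z (b : Fin 2 × Fin 2) => (a z).val b.1 b.2)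
    (fun b => ha b.1 b.2) (P i j)
  have h2 : (fun z => (Φ (a z)).val i j) =
      fun z => MvPolynomial.eval (fun b : Fin 2 × Fin 2 => (a z).val b.1 b.2) (P i j) :=
    funext fun z => hP (a z) i j
  rw [h2]
  exact h1

/-- In the polar decomposition `g = conjDiag U z * k` the factor `k` is unitary. The other factor
lies in an algebraic one-parameter family which is unitary for `z` on the unit circle. -/
lemma IsPolynomialHom.mulVec_mem {N : ℕ} {Φ : SpecialLinearGroup (Fin 2) ℂ →* GL (Fin N) ℂ}
    (hΦ : IsPolynomialHom Φ) {W : Submodule ℂ (Fin N → ℂ)}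
    (hW : ∀ g ∈ specialUnitary, ∀ v ∈ W, (Φ g).val *ᵥ v ∈ W) (g : SpecialLinearGroup (Fin 2) ℂ) :
    ∀ v ∈ W, (Φ g).val *ᵥ v ∈ W := by
  intro v hv
  obtain ⟨U, z, k, hk, hg⟩ := exists_eq_conjDiag_mul g
  have h2 := mulVec_mem_of_isLaurent (W := W) (hΦ.isLaurent (isLaurent_conjDiag U))
    (fun x hx => hW _ (conjDiag_mem_specialUnitary U hx)) z _ (hW k hk v hv)
  rw [hg, map_mul, Units.val_mul, ← Matrix.mulVec_mulVec]
  exact h2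

/-- The restriction of a parameter to the first factor `SL(2, ℂ)`. -/
def paramFst (ψ : ArthurGroup F →* t.dualGroup n) :
    SpecialLinearGroup (Fin 2) ℂ →* GL (Fin (t.size n)) ℂ :=
  (paramGL ψ).comp ((MonoidHom.inr _ _).comp (MonoidHom.inl _ _))

/-- The restriction of a parameter to the second factor `SL(2, ℂ)`. -/
def paramSnd (ψ : ArthurGroup F →* t.dualGroup n) :
    SpecialLinearGroup (Fin 2) ℂ →* GL (Fin (t.size n)) ℂ :=
  (paramGL ψ).comp ((MonoidHom.inr _ _).comp (MonoidHom.inr _ _))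

lemma paramGL_eq (ψ : ArthurGroup F →* t.dualGroup n) (w : WeilGroup F)
    (g h : SpecialLinearGroup (Fin 2) ℂ) :
    paramGL ψ (w, g, h) = paramGL ψ (w, 1, 1) * paramFst ψ g * paramSnd ψ h := by
  simp [paramFst, paramSnd, ← map_mul]

lemma IsAParameter.isPolynomialHom_fst (hψ : IsAParameter ψ) : IsPolynomialHom (paramFst ψ) := by
  obtain ⟨P, hP⟩ := hψ.algebraic
  refine ⟨fun i j => MvPolynomial.bind₁ (Sum.elim MvPolynomial.X
    (fun x => MvPolynomial.C ((1 : SpecialLinearGroup (Fin 2) ℂ) x.1 x.2))) (P i j),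
    fun g i j => ?_⟩
  rw [← MvPolynomial.coe_aeval_eq_eval, RingHom.coe_coe, MvPolynomial.aeval_bind₁]
  refine (hP g 1 i j).trans ?_
  congr 2
  funext x
  rcases x with x | x <;> simp

lemma IsAParameter.isPolynomialHom_snd (hψ : IsAParameter ψ) : IsPolynomialHom (paramSnd ψ) := by
  obtain ⟨P, hP⟩ := hψ.algebraic
  refine ⟨fun i j => MvPolynomial.bind₁ (Sum.elim
    (fun x => MvPolynomial.C ((1 : SpecialLinearGroup (Fin 2) ℂ) x.1 x.2)) MvPolynomial.X) (P i j),
    fun g i j => ?_⟩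
  rw [← MvPolynomial.coe_aeval_eq_eval, RingHom.coe_coe, MvPolynomial.aeval_bind₁]
  refine (hP 1 g i j).trans ?_
  congr 2
  funext x
  rcases x with x | x <;> simp

/-- A parameter together with a commuting torus is completely reducible. -/
theorem IsAParameter.hasProjections_prodRep (hψ : IsAParameter ψ) {k : ℕ}
    {f : (Fin k → ℂˣ) →* GL (Fin (t.size n)) ℂ} (hf : IsAlgebraicTorusHom f)
    (h : ∀ g z, Commute (paramGL ψ g) (f z)) :
    HasProjections (prodRep (commute_glRep h)) := by
  -- The whole Weil group, two copies of `SU(2)` and the unit circles of the torus. Its image lies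
  -- in a product of four compact sets.
  let C : Subgroup (ArthurGroup F × (Fin k → ℂˣ)) :=
    Subgroup.prod (Subgroup.prod ⊤ (Subgroup.prod specialUnitary specialUnitary))
      (Subgroup.pi Set.univ fun _ => Circle.toUnits.range)
  have hmemC : ∀ w g k z, g ∈ specialUnitary → k ∈ specialUnitary →
      (∀ a, z a ∈ Circle.toUnits.range) → ((w, g, k), z) ∈ C := fun w g k z hg hk hz => by
    simp only [C, Subgroup.mem_prod, Subgroup.mem_top, true_and, Subgroup.mem_pi]
    exact ⟨⟨hg, hk⟩, fun a _ => hz a⟩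
  let Φ : ArthurGroup F × (Fin k → ℂˣ) →* GL (Fin (t.size n)) ℂ :=
    MonoidHom.noncommCoprod (paramGL ψ) f h
  have hΦ : ∀ g z, Φ (g, z) = paramGL ψ g * f z := fun _ _ => rfl
  refine hasProjections_of_isCompact Φ ?_ C ?_ ?_
  · rintro ⟨g, z⟩ v
    rw [hΦ, Units.val_mul, ← Matrix.mulVec_mulVec]
    rfl
  · have hc := ((hψ.bounded_weil.mul (isCompact_specialUnitary.image
      hψ.isPolynomialHom_fst.continuous)).mul (isCompact_specialUnitary.image
      hψ.isPolynomialHom_snd.continuous)).mul hf.isCompact_image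
    refine hc.closure_of_subset ?_
    rintro _ ⟨⟨⟨w, g, k⟩, z⟩, hC, rfl⟩
    simp only [C, SetLike.mem_coe, Subgroup.mem_prod, Subgroup.mem_top, true_and,
      Subgroup.mem_pi] at hC
    obtain ⟨⟨hg, hk⟩, hz⟩ := hC
    choose x hx using fun a => hz a (Set.mem_univ a)
    rw [hΦ, paramGL_eq]
    refine Set.mul_mem_mul (Set.mul_mem_mul (Set.mul_mem_mul (subset_closure ⟨w, rfl⟩) ⟨g, hg, rfl⟩)
      ⟨k, hk, rfl⟩) ⟨x, ?_⟩
    exact congrArg f (funext hx)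
  · intro W hW
    rw [isStable_prodRep_iff]
    refine ⟨?_, ?_⟩
    · rintro ⟨w, g, k⟩ v hv
      have h1 : ∀ w, ∀ v ∈ W, (paramGL ψ (w, 1, 1)).val *ᵥ v ∈ W := fun w v hv => by
        have := hW ((w, 1, 1), 1) (hmemC _ _ _ _ (one_mem _) (one_mem _) fun a => one_mem _) v hv
        rw [prodRep_apply, map_one, mul_one] at this
        exact this
      have h2 := hψ.isPolynomialHom_fst.mulVec_mem (W := W) fun g hg v hv => by
        have := hW ((1, g, 1), 1) (hmemC _ _ _ _ hg (one_mem _) fun a => one_mem _) v hv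
        rw [prodRep_apply, map_one, mul_one] at this
        exact this
      have h3 := hψ.isPolynomialHom_snd.mulVec_mem (W := W) fun g hg v hv => by
        have := hW ((1, 1, g), 1) (hmemC _ _ _ _ (one_mem _) hg fun a => one_mem _) v hv
        rw [prodRep_apply, map_one, mul_one] at this
        exact this
      rw [glRep_apply, paramGL_eq, Units.val_mul, Units.val_mul, ← Matrix.mulVec_mulVec,
        ← Matrix.mulVec_mulVec]
      exact h1 w _ (h2 g _ (h3 k v hv))
    · refine hf.mulVec_mem fun z hz v hv => ?_
      have := hW (1, z) (hmemC _ _ _ _ (one_mem _) (one_mem _) fun a => ?_) v hv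
      · rw [prodRep_apply, map_one, one_mul] at this
        exact this
      · exact ⟨⟨z a, mem_sphere_zero_iff_norm.2 (hz a)⟩, Units.ext rfl⟩

/-- An A-parameter is completely reducible. -/
theorem IsAParameter.hasProjections (hψ : IsAParameter ψ) : HasProjections (glRep (paramGL ψ)) := by
  intro W hW
  -- The case of the torus of rank zero.
  have hf : IsAlgebraicTorusHom (1 : (Fin 0 → ℂˣ) →* GL (Fin (t.size n)) ℂ) :=
    ⟨fun i j => MvPolynomial.C ((1 : Matrix _ _ ℂ) i j), fun z i j => by simp⟩
  have h : ∀ g z, Commute (paramGL ψ g) ((1 : (Fin 0 → ℂˣ) →* GL (Fin (t.size n)) ℂ) z) :=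
    fun g z => Commute.one_right _
  obtain ⟨R, hRρ, hR⟩ := hψ.hasProjections_prodRep hf h W ((isStable_prodRep_iff _).2
    ⟨hW, fun z v hv => by simpa [glRep_apply] using hv⟩)
  exact ⟨R, ((isEquivariant_prodRep_iff _).1 hRρ).1, hR⟩

end ParameterReducible

/-! ### The Cayley transform -/

section CayleyPath

variable {N : ℕ} {A J : Matrix (Fin N) (Fin N) ℂ}

/-- The denominator of the Cayley path through `A`. -/
def cayleyDen (A : Matrix (Fin N) (Fin N) ℂ) (z : ℂ) : Matrix (Fin N) (Fin N) ℂ :=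
  (1 + A) + z • (1 - A)

lemma commute_cayleyDen {M : Matrix (Fin N) (Fin N) ℂ} (h : Commute M A) (z : ℂ) :
    Commute M (cayleyDen A z) :=
  ((Commute.one_right M).add_right h).add_right
    (((Commute.one_right M).sub_right h).smul_right z)

lemma continuous_cayleyDen : Continuous (cayleyDen A) :=
  continuous_const.add (continuous_id.smul continuous_const)

/-- The determinant is a polynomial in `z` with value `2 ^ N` at `z = 1`. -/
lemma finite_setOf_det_cayleyDen_eq_zero : {z : ℂ | (cayleyDen A z).det = 0}.Finite := by
  let p : Polynomial ℂ := (((1 + A).map Polynomial.C + (Polynomial.X : Polynomial ℂ) •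
    (1 - A).map Polynomial.C : Matrix (Fin N) (Fin N) (Polynomial ℂ))).det
  have hp : ∀ z, p.eval z = (cayleyDen A z).det := fun z => by
    simp only [p]
    rw [← Polynomial.coe_evalRingHom, RingHom.map_det]
    congr 1
    ext i j
    simp [cayleyDen]
  have h0 : p ≠ 0 := fun h => by
    have h1 := hp 1
    have h2 : cayleyDen A 1 = (2 : ℂ) • 1 := by
      rw [cayleyDen, one_smul, two_smul]; abel
    rw [h, h2, det_smul, det_one] at h1
    simp only [Polynomial.eval_zero, mul_one, Fintype.card_fin] at h1
    exact pow_ne_zero N two_ne_zero h1.symm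
  refine (p.roots.toFinset.finite_toSet).subset fun z hz => ?_
  simp only [Finset.mem_coe, Multiset.mem_toFinset, Polynomial.mem_roots h0, Polynomial.IsRoot, hp]
  exact hz

section Isometry

variable (hJ : J.det ≠ 0) (hA : Aᵀ * J * A = J)
include hA

lemma cayleyDen_transpose_mul (z : ℂ) : (cayleyDen A z)ᵀ * J * A = J * cayleyDen A (-z) := by
  simp only [cayleyDen, transpose_add, transpose_smul, transpose_sub, transpose_one,
    Matrix.add_mul, Matrix.sub_mul, Matrix.smul_mul, Matrix.one_mul, hA, Matrix.mul_add,
    Matrix.mul_sub, Matrix.mul_smul, Matrix.mul_one]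
  module

include hJ

/-- Take determinants in `cayleyDen_transpose_mul` at `z = 0`, where the denominator is `1 + A`. So
the Cayley condition takes care of the determinant in the special orthogonal case. -/
lemma det_eq_one_of_cayleyDen (h0 : (cayleyDen A 0).det ≠ 0) : A.det = 1 := by
  have h1 := congrArg det (cayleyDen_transpose_mul hA 0)
  rw [neg_zero, det_mul, det_mul, det_mul, det_transpose] at h1
  have h2 : (cayleyDen A 0).det * J.det * (A.det - 1) = 0 := by linear_combination h1
  rcases mul_eq_zero.1 h2 with h3 | h3
  · exact absurd h3 (mul_ne_zero h0 hJ)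
  · exact sub_eq_zero.1 h3

lemma det_cayleyDen_neg (h0 : (cayleyDen A 0).det ≠ 0) (z : ℂ) :
    (cayleyDen A (-z)).det = (cayleyDen A z).det := by
  have h1 := congrArg det (cayleyDen_transpose_mul hA z)
  rw [det_mul, det_mul, det_mul, det_transpose, det_eq_one_of_cayleyDen hJ hA h0] at h1
  exact mul_left_cancel₀ hJ (by linear_combination -h1)

/-- After multiplication by `A` on the right, both sides become `J` times the product of the
commuting denominators at `z` and `-z`. -/
lemma cayleyDen_transpose_mul_mul (h0 : (cayleyDen A 0).det ≠ 0) (z : ℂ) :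
    (cayleyDen A (-z))ᵀ * J * cayleyDen A (-z) = (cayleyDen A z)ᵀ * J * cayleyDen A z := by
  have hu : IsUnit A := (Matrix.isUnit_iff_isUnit_det A).2
    (by rw [det_eq_one_of_cayleyDen hJ hA h0]; exact isUnit_one)
  have hc : ∀ z, Commute A (cayleyDen A z) := commute_cayleyDen (Commute.refl A)
  have hc' : ∀ z w, Commute (cayleyDen A w) (cayleyDen A z) := fun z w =>
    commute_cayleyDen (hc w).symm z
  have h1 := cayleyDen_transpose_mul hA z
  have h2 := cayleyDen_transpose_mul hA (-z)
  rw [neg_neg] at h2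
  refine hu.mul_right_cancel ?_
  calc (cayleyDen A (-z))ᵀ * J * cayleyDen A (-z) * A
      = (cayleyDen A (-z))ᵀ * J * A * cayleyDen A (-z) := by
        rw [Matrix.mul_assoc _ (cayleyDen A (-z)), ← (hc (-z)).eq, Matrix.mul_assoc _ A]
    _ = (cayleyDen A z)ᵀ * J * A * cayleyDen A z := by
        rw [h1, h2, Matrix.mul_assoc, Matrix.mul_assoc, (hc' (-z) z).eq]
    _ = _ := by rw [Matrix.mul_assoc _ A, (hc z).eq, Matrix.mul_assoc _ (cayleyDen A z)]

end Isometry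

/-- The parameters of the Cayley path. -/
abbrev CayleyDomain (A : Matrix (Fin N) (Fin N) ℂ) : Type :=
  ({z : ℂ | (cayleyDen A z).det = 0}ᶜ : Set ℂ)

/-- The complement of a finite set in `ℂ`, which has real dimension two, is connected. A complex
parameter avoids the finitely many bad values that a real segment might meet. -/
instance : PreconnectedSpace (CayleyDomain A) :=
  Subtype.preconnectedSpace
    (finite_setOf_det_cayleyDen_eq_zero.countable.isConnected_compl_of_one_lt_rank
      (by simp)).isPreconnected

/-- The path `(1 + A - z(1 - A)) (1 + A + z(1 - A))⁻¹` from `1` to `A`. -/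
def cayleyPath (A : Matrix (Fin N) (Fin N) ℂ)
    (hd : ∀ z, (cayleyDen A (-z)).det = (cayleyDen A z).det) (z : CayleyDomain A) :
    GL (Fin N) ℂ where
  -- The inverse of the value at `z` is the value at `-z`; by `hd` both have the same denominator
  -- determinant.
  val := (cayleyDen A z).det⁻¹ • (cayleyDen A (-z) * (cayleyDen A z).adjugate)
  inv := (cayleyDen A z).det⁻¹ • (cayleyDen A z * (cayleyDen A (-z)).adjugate)
  val_inv := by
    have hz : (cayleyDen A z).det ≠ 0 := z.2
    rw [Matrix.smul_mul, Matrix.mul_smul, Matrix.mul_assoc, ← Matrix.mul_assoc (adjugate _),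
      adjugate_mul, Matrix.smul_mul, Matrix.one_mul, Matrix.mul_smul, mul_adjugate, hd, smul_smul,
      smul_smul, smul_smul, inv_mul_cancel_right₀ hz, inv_mul_cancel₀ hz, one_smul]
  inv_val := by
    have hz : (cayleyDen A z).det ≠ 0 := z.2
    rw [Matrix.smul_mul, Matrix.mul_smul, Matrix.mul_assoc, ← Matrix.mul_assoc (adjugate _),
      adjugate_mul, Matrix.smul_mul, Matrix.one_mul, Matrix.mul_smul, mul_adjugate, hd, smul_smul,
      smul_smul, smul_smul, inv_mul_cancel_right₀ hz, inv_mul_cancel₀ hz, one_smul]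

variable {hd : ∀ z, (cayleyDen A (-z)).det = (cayleyDen A z).det}

lemma cayleyPath_mul (z : CayleyDomain A) :
    (cayleyPath A hd z).val * cayleyDen A z = cayleyDen A (-z) := by
  have hz : (cayleyDen A z).det ≠ 0 := z.2
  change ((cayleyDen A z).det⁻¹ • (cayleyDen A (-z) * (cayleyDen A z).adjugate)) * _ = _
  rw [Matrix.smul_mul, Matrix.mul_assoc, adjugate_mul, Matrix.mul_smul, smul_smul,
    inv_mul_cancel₀ hz, one_smul, Matrix.mul_one]

lemma eq_cayleyPath {z : CayleyDomain A} {M : Matrix (Fin N) (Fin N) ℂ}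
    (h : M * cayleyDen A z = cayleyDen A (-z)) : (cayleyPath A hd z).val = M := by
  have hu : IsUnit (cayleyDen A z) :=
    (Matrix.isUnit_iff_isUnit_det _).2 (isUnit_iff_ne_zero.2 z.2)
  exact hu.mul_right_cancel ((cayleyPath_mul z).trans h.symm)

lemma continuous_cayleyPath : Continuous (cayleyPath A hd) := by
  have h1 : Continuous fun z : CayleyDomain A => cayleyDen A z :=
    continuous_cayleyDen.comp continuous_subtype_val
  have h2 : Continuous fun z : CayleyDomain A => cayleyDen A (-z) :=
    continuous_cayleyDen.comp continuous_subtype_val.neg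
  have h3 : Continuous fun z : CayleyDomain A => (cayleyDen A z).det⁻¹ :=
    h1.matrix_det.inv₀ fun z => z.2
  exact Units.continuous_iff.2 ⟨h3.smul (h2.mul h1.matrix_adjugate),
    h3.smul (h1.mul h2.matrix_adjugate)⟩

lemma commute_cayleyPath {M : Matrix (Fin N) (Fin N) ℂ} (h : Commute M A) (z : CayleyDomain A) :
    Commute M (cayleyPath A hd z).val := by
  have hu : IsUnit (cayleyDen A z) :=
    (Matrix.isUnit_iff_isUnit_det _).2 (isUnit_iff_ne_zero.2 z.2)
  refine hu.mul_right_cancel ?_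
  rw [Matrix.mul_assoc, cayleyPath_mul, Matrix.mul_assoc, (commute_cayleyDen h z).eq,
    ← Matrix.mul_assoc, cayleyPath_mul, (commute_cayleyDen h _).eq]

lemma det_cayleyPath (z : CayleyDomain A) : (cayleyPath A hd z).val.det = 1 := by
  have h1 := congrArg det (cayleyPath_mul (hd := hd) z)
  rw [det_mul, hd] at h1
  exact mul_right_cancel₀ z.2 (h1.trans (one_mul _).symm)

lemma cayleyPath_isometry (hJ : J.det ≠ 0) (hA : Aᵀ * J * A = J) (h0 : (cayleyDen A 0).det ≠ 0)
    (z : CayleyDomain A) : (cayleyPath A hd z).valᵀ * J * (cayleyPath A hd z).val = J := by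
  have hu : IsUnit (cayleyDen A z) :=
    (Matrix.isUnit_iff_isUnit_det _).2 (isUnit_iff_ne_zero.2 z.2)
  have hu' : IsUnit (cayleyDen A z)ᵀ := (Matrix.isUnit_transpose _).2 hu
  refine hu.mul_right_cancel (hu'.mul_left_cancel ?_)
  have h1 := cayleyDen_transpose_mul_mul hJ hA h0 z
  conv_lhs at h1 => rw [← cayleyPath_mul (hd := hd) z]
  rw [transpose_mul] at h1
  simp only [Matrix.mul_assoc] at h1 ⊢
  exact h1

end CayleyPath

/-! ### The form of the dual group -/

section DualForm

variable (t : DualType) (n : ℕ)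

lemma DualType.sign_mul_sign : t.sign * t.sign = 1 := by cases t <;> simp [DualType.sign]

lemma DualType.form_mul_transpose : t.form n * (t.form n)ᵀ = 1 := by
  ext i k
  rw [Matrix.mul_apply, Finset.sum_eq_single (Fin.rev i)]
  · by_cases hik : i = k
    · subst hik
      rw [Matrix.one_apply_eq]
      simp only [DualType.form, transpose_apply, of_apply, if_true]
      split_ifs
      · simp
      · exact t.sign_mul_sign
    · rw [Matrix.one_apply_ne hik]
      have : Fin.rev i ≠ Fin.rev k := fun h => hik (Fin.rev_injective h)
      simp [DualType.form, this]
  · intro j _ hj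
    simp [DualType.form, hj]
  · simp

lemma DualType.det_form_ne_zero : (t.form n).det ≠ 0 := fun h => by
  have := congrArg det (t.form_mul_transpose n)
  rw [det_mul, h, zero_mul, det_one] at this
  exact zero_ne_one this

/-- In the symplectic case `N` is even, so no antidiagonal entry is on the diagonal, and exactly one
of two transposed antidiagonal entries lies below it. -/
lemma DualType.form_apply_comm (i j : Fin (t.size n)) :
    t.form n i j = t.sign * t.form n j i := by
  have h1 : (j = Fin.rev i) ↔ (i = Fin.rev j) := by
    constructor <;> (rintro rfl; simp)
  simp only [DualType.form, of_apply, h1]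
  by_cases h : i = Fin.rev j
  swap
  · simp [h]
  simp only [h, if_true]
  cases t
  · simp [DualType.sign]
  · have h2 : (Fin.rev j).val ≠ j.val := by
      have := j.2
      simp only [DualType.size] at this
      rw [Fin.val_rev]
      simp only [DualType.size]
      omega
    rcases lt_or_gt_of_ne h2 with h3 | h3
    · have h4 : Fin.rev j < j := h3
      simp [DualType.sign, h4.le, not_le.2 h4]
    · have h4 : j < Fin.rev j := h3
      simp [DualType.sign, h4.le, not_le.2 h4]
  · simp [DualType.sign]

/-- The bilinear form of the dual group. -/
def DualType.bilin : LinearMap.BilinForm ℂ (Fin (t.size n) → ℂ) := Matrix.toBilin' (t.form n)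

lemma DualType.bilin_apply (x y : Fin (t.size n) → ℂ) :
    t.bilin n x y = x ⬝ᵥ t.form n *ᵥ y := Matrix.toBilin'_apply' _ _ _

lemma DualType.isEpsForm : IsEpsForm (t.bilin n) t.sign where
  nondeg := LinearMap.BilinForm.nondegenerate_toBilin'_of_det_ne_zero' _ (t.det_form_ne_zero n)
  sq := t.sign_mul_sign
  symm x y := by
    rw [DualType.bilin_apply, DualType.bilin_apply, dotProduct_mulVec, dotProduct_comm]
    rw [← smul_eq_mul, ← dotProduct_smul, ← smul_mulVec, ← mulVec_transpose]
    congr 2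
    ext i j
    exact t.form_apply_comm n j i

/-- The endomorphism of `ℂ^N` given by an invertible matrix. -/
def glEnd {N : ℕ} : GL (Fin N) ℂ →* Module.End ℂ (Fin N → ℂ) :=
  ((Matrix.toLinAlgEquiv' : Matrix (Fin N) (Fin N) ℂ ≃ₐ[ℂ] _) :
    Matrix (Fin N) (Fin N) ℂ →* Module.End ℂ (Fin N → ℂ)).comp (Units.coeHom _)

lemma glEnd_apply {N : ℕ} (g : GL (Fin N) ℂ) (v : Fin N → ℂ) : glEnd g v = g.val *ᵥ v := rfl

lemma glRep_eq_glEnd {N : ℕ} {Γ : Type*} [Group Γ] (Φ : Γ →* GL (Fin N) ℂ) (g : Γ) :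
    glRep Φ g = glEnd (Φ g) := rfl

lemma glEnd_injective {N : ℕ} : Function.Injective (glEnd (N := N)) := fun _ _ h =>
  Units.ext ((Matrix.toLinAlgEquiv' : Matrix (Fin N) (Fin N) ℂ ≃ₐ[ℂ] _).injective h)

lemma exists_glEnd_eq {N : ℕ} {f f' : Module.End ℂ (Fin N → ℂ)} (h : f' * f = 1) :
    ∃ g : GL (Fin N) ℂ, glEnd g = f := by
  refine ⟨⟨LinearMap.toMatrix' f, LinearMap.toMatrix' f', ?_, ?_⟩, ?_⟩
  · rw [← LinearMap.toMatrix'_mul, mul_eq_one_comm_end h, LinearMap.toMatrix'_one]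
  · rw [← LinearMap.toMatrix'_mul, h, LinearMap.toMatrix'_one]
  · exact Matrix.toLin'_toMatrix' f

variable {t n}

lemma adj_glEnd_mul_iff {g : GL (Fin (t.size n)) ℂ} :
    adj (t.bilin n) (glEnd g) * glEnd g = 1 ↔ g.valᵀ * t.form n * g.val = t.form n := by
  rw [(t.isEpsForm n).isometry_iff]
  have h1 : ∀ x y, t.bilin n (glEnd g x) (glEnd g y) =
      Matrix.toBilin' (g.valᵀ * t.form n * g.val) x y := fun x y => by
    rw [DualType.bilin_apply, glEnd_apply, glEnd_apply, Matrix.toBilin'_apply',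
      ← Matrix.mulVec_mulVec, ← Matrix.mulVec_mulVec, Matrix.dotProduct_mulVec x,
      Matrix.vecMul_transpose]
  constructor
  · intro h
    refine Matrix.toBilin'.injective ?_
    exact LinearMap.ext₂ fun x y => (h1 x y).symm.trans (h x y)
  · intro h x y
    rw [h1, h]
    rfl

end DualForm

/-! ### The centralizer of a parameter -/

section Centralizer

open Representation

variable {F : Type*} [Field F] [ValuativeRel F] [TopologicalSpace F] [IsNonarchimedeanLocalField F]
variable {t : DualType} {n : ℕ} {ψ : ArthurGroup F →* t.dualGroup n}

lemma isInvariantForm_paramRep (ψ : ArthurGroup F →* t.dualGroup n) :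
    IsInvariantForm (paramRep ψ) (t.bilin n) := fun g x y =>
  ((t.isEpsForm n).isometry_iff.1 (adj_glEnd_mul_iff.2 (ψ g).2.1)) x y

lemma mem_centralizerOf_iff {g : GL (Fin (t.size n)) ℂ} : g ∈ centralizerOf ψ ↔
    IsEquivariant (paramRep ψ) (glEnd g) ∧ adj (t.bilin n) (glEnd g) * glEnd g = 1 ∧
      (t = .oddSpecialOrthogonal → g.val.det = 1) := by
  rw [adj_glEnd_mul_iff, centralizerOf, Subgroup.mem_inf, Subgroup.mem_centralizer_iff, and_comm]
  refine and_congr ⟨fun h γ => ?_, fun h => ?_⟩ Iff.rfl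
  · have h1 := congrArg glEnd (h _ ⟨γ, rfl⟩)
    rw [map_mul, map_mul] at h1
    exact h1.symm
  · rintro _ ⟨γ, rfl⟩
    refine glEnd_injective ?_
    rw [map_mul, map_mul]
    exact (h γ).eq.symm

/-- The endomorphisms given by the identity component of the centralizer. -/
def componentMonoid (ψ : ArthurGroup F →* t.dualGroup n) :
    Submonoid (Module.End ℂ (Fin (t.size n) → ℂ)) :=
  (identityComponent (centralizerOf ψ)).toSubmonoid.map glEnd

lemma glEnd_mem_componentMonoid {g : GL (Fin (t.size n)) ℂ} :
    glEnd g ∈ componentMonoid ψ ↔ g ∈ identityComponent (centralizerOf ψ) := by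
  refine ⟨?_, fun h => ⟨g, h, rfl⟩⟩
  rintro ⟨g', hg', h⟩
  rw [← glEnd_injective h]
  exact hg'

/-- The Cayley path consists of isometries of determinant `1` which commute with everything that
commutes with `g`. So it joins `1`, at parameter `0`, to `g`, at parameter `1`, inside the
centralizer. -/
lemma mem_identityComponent_of_cayley {g : GL (Fin (t.size n)) ℂ}
    (hg : IsEquivariant (paramRep ψ) (glEnd g)) (hgi : adj (t.bilin n) (glEnd g) * glEnd g = 1)
    (h : ∀ v, glEnd g v = -v → v = 0) : g ∈ identityComponent (centralizerOf ψ) := by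
  have h0 : (cayleyDen g.val 0).det ≠ 0 := fun h0 => by
    obtain ⟨v, hv, hv0⟩ := Matrix.exists_mulVec_eq_zero_iff.2 h0
    refine hv (h v ?_)
    rw [cayleyDen, zero_smul, add_zero, Matrix.add_mulVec, Matrix.one_mulVec] at hv0
    rw [glEnd_apply]
    exact eq_neg_of_add_eq_zero_right hv0
  have hJ := t.det_form_ne_zero n
  have hA := adj_glEnd_mul_iff.1 hgi
  have hd := det_cayleyDen_neg hJ hA h0
  have hmem : ∀ z, cayleyPath g.val hd z ∈ centralizerOf ψ := fun z => by
    refine mem_centralizerOf_iff.2 ⟨fun γ => ?_, ?_, fun _ => det_cayleyPath z⟩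
    · have h1 : Commute (paramGL ψ γ).val g.val := by
        have := (mem_centralizerOf_iff (ψ := ψ) (g := g)).2 ⟨hg, hgi, fun _ => by
          exact det_eq_one_of_cayleyDen hJ hA h0⟩
        have h2 := Subgroup.mem_centralizer_iff.1 this.2 _ ⟨γ, rfl⟩
        exact congrArg Units.val h2
      exact ((commute_cayleyPath (hd := hd) h1 z).symm).map
        ((Matrix.toLinAlgEquiv' : Matrix (Fin (t.size n)) (Fin (t.size n)) ℂ ≃ₐ[ℂ] _) :
          Matrix (Fin (t.size n)) (Fin (t.size n)) ℂ →* Module.End ℂ (Fin (t.size n) → ℂ))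
    · exact adj_glEnd_mul_iff.2 (cayleyPath_isometry hJ hA h0 z)
  let c : CayleyDomain g.val → centralizerOf ψ := fun z => ⟨cayleyPath g.val hd z, hmem z⟩
  have hc : Continuous c := continuous_cayleyPath.subtype_mk _
  have h1 : (cayleyDen g.val 1).det ≠ 0 := by
    have h2 : cayleyDen g.val 1 = (2 : ℂ) • 1 := by
      rw [cayleyDen, one_smul, two_smul]; abel
    rw [h2, det_smul, det_one, mul_one]
    exact pow_ne_zero _ two_ne_zero
  have hc0 : c ⟨0, h0⟩ = 1 := by
    refine Subtype.ext (Units.ext (eq_cayleyPath (hd := hd) ?_))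
    simp
  have hc1 : (c ⟨1, h1⟩).val = g := by
    refine Units.ext (eq_cayleyPath (hd := hd) ?_)
    simp only [cayleyDen, one_smul, neg_smul, Matrix.mul_add, Matrix.mul_sub, Matrix.mul_one]
    abel
  have hsub := (isPreconnected_range hc).subset_connectedComponent ⟨⟨0, h0⟩, hc0⟩
  exact ⟨c ⟨1, h1⟩, hsub ⟨⟨1, h1⟩, rfl⟩, hc1⟩

lemma isCayleyMonoid_componentMonoid (ψ : ArthurGroup F →* t.dualGroup n) :
    IsCayleyMonoid (paramRep ψ) (t.bilin n) (componentMonoid ψ) where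
  equivariant := by
    rintro _ ⟨g, hg, rfl⟩
    exact (mem_centralizerOf_iff.1 (identityComponent_le _ hg)).1
  isometry := by
    rintro _ ⟨g, hg, rfl⟩
    exact (mem_centralizerOf_iff.1 (identityComponent_le _ hg)).2.1
  cayley := by
    intro f hf hfi h
    obtain ⟨g, rfl⟩ := exists_glEnd_eq hfi
    exact glEnd_mem_componentMonoid.2 (mem_identityComponent_of_cayley hf hfi h)

/-- Through the retraction `homAct` is linear in the matrix, so `homDet` is the determinant of a
matrix with linear entries. -/
lemma continuous_homDet_glEnd {N : ℕ} {Γ : Type*} [Group Γ] {W : Type*} [AddCommGroup W]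
    [Module ℂ W] [FiniteDimensional ℂ W] (σ : Representation ℂ Γ W)
    (ρ : Representation ℂ Γ (Fin N → ℂ)) :
    Continuous fun g : GL (Fin N) ℂ => homDet σ ρ (glEnd g) := by
  let b := Module.finBasis ℂ (IntertwiningMap σ ρ)
  let l : Matrix (Fin N) (Fin N) ℂ →ₗ[ℂ] Matrix _ _ ℂ :=
    { toFun := fun M => LinearMap.toMatrix b b (homAct σ ρ (Matrix.toLin' M))
      map_add' := fun M M' => by
        rw [← map_add]
        congr 1
        ext φ : 1
        simp [homAct]
      map_smul' := fun c M => by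
        rw [RingHom.id_apply, ← map_smul]
        congr 1
        ext φ : 1
        simp [homAct] }
  have h1 : ∀ g : GL (Fin N) ℂ, homDet σ ρ (glEnd g) = (l g.val).det := fun g =>
    (LinearMap.det_toMatrix b _).symm
  simp only [h1]
  exact ((LinearMap.continuous_of_finiteDimensional l).comp Units.continuous_val).matrix_det

/-- A character of order two of the centralizer is trivial on the identity component. -/
lemma homDet_eq_one_of_mem_componentMonoid {W : Type*} [AddCommGroup W]
    [Module ℂ W] [FiniteDimensional ℂ W] {σ : Representation ℂ (ArthurGroup F) W}
    (h : ∀ f, IsEquivariant (paramRep ψ) f → adj (t.bilin n) f * f = 1 →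
      homDet σ (paramRep ψ) f * homDet σ (paramRep ψ) f = 1)
    {κ : Module.End ℂ (Fin (t.size n) → ℂ)} (hκ : κ ∈ componentMonoid ψ) :
    homDet σ (paramRep ψ) κ = 1 := by
  obtain ⟨_, ⟨x, hx, rfl⟩, rfl⟩ := hκ
  let d : centralizerOf ψ → ℂ := fun x => homDet σ (paramRep ψ) (glEnd x.val)
  have hd : Continuous d := (continuous_homDet_glEnd σ _).comp continuous_subtype_val
  have hs : Set.EqOn (d ^ 2) 1 (connectedComponent (1 : centralizerOf ψ)) := fun x _ => by
    have h1 := mem_centralizerOf_iff.1 x.2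
    rw [Pi.pow_apply, sq]
    exact h _ h1.1 h1.2.1
  have h1 : d 1 = 1 := by
    change homDet σ (paramRep ψ) (glEnd 1) = 1
    rw [map_one, homDet_one]
  -- A continuous function with values `±1` is constant on a connected set, and it is `1` at the
  -- identity.
  rcases isPreconnected_connectedComponent.eq_one_or_eq_neg_one_of_sq_eq hd.continuousOn hs with
    h2 | h2
  · exact h2 hx
  · have h3 := h2 (mem_connectedComponent (x := (1 : centralizerOf ψ)))
    rw [h1] at h3
    norm_num [Pi.neg_apply] at h3

end Centralizer

/-! ### Maximal tori -/

section MaximalTorus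

variable {F : Type*} [Field F] [ValuativeRel F] [TopologicalSpace F] [IsNonarchimedeanLocalField F]
variable {t : DualType} {n : ℕ} {ψ : ArthurGroup F →* t.dualGroup n}

lemma exists_torus_mul_self {k : ℕ} (z : Fin k → ℂˣ) : ∃ w, w * w = z := by
  have h1 : ∀ a : ℂˣ, ∃ b, b * b = a := fun a => by
    obtain ⟨b, hb⟩ := IsAlgClosed.exists_eq_mul_self (a : ℂ)
    have hb0 : b ≠ 0 := fun h => a.ne_zero (by rw [hb, h, zero_mul])
    exact ⟨Units.mk0 b hb0, Units.ext hb.symm⟩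
  choose b hb using h1
  exact ⟨fun a => b (z a), funext fun a => hb _⟩

lemma isTorus_of_isSplitTorus {N : ℕ} {Z : Type*} [CommGroup Z] {f : Representation ℂ Z (Fin N → ℂ)}
    {K : Submonoid (Module.End ℂ (Fin N → ℂ))} {P : Module.End ℂ (Fin N → ℂ)} {k : ℕ}
    {τ : (Fin k → ℂˣ) →* Module.End ℂ (Fin N → ℂ)} (hτ : IsSplitTorus f K P τ) :
    ∃ T : Subgroup (GL (Fin N) ℂ), IsTorus T ∧ ∀ g, g ∈ T ↔ glEnd g ∈ Set.range τ := by
  let e : Module.End ℂ (Fin N → ℂ) →* Matrix (Fin N) (Fin N) ℂ :=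
    (LinearMap.toMatrixAlgEquiv' : Module.End ℂ (Fin N → ℂ) ≃ₐ[ℂ] _)
  let u : (Fin k → ℂˣ) →* GL (Fin N) ℂ := (Units.map e).comp τ.toHomUnits
  have hu : ∀ y, glEnd (u y) = τ y := fun y => Matrix.toLin'_toMatrix' (τ y)
  refine ⟨u.range, ⟨k, u, fun y y' h => hτ.inj ?_, rfl, ?_⟩, fun g => ⟨?_, ?_⟩⟩
  · rw [← hu, ← hu, h]
  · obtain ⟨Q, Q', hQ⟩ := hτ.linear
    refine ⟨fun i j => MvPolynomial.C ((1 : Matrix _ _ ℂ) i j) + ∑ a,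
      ((MvPolynomial.X (Sum.inl a) - 1) * MvPolynomial.C (LinearMap.toMatrix' (Q a) i j) +
        (MvPolynomial.X (Sum.inr a) - 1) * MvPolynomial.C (LinearMap.toMatrix' (Q' a) i j)),
      fun y i j => ?_⟩
    change LinearMap.toMatrix' (τ y) i j = _
    rw [hQ]
    simp only [map_add, map_sum, map_mul, map_sub, map_one, MvPolynomial.eval_C,
      MvPolynomial.eval_X, Sum.elim_inl, Sum.elim_inr, map_smul, Matrix.add_apply,
      Matrix.sum_apply, Matrix.smul_apply, smul_eq_mul, LinearMap.toMatrix'_one]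
  · rintro ⟨y, rfl⟩
    exact ⟨y, (hu y).symm⟩
  · rintro ⟨y, hy⟩
    exact ⟨y, glEnd_injective ((hu y).trans hy)⟩

/-- A maximal torus contains the one-parameter groups which commute with it. -/
lemma hypScale_mem_range_of_isMaximalTorus (hψ : IsAParameter ψ)
    {T : Subgroup (GL (Fin (t.size n)) ℂ)}
    (hT : IsMaximalTorus (identityComponent (centralizerOf ψ)) T) {k : ℕ}
    {f : (Fin k → ℂˣ) →* GL (Fin (t.size n)) ℂ} (hfT : f.range = T)
    (hf : IsAlgebraicTorusHom f) (h : ∀ g z, Commute (paramGL ψ g) (f z))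
    (hfB : IsInvariantForm (glRep f) (t.bilin n)) {Q : Module.End ℂ (Fin (t.size n) → ℂ)}
    (hQ : IsHyp (t.bilin n) Q) (hQρ : IsEquivariant (prodRep (commute_glRep h)) Q) (hQ0 : Q ≠ 0)
    (hsc : ∀ z, ∃ c : ℂ, glRep f z * Q = c • Q) (w : ℂˣ) :
    hypScale (t.bilin n) Q w ∈ Set.range (glRep f) := by
  have hK := isCayleyMonoid_componentMonoid ψ
  have hB := t.isEpsForm n
  have hρ := isInvariantForm_paramRep ψ
  obtain ⟨m, τ, hτ, hQτ⟩ := exists_isSplitTorus_of_isHyp (commute_glRep h) hB hρ hfB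
    (hψ.hasProjections_prodRep hf h) exists_torus_mul_self (K := componentMonoid ψ)
    (fun Q hQ hQρ z => hK.hypScale_mem hB hρ hQ ((isEquivariant_prodRep_iff _).1 hQρ).1 z)
    hQ hQρ hQ0 hsc
  obtain ⟨T', hT', hT'mem⟩ := isTorus_of_isSplitTorus hτ
  -- The larger torus contains `T` by `fits` and lies in the identity component by `mem`, so
  -- maximality gives `T' ≤ T`.
  have hle : T ≤ T' := by
    rw [← hfT]
    rintro _ ⟨z, rfl⟩
    obtain ⟨y, hy⟩ := hτ.fits z
    rw [one_mul, add_sub_cancel] at hy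
    exact (hT'mem _).2 ⟨y, hy⟩
  have hle' : T' ≤ identityComponent (centralizerOf ψ) := fun g hg => by
    obtain ⟨y, hy⟩ := (hT'mem g).1 hg
    rw [← glEnd_mem_componentMonoid, ← hy]
    exact hτ.mem y
  obtain ⟨y, hy⟩ := hQτ w
  obtain ⟨g, hg⟩ := exists_glEnd_eq (hypScale_isometry hB hQ w)
  have hgT : g ∈ T := hT.2 ⟨hT', hle'⟩ hle ((hT'mem g).2 ⟨y, hy.trans hg.symm⟩)
  rw [← hfT] at hgT
  obtain ⟨z, hz⟩ := hgT
  exact ⟨z, by rw [glRep_eq_glEnd, hz, hg]⟩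

end MaximalTorus

/-! ### Irreducible representations and their duals -/

section Irreducible

open Representation

variable {Γ : Type*} [Group Γ] {V : Type*} [AddCommGroup V] [Module ℂ V] [FiniteDimensional ℂ V]
  {W : Type*} [AddCommGroup W] [Module ℂ W] [FiniteDimensional ℂ W]
  {W' : Type*} [AddCommGroup W'] [Module ℂ W'] [FiniteDimensional ℂ W']
  {ρ : Representation ℂ Γ V} {σ : Representation ℂ Γ W} {τ : Representation ℂ Γ W'}

lemma isIrreducible_of_isMinimalStable_top (h : IsMinimalStable σ ⊤) : σ.IsIrreducible := by
  have : Nontrivial (Subrepresentation σ) :=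
    ⟨⊥, ⊤, fun h' => h.ne_bot (congrArg Subrepresentation.toSubmodule h').symm⟩
  refine ⟨fun X => ?_⟩
  rcases h.minimal X.toSubmodule le_top (fun g _ hv => X.apply_mem_toSubmodule g hv) with h' | h'
  · exact Or.inl (Subrepresentation.toSubmodule_injective h')
  · exact Or.inr (Subrepresentation.toSubmodule_injective h')

lemma eq_bot_or_eq_top_of_isStable (hσ : σ.IsIrreducible) {X : Submodule ℂ W}
    (hX : IsStable σ X) : X = ⊥ ∨ X = ⊤ := by
  rcases eq_bot_or_eq_top (⟨X, fun g _ hv => hX g _ hv⟩ : Subrepresentation σ) with h | h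
  · exact Or.inl (congrArg Subrepresentation.toSubmodule h)
  · exact Or.inr (congrArg Subrepresentation.toSubmodule h)

lemma nontrivial_of_isIrreducible (hσ : σ.IsIrreducible) : Nontrivial W := by
  by_contra h
  rw [not_nontrivial_iff_subsingleton] at h
  exact bot_ne_top (α := Subrepresentation σ) (Subrepresentation.toSubmodule_injective
    (Subsingleton.elim _ _))

lemma isIrreducible_of_equiv (hσ : σ.IsIrreducible) (e : σ.Equiv τ) : τ.IsIrreducible := by
  have := nontrivial_of_isIrreducible hσ
  have h0 : e.toIntertwiningMap ≠ 0 := fun h => by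
    obtain ⟨w, hw⟩ := exists_ne (0 : W)
    refine hw (e.injective ?_)
    rw [map_zero]
    exact DFunLike.congr_fun h w
  have h1 := isMinimalStable_range hσ h0
  have h2 : LinearMap.range e.toIntertwiningMap.toLinearMap = ⊤ :=
    LinearMap.range_eq_top.2 e.surjective
  rw [h2] at h1
  exact isIrreducible_of_isMinimalStable_top h1

/-- A stable subspace of the dual is the annihilator of its coannihilator, which is a stable
subspace of the original space. -/
lemma isIrreducible_dual (hσ : σ.IsIrreducible) : σ.dual.IsIrreducible := by
  have := nontrivial_of_isIrreducible hσ
  refine isIrreducible_of_isMinimalStable_top ⟨fun _ _ _ => trivial, top_ne_bot, fun X _ hX => ?_⟩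
  have hst : IsStable σ X.dualCoannihilator := fun g w hw => by
    rw [Submodule.mem_dualCoannihilator] at hw ⊢
    intro l hl
    have := hw _ (hX g⁻¹ l hl)
    simpa [Module.Dual.transpose_apply] using this
  rw [← Subspace.dualCoannihilator_dualAnnihilator_eq (W := X)]
  rcases eq_bot_or_eq_top_of_isStable hσ hst with h | h
  · right
    rw [h, Submodule.dualAnnihilator_bot]
  · left
    rw [h, Submodule.dualAnnihilator_top]

lemma nonempty_equiv_of_ne_zero (hσ : σ.IsIrreducible) (hτ : τ.IsIrreducible)
    {φ : IntertwiningMap σ τ} (h0 : φ ≠ 0) : Nonempty (σ.Equiv τ) :=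
  ⟨φ.ofBijective ((IsIrreducible.bijective_or_eq_zero φ).resolve_right h0)⟩

lemma isInvariantPairing_of_intertwining (φ : IntertwiningMap σ τ.dual) :
    IsInvariantPairing σ τ φ.toLinearMap := fun g x y => by
  have h1 := congrArg (· (τ g y)) (IntertwiningMap.isIntertwining _ _ φ g x)
  simpa [Module.Dual.transpose_apply] using h1

lemma equiv_toLinearMap_ne_zero [Nontrivial W] (e : σ.Equiv τ) :
    e.toIntertwiningMap.toLinearMap ≠ 0 := fun h => by
  obtain ⟨w, hw⟩ := exists_ne (0 : W)
  refine hw (e.injective ?_)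
  rw [map_zero]
  exact LinearMap.congr_fun h w

lemma nonempty_equiv_dual_symm (hσ : σ.IsIrreducible) (hτ : τ.IsIrreducible)
    (e : σ.Equiv τ.dual) : Nonempty (τ.Equiv σ.dual) := by
  have := nontrivial_of_isIrreducible hσ
  have h1 := isInvariantPairing_of_intertwining e.toIntertwiningMap
  exact ⟨(pairingIntertwining h1.flip).ofBijective (pairingIntertwining_bijective hτ hσ h1.flip
    (flip_ne_zero (equiv_toLinearMap_ne_zero e)))⟩

lemma finrank_hom_le_of_surjective {φ : IntertwiningMap σ τ} (hφ : Function.Surjective φ)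
    (ρ : Representation ℂ Γ V) :
    Module.finrank ℂ (IntertwiningMap τ ρ) ≤ Module.finrank ℂ (IntertwiningMap σ ρ) := by
  let l : IntertwiningMap τ ρ →ₗ[ℂ] IntertwiningMap σ ρ :=
    { toFun := fun f => f.comp φ
      map_add' := fun f g => IntertwiningMap.ext_apply fun w => rfl
      map_smul' := fun c f => IntertwiningMap.ext_apply fun w => rfl }
  refine LinearMap.finrank_le_finrank_of_injective (f := l) fun f g h => ?_
  refine IntertwiningMap.ext_apply fun w => ?_
  obtain ⟨x, rfl⟩ := hφ w
  exact DFunLike.congr_fun h x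

lemma finrank_hom_congr_left (e : σ.Equiv τ) (ρ : Representation ℂ Γ V) :
    Module.finrank ℂ (IntertwiningMap σ ρ) = Module.finrank ℂ (IntertwiningMap τ ρ) :=
  le_antisymm (finrank_hom_le_of_surjective (φ := e.symm.toIntertwiningMap) e.symm.surjective ρ)
    (finrank_hom_le_of_surjective (φ := e.toIntertwiningMap) e.surjective ρ)

lemma finrank_hom_le_of_injective {φ : IntertwiningMap σ τ} (hφ : Function.Injective φ)
    (θ : Representation ℂ Γ V) :
    Module.finrank ℂ (IntertwiningMap θ σ) ≤ Module.finrank ℂ (IntertwiningMap θ τ) := by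
  let l : IntertwiningMap θ σ →ₗ[ℂ] IntertwiningMap θ τ :=
    { toFun := fun f => φ.comp f
      map_add' := fun f g => IntertwiningMap.ext_apply fun w => map_add φ _ _
      map_smul' := fun c f => IntertwiningMap.ext_apply fun w => map_smul φ _ _ }
  refine LinearMap.finrank_le_finrank_of_injective (f := l) fun f g h => ?_
  exact IntertwiningMap.ext_apply fun w => hφ (DFunLike.congr_fun h w)

lemma finrank_hom_congr_right (e : σ.Equiv τ) (θ : Representation ℂ Γ V) :
    Module.finrank ℂ (IntertwiningMap θ σ) = Module.finrank ℂ (IntertwiningMap θ τ) :=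
  le_antisymm (finrank_hom_le_of_injective (φ := e.toIntertwiningMap) e.injective θ)
    (finrank_hom_le_of_injective (φ := e.symm.toIntertwiningMap) e.symm.injective θ)

/-- The multiplicity of `σ` is the number of its coordinates in a decomposition. -/
lemma finrank_hom_eq_of_components (hσ : σ.IsIrreducible) {a : ℕ}
    (i : Fin a → IntertwiningMap σ ρ) (c : Fin a → IntertwiningMap ρ σ)
    (hci : ∀ x w, c x (i x w) = w) (hci' : ∀ x y w, x ≠ y → c x (i y w) = 0)
    (h0 : ∀ φ : IntertwiningMap σ ρ, (∀ x w, c x (φ w) = 0) → φ = 0) :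
    Module.finrank ℂ (IntertwiningMap σ ρ) = a := by
  have := nontrivial_of_isIrreducible hσ
  have hsum : ∀ (k : Fin a → ℂ) x w, c x ((∑ y, k y • i y) w) = k x • w := fun k x w => by
    rw [IntertwiningMap.sum_apply, map_sum, Finset.sum_eq_single x]
    · rw [IntertwiningMap.smul_apply, map_smul, hci]
    · intro y _ hy
      rw [IntertwiningMap.smul_apply, map_smul, hci' x y w hy.symm, smul_zero]
    · simp
  have hli : LinearIndependent ℂ i := Fintype.linearIndependent_iff.2 fun k hk x => by
    obtain ⟨w, hw⟩ := exists_ne (0 : W)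
    have := hsum k x w
    rw [hk] at this
    refine (smul_eq_zero.1 (this.symm.trans ?_)).resolve_right hw
    exact map_zero (c x)
  have hsp : ⊤ ≤ Submodule.span ℂ (Set.range i) := fun φ _ => by
    choose k hk using fun x => exists_eq_smul_of_isIrreducible hσ ((c x).comp φ)
    have h1 : φ = ∑ y, k y • i y := by
      refine sub_eq_zero.1 (h0 _ fun x w => ?_)
      have h2 : (φ - ∑ y, k y • i y) w = φ w - (∑ y, k y • i y) w := rfl
      rw [h2, map_sub, hsum, sub_eq_zero]
      exact hk x w
    rw [h1]
    exact Submodule.sum_mem _ fun y _ => Submodule.smul_mem _ _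
      (Submodule.subset_span (Set.mem_range_self y))
  rw [Module.finrank_eq_card_basis (Module.Basis.mk hli hsp), Fintype.card_fin]

end Irreducible

/-! ### Complete reducibility -/

section CompletelyReducible

open Representation

variable {Γ : Type*} [Group Γ] {V : Type*} [AddCommGroup V] [Module ℂ V] [FiniteDimensional ℂ V]
  {V' : Type*} [AddCommGroup V'] [Module ℂ V'] [FiniteDimensional ℂ V']
  {W : Type*} [AddCommGroup W] [Module ℂ W] [FiniteDimensional ℂ W]
  {ρ : Representation ℂ Γ V} {ρ' : Representation ℂ Γ V'} {σ : Representation ℂ Γ W}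

lemma IsStable.sup {X Y : Submodule ℂ V} (hX : IsStable ρ X) (hY : IsStable ρ Y) :
    IsStable ρ (X ⊔ Y) := fun g v hv => by
  obtain ⟨x, hx, y, hy, rfl⟩ := Submodule.mem_sup.1 hv
  rw [map_add]
  exact Submodule.add_mem_sup (hX g x hx) (hY g y hy)

/-- Take `W'` maximal among the stable subspaces disjoint from `W`. A minimal stable subspace
outside `W ⊔ W'` could be added to `W'`, so `W ⊔ W'` contains all of them. -/
lemma hasProjections_of_forall_minimal
    (h : ∀ X, (∀ U, IsMinimalStable ρ U → U ≤ X) → X = ⊤) : HasProjections ρ := by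
  intro W hW
  obtain ⟨W', ⟨hW', hd⟩, hmax⟩ := (wellFounded_gt (α := Submodule ℂ V)).has_min
    {X | IsStable ρ X ∧ Disjoint W X} ⟨⊥, fun g v hv => by
      rw [Submodule.mem_bot] at hv ⊢; rw [hv, map_zero], disjoint_bot_right⟩
  have hst := hW.sup hW'
  have hc : IsCompl W W' := by
    refine ⟨hd, codisjoint_iff.2 (h _ fun U hU => ?_)⟩
    rcases hU.minimal _ inf_le_left (hU.stable.inf hst) with h1 | h1
    swap
    · exact inf_eq_left.1 h1
    exfalso
    have h2 : Disjoint W (W' ⊔ U) := by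
      rw [Submodule.disjoint_def]
      intro x hx hx'
      obtain ⟨y, hy, u, hu, rfl⟩ := Submodule.mem_sup.1 hx'
      have hu' : u ∈ U ⊓ (W ⊔ W') := ⟨hu, by
        have : u = (y + u) - y := by abel
        rw [this]
        exact Submodule.sub_mem _ (Submodule.mem_sup_left hx) (Submodule.mem_sup_right hy)⟩
      rw [h1, Submodule.mem_bot] at hu'
      rw [hu', add_zero] at hx ⊢
      exact Submodule.disjoint_def.1 hd y hx hy
    refine hmax (W' ⊔ U) ⟨hW'.sup hU.stable, h2⟩ (lt_of_le_of_ne le_sup_left fun h3 => ?_)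
    have h4 : U ≤ W ⊔ W' := (le_sup_right.trans h3.symm.le).trans le_sup_right
    exact hU.ne_bot ((inf_eq_left.2 h4).symm.trans h1)
  refine ⟨Submodule.projection W W' hc, fun g => ?_, ?_, Submodule.range_projection hc⟩
  · refine LinearMap.ext fun v => ?_
    have hv := Submodule.projection_add_projection_eq_self hc v
    have hl := Submodule.projection_apply_left hc ⟨_, hW g _ (Submodule.projection_apply_mem hc v)⟩
    have hr := (Submodule.projection_apply_eq_zero_iff hc).2
      (hW' g _ (Submodule.projection_apply_mem hc.symm v))
    rw [Module.End.mul_apply, Module.End.mul_apply]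
    conv_lhs => rw [← hv]
    rw [map_add, map_add, hr, add_zero]
    exact hl
  · refine LinearMap.ext fun v => ?_
    exact Submodule.projection_apply_left hc ⟨_, Submodule.projection_apply_mem hc v⟩

/-- A constituent is a direct summand. -/
lemma exists_intertwining_leftInverse (hcr : HasProjections ρ) (hσ : σ.IsIrreducible)
    {φ : IntertwiningMap σ ρ} (h0 : φ ≠ 0) :
    ∃ c : IntertwiningMap ρ σ, ∀ w, c (φ w) = w := by
  obtain ⟨R, hR, hRR, hr⟩ := hcr _ (IsStable.range φ)
  have hinj : Function.Injective φ := intertwining_injective hσ h0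
  have hmem : ∀ v, ∃ w, φ w = R v := fun v => by
    have : R v ∈ LinearMap.range φ.toLinearMap := hr ▸ LinearMap.mem_range_self R v
    exact this
  choose k hk using hmem
  let c : IntertwiningMap ρ σ :=
    { toFun := k
      map_add' := fun x y => hinj (by rw [hk, map_add, map_add, hk, hk])
      map_smul' := fun a x => hinj (by rw [hk, map_smul, RingHom.id_apply, map_smul, hk])
      isIntertwining' := fun g => LinearMap.ext fun v => hinj (by
        have h1 := IntertwiningMap.isIntertwining _ _ φ g (k v)
        have h2 := congrArg (· v) (hR g).eq
        change φ (k (ρ g v)) = φ (σ g (k v))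
        rw [h1, hk, hk]
        exact h2) }
  refine ⟨c, fun w => hinj ?_⟩
  have h1 : R (φ w) = φ w := by
    have : φ w ∈ LinearMap.range R := hr ▸ LinearMap.mem_range_self φ.toLinearMap w
    exact (mem_range_iff_of_idem hRR).1 this
  exact (hk (φ w)).trans h1

/-- A representation maps onto every representation with smaller multiplicities. -/
lemma exists_surjective_intertwining (hcr : HasProjections ρ) (hcr' : HasProjections ρ')
    (hle : ∀ U (hU : IsMinimalStable ρ' U),
      Module.finrank ℂ (IntertwiningMap (subRep hU.stable) ρ') ≤
      Module.finrank ℂ (IntertwiningMap (subRep hU.stable) ρ)) :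
    ∃ f : IntertwiningMap ρ ρ', Function.Surjective f := by
  -- Choose `f` with maximal range. If it is not surjective, its range has a minimal stable `U` in a
  -- complement, and `f` can be modified to reach `U` too.
  obtain ⟨_, ⟨f, rfl⟩, hf⟩ := (wellFounded_gt (α := Submodule ℂ V')).has_min
    (Set.range fun f : IntertwiningMap ρ ρ' => LinearMap.range f.toLinearMap) ⟨_, 0, rfl⟩
  refine ⟨f, LinearMap.range_eq_top.1 ?_⟩
  by_contra hne
  obtain ⟨R, hR, hRR, hr⟩ := hcr' _ (IsStable.range f)
  have hR1 : IsEquivariant ρ' (1 - R) := IsEquivariant.one.sub hR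
  have hne' : LinearMap.range (1 - R) ≠ ⊥ := fun h => hne (by
    rw [LinearMap.range_eq_bot, sub_eq_zero] at h
    rw [← hr, ← h]
    exact LinearMap.range_eq_top.2 fun x => ⟨x, rfl⟩)
  obtain ⟨U, hUle, hU⟩ := exists_isMinimalStable hR1.isStable_range hne'
  have hUR : ∀ u ∈ U, R u = 0 := fun u hu => by
    obtain ⟨v, rfl⟩ := hUle hu
    have := congrArg (· v) hRR
    simp only [Module.End.mul_apply] at this
    simp [this]
  let θ := subRep hU.stable
  have hθ : θ.IsIrreducible := hU.isIrreducible
  let φ' : IntertwiningMap θ ρ' := subRepIncl hU.stable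
  have hnot : ¬ U ≤ LinearMap.range f.toLinearMap := fun h => hU.ne_bot
    ((Submodule.eq_bot_iff _).2 fun u hu => by
      have h1 := h hu
      rw [← hr] at h1
      rw [← (mem_range_iff_of_idem hRR).1 h1, hUR u hu])
  let l : IntertwiningMap θ ρ →ₗ[ℂ] IntertwiningMap θ ρ' :=
    { toFun := fun φ => f.comp φ
      map_add' := fun φ φ' => IntertwiningMap.ext_apply fun w => map_add f _ _
      map_smul' := fun c φ => IntertwiningMap.ext_apply fun w => map_smul f _ _ }
  -- If composition with `f` were injective on `Hom(θ, ρ)`, the inequality of multiplicities would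
  -- make it surjective. Then the inclusion of `U` would factor through `f`.
  have hker : ∃ φ : IntertwiningMap θ ρ, φ ≠ 0 ∧ ∀ w, f (φ w) = 0 := by
    by_contra! hcon
    have hinj : Function.Injective l := (injective_iff_map_eq_zero l).2 fun φ hφ => by
      by_contra h0
      obtain ⟨w, hw⟩ := hcon φ h0
      exact hw (DFunLike.congr_fun hφ w)
    have heq := le_antisymm (LinearMap.finrank_le_finrank_of_injective hinj) (hle U hU)
    obtain ⟨φ, hφ⟩ := (LinearMap.injective_iff_surjective_of_finrank_eq_finrank heq).1 hinj φ'
    exact hnot fun u hu => ⟨φ ⟨u, hu⟩, DFunLike.congr_fun hφ ⟨u, hu⟩⟩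
  obtain ⟨φ, hφ0, hφ⟩ := hker
  obtain ⟨c, hc⟩ := exists_intertwining_leftInverse hcr hθ hφ0
  let f' : IntertwiningMap ρ ρ' := f + φ'.comp c
  have hf' : ∀ v, f' v = f v + φ' (c v) := fun v => rfl
  have hU' : U ≤ LinearMap.range f'.toLinearMap := fun u hu => ⟨φ ⟨u, hu⟩, by
    change f' _ = u
    rw [hf', hφ, hc, zero_add]
    rfl⟩
  refine hf _ ⟨f', rfl⟩ (lt_of_le_of_ne ?_ fun h => hnot (hU'.trans h.ge))
  rintro _ ⟨v, rfl⟩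
  have h1 : f v = f' v - φ' (c v) := by rw [hf']; abel
  change f v ∈ _
  rw [h1]
  exact Submodule.sub_mem _ ⟨v, rfl⟩ (hU' (c v).2)

/-- Surjections in both directions force equal dimensions, so each of them is an isomorphism. -/
lemma nonempty_equiv_of_finrank_hom_eq (hcr : HasProjections ρ) (hcr' : HasProjections ρ')
    (h : ∀ U (hU : IsMinimalStable ρ U), Module.finrank ℂ (IntertwiningMap (subRep hU.stable) ρ) =
      Module.finrank ℂ (IntertwiningMap (subRep hU.stable) ρ'))
    (h' : ∀ U (hU : IsMinimalStable ρ' U),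
      Module.finrank ℂ (IntertwiningMap (subRep hU.stable) ρ) =
      Module.finrank ℂ (IntertwiningMap (subRep hU.stable) ρ')) : Nonempty (ρ.Equiv ρ') := by
  obtain ⟨f, hf⟩ := exists_surjective_intertwining hcr hcr' fun U hU => (h' U hU).ge
  obtain ⟨f', hf'⟩ := exists_surjective_intertwining hcr' hcr fun U hU => (h U hU).le
  have h1 : Module.finrank ℂ V' ≤ Module.finrank ℂ V :=
    LinearMap.finrank_le_finrank_of_surjective (f := f.toLinearMap) hf
  have h2 : Module.finrank ℂ V ≤ Module.finrank ℂ V' :=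
    LinearMap.finrank_le_finrank_of_surjective (f := f'.toLinearMap) hf'
  exact ⟨f.ofBijective ⟨(LinearMap.injective_iff_surjective_of_finrank_eq_finrank
    (f := f.toLinearMap) (le_antisymm h2 h1)).2 hf, hf⟩⟩

end CompletelyReducible

/-! ### Direct sums of multiples of representations and of their duals -/

section DirectSumRep

open Representation DirectSum

variable {Γ : Type*} [Group Γ] {s : ℕ} {W : Fin s → Type*} [∀ i, AddCommGroup (W i)]
  [∀ i, Module ℂ (W i)] [∀ i, FiniteDimensional ℂ (W i)]
  (σ : ∀ i, Representation ℂ Γ (W i)) (a b : Fin s → ℕ)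

/-- The representation `⨁ i, a_i σ_i ⊕ b_i σ_i^∨`. -/
def sumRep : Representation ℂ Γ (∀ i, (Fin (a i) → W i) × (Fin (b i) → Module.Dual ℂ (W i))) where
  toFun g :=
    { toFun := fun v i => (fun x => σ i g ((v i).1 x), fun x => (σ i).dual g ((v i).2 x))
      map_add' := fun v w => by ext <;> simp
      map_smul' := fun c v => by ext <;> simp }
  map_one' := by
    refine LinearMap.ext fun v => funext fun i => Prod.ext (funext fun x => ?_) (funext fun x => ?_)
    · simp
    · exact LinearMap.congr_fun (map_one (σ i).dual) _
  map_mul' g h := by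
    refine LinearMap.ext fun v => funext fun i => Prod.ext (funext fun x => ?_) (funext fun x => ?_)
    · simp
    · exact LinearMap.congr_fun (map_mul (σ i).dual g h) _

lemma sumRep_apply (g : Γ) (v : ∀ i, (Fin (a i) → W i) × (Fin (b i) → Module.Dual ℂ (W i)))
    (i : Fin s) : sumRep σ a b g v i =
      (fun x => σ i g ((v i).1 x), fun x => (σ i).dual g ((v i).2 x)) := rfl

lemma finsuppRep_apply {α U : Type*} [AddCommGroup U] [Module ℂ U] (τ : Representation ℂ Γ U)
    (g : Γ) (v : α →₀ U) (x : α) : τ.finsupp α g v x = τ g (v x) := by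
  have h : Finsupp.lapply x ∘ₗ τ.finsupp α g = τ g ∘ₗ Finsupp.lapply (R := ℂ) x := by
    refine Finsupp.lhom_ext fun y u => ?_
    by_cases hxy : y = x
    · subst hxy; simp
    · simp [hxy]
  exact LinearMap.congr_fun h v

/-- The comparison of `sumRep` with a direct sum. -/
def directSumEquiv : (Representation.directSum fun i =>
    ((σ i).finsupp (Fin (a i))).prod ((σ i).dual.finsupp (Fin (b i)))).Equiv (sumRep σ a b) :=
  Representation.Equiv.mk ((DirectSum.linearEquivFunOnFintype ℂ (Fin s)
      (fun i => (Fin (a i) →₀ W i) × (Fin (b i) →₀ Module.Dual ℂ (W i)))).trans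
    (LinearEquiv.piCongrRight fun i => LinearEquiv.prodCongr
      (Finsupp.linearEquivFunOnFinite ℂ (W i) (Fin (a i)))
      (Finsupp.linearEquivFunOnFinite ℂ (Module.Dual ℂ (W i)) (Fin (b i))))) fun g => by
    refine LinearMap.ext fun v => funext fun i => ?_
    refine Prod.ext (funext fun x => ?_) (funext fun x => ?_)
    · exact finsuppRep_apply (σ i) g _ x
    · exact finsuppRep_apply (σ i).dual g _ x

/-- The inclusion of a copy of `σ_i`. -/
def sumInl (i : Fin s) (x : Fin (a i)) : IntertwiningMap (σ i) (sumRep σ a b) where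
  toLinearMap := LinearMap.single ℂ
    (fun i => (Fin (a i) → W i) × (Fin (b i) → Module.Dual ℂ (W i))) i ∘ₗ
    LinearMap.inl ℂ _ _ ∘ₗ LinearMap.single ℂ (fun _ : Fin (a i) => W i) x
  isIntertwining' g := by
    refine LinearMap.ext fun w => funext fun j => ?_
    simp only [LinearMap.comp_apply, sumRep_apply]
    by_cases hij : j = i
    · subst hij
      refine Prod.ext (funext fun y => ?_) (funext fun y => ?_)
      · by_cases hxy : y = x
        · subst hxy; simp
        · simp [hxy]
      · simp
    · simp [Pi.single_eq_of_ne hij]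
      rfl

/-- The inclusion of a copy of the dual of `σ_i`. -/
def sumInr (i : Fin s) (x : Fin (b i)) : IntertwiningMap (σ i).dual (sumRep σ a b) where
  toLinearMap := LinearMap.single ℂ
    (fun i => (Fin (a i) → W i) × (Fin (b i) → Module.Dual ℂ (W i))) i ∘ₗ
    LinearMap.inr ℂ _ _ ∘ₗ LinearMap.single ℂ (fun _ : Fin (b i) => Module.Dual ℂ (W i)) x
  isIntertwining' g := by
    refine LinearMap.ext fun w => funext fun j => ?_
    simp only [LinearMap.comp_apply, sumRep_apply]
    by_cases hij : j = i
    · subst hij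
      refine Prod.ext (funext fun y => ?_) (funext fun y => ?_)
      · simp
      · by_cases hxy : y = x
        · subst hxy; simp
        · simp [hxy]
    · simp [Pi.single_eq_of_ne hij]
      rfl

/-- The coordinate in a copy of `σ_i`. -/
def sumFst (i : Fin s) (x : Fin (a i)) : IntertwiningMap (sumRep σ a b) (σ i) where
  toLinearMap := LinearMap.proj x ∘ₗ LinearMap.fst ℂ _ _ ∘ₗ LinearMap.proj
    (φ := fun i => (Fin (a i) → W i) × (Fin (b i) → Module.Dual ℂ (W i))) i
  isIntertwining' _ := rfl

/-- The coordinate in a copy of the dual of `σ_i`. -/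
def sumSnd (i : Fin s) (x : Fin (b i)) : IntertwiningMap (sumRep σ a b) (σ i).dual where
  toLinearMap := LinearMap.proj x ∘ₗ LinearMap.snd ℂ _ _ ∘ₗ LinearMap.proj
    (φ := fun i => (Fin (a i) → W i) × (Fin (b i) → Module.Dual ℂ (W i))) i
  isIntertwining' _ := rfl

variable {σ a b}

lemma sumInl_apply (i : Fin s) (x : Fin (a i)) (w : W i) : sumInl σ a b i x w =
    Pi.single (M := fun i => (Fin (a i) → W i) × (Fin (b i) → Module.Dual ℂ (W i))) i
      (Pi.single x w, 0) := rfl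

lemma sumInr_apply (i : Fin s) (x : Fin (b i)) (w : Module.Dual ℂ (W i)) : sumInr σ a b i x w =
    Pi.single (M := fun i => (Fin (a i) → W i) × (Fin (b i) → Module.Dual ℂ (W i))) i
      (0, Pi.single x w) := rfl

lemma sumFst_apply (i : Fin s) (x : Fin (a i))
    (v : ∀ i, (Fin (a i) → W i) × (Fin (b i) → Module.Dual ℂ (W i))) :
    sumFst σ a b i x v = (v i).1 x := rfl

lemma sumSnd_apply (i : Fin s) (x : Fin (b i))
    (v : ∀ i, (Fin (a i) → W i) × (Fin (b i) → Module.Dual ℂ (W i))) :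
    sumSnd σ a b i x v = (v i).2 x := rfl

lemma eq_zero_of_coordinates
    {v : ∀ i, (Fin (a i) → W i) × (Fin (b i) → Module.Dual ℂ (W i))}
    (h1 : ∀ i x, sumFst σ a b i x v = 0) (h2 : ∀ i x, sumSnd σ a b i x v = 0) : v = 0 :=
  funext fun i => Prod.ext (funext fun x => h1 i x) (funext fun x => h2 i x)

lemma sumFst_sumInl (i : Fin s) (x : Fin (a i)) (w : W i) :
    sumFst σ a b i x (sumInl σ a b i x w) = w := by
  simp [sumFst_apply, sumInl_apply]

lemma sumFst_sumInl_of_ne (i : Fin s) {x y : Fin (a i)} (w : W i) (h : x ≠ y) :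
    sumFst σ a b i x (sumInl σ a b i y w) = 0 := by
  simp [sumFst_apply, sumInl_apply, h]

lemma sumSnd_sumInr (i : Fin s) (x : Fin (b i)) (w : Module.Dual ℂ (W i)) :
    sumSnd σ a b i x (sumInr σ a b i x w) = w := by
  simp [sumSnd_apply, sumInr_apply]

lemma sumSnd_sumInr_of_ne (i : Fin s) {x y : Fin (b i)} (w : Module.Dual ℂ (W i)) (h : x ≠ y) :
    sumSnd σ a b i x (sumInr σ a b i y w) = 0 := by
  simp [sumSnd_apply, sumInr_apply, h]

/-- The copies of the `σ_i` and of their duals span the direct sum. -/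
lemma eq_top_of_sumInl_mem
    {X : Submodule ℂ (∀ i, (Fin (a i) → W i) × (Fin (b i) → Module.Dual ℂ (W i)))}
    (h1 : ∀ i x w, sumInl σ a b i x w ∈ X) (h2 : ∀ i x w, sumInr σ a b i x w ∈ X) : X = ⊤ := by
  refine eq_top_iff.2 fun v _ => ?_
  have hv : v = ∑ i, (∑ x, sumInl σ a b i x ((v i).1 x) + ∑ x, sumInr σ a b i x ((v i).2 x)) := by
    let M : Fin s → Type _ := fun i => (Fin (a i) → W i) × (Fin (b i) → Module.Dual ℂ (W i))
    have h3 : ∀ i, Pi.single (M := M) i (v i) =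
        ∑ x, sumInl σ a b i x ((v i).1 x) + ∑ x, sumInr σ a b i x ((v i).2 x) := by
      intro i
      change LinearMap.single ℂ M i (v i) =
        ∑ x, LinearMap.single ℂ M i (Pi.single x ((v i).1 x), 0) +
          ∑ x, LinearMap.single ℂ M i (0, Pi.single x ((v i).2 x))
      rw [← map_sum, ← map_sum, ← map_add]
      congr 1
      refine Prod.ext ?_ ?_
      · rw [Prod.fst_add, Prod.fst_sum, Prod.fst_sum]
        simp [Finset.univ_sum_single]
      · rw [Prod.snd_add, Prod.snd_sum, Prod.snd_sum]
        simp [Finset.univ_sum_single]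
    rw [← Finset.sum_congr rfl fun i _ => h3 i, Finset.univ_sum_single]
  rw [hv]
  exact X.sum_mem fun i _ => X.add_mem (X.sum_mem fun x _ => h1 i x _)
    (X.sum_mem fun x _ => h2 i x _)

lemma hasProjections_sumRep (hσ : ∀ i, (σ i).IsIrreducible) : HasProjections (sumRep σ a b) := by
  refine hasProjections_of_forall_minimal fun X hX => eq_top_of_sumInl_mem (σ := σ) ?_ ?_
  · intro i x w
    by_cases h : sumInl σ a b i x = 0
    · rw [h]; exact X.zero_mem
    · exact hX _ (isMinimalStable_range (hσ i) h) ⟨w, rfl⟩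
  · intro i x w
    by_cases h : sumInr σ a b i x = 0
    · rw [h]; exact X.zero_mem
    · exact hX _ (isMinimalStable_range (isIrreducible_dual (hσ i)) h) ⟨w, rfl⟩

/-! ### Multiplicities in a direct sum -/

section Multiplicities

variable (hσ : ∀ i, (σ i).IsIrreducible) (hne : ∀ i j, i ≠ j → IsEmpty ((σ i).Equiv (σ j)))
  (hne' : ∀ i j, i ≠ j → IsEmpty ((σ i).Equiv (σ j).dual))
  (hb : ∀ i, b i ≠ 0 → IsEmpty ((σ i).Equiv (σ i).dual))
include hσ

/-- Evaluation identifies `σ j` with its double dual. -/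
lemma isEmpty_equiv_dual_dual {i j : Fin s} (h : IsEmpty ((σ i).Equiv (σ j))) :
    IsEmpty ((σ j).dual.Equiv (σ i).dual) := ⟨fun e => by
  obtain ⟨e₁⟩ := nonempty_equiv_dual_symm (isIrreducible_dual (hσ j)) (hσ i) e
  have h2 : IsInvariantPairing (σ j) (σ j).dual (Module.Dual.eval ℂ (W j)) := fun g x l => by
    simp [Module.Dual.transpose_apply]
  have := nontrivial_of_isIrreducible (hσ j)
  have h0 : Module.Dual.eval ℂ (W j) ≠ 0 := fun h0 => by
    obtain ⟨w, hw⟩ := exists_ne (0 : W j)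
    exact hw ((Module.eval_apply_eq_zero_iff ℂ w).1 (LinearMap.congr_fun h0 w))
  have e₂ := (pairingIntertwining h2).ofBijective
    (pairingIntertwining_bijective (hσ j) (isIrreducible_dual (hσ j)) h2 h0)
  exact h.false (e₁.trans e₂.symm)⟩

omit hσ in
lemma intertwining_apply_eq_zero {U U' : Type*} [AddCommGroup U] [Module ℂ U]
    [FiniteDimensional ℂ U] [AddCommGroup U'] [Module ℂ U'] [FiniteDimensional ℂ U']
    {θ : Representation ℂ Γ U} {θ' : Representation ℂ Γ U'} (hθ : θ.IsIrreducible)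
    (hθ' : θ'.IsIrreducible) (h : IsEmpty (θ.Equiv θ')) (φ : IntertwiningMap θ θ') (u : U) :
    φ u = 0 := by
  by_contra hu
  obtain ⟨e⟩ := nonempty_equiv_of_ne_zero hθ hθ' (φ := φ) fun h0 => hu (by rw [h0]; rfl)
  exact h.false e

include hne hne' hb

/-- By Schur's lemma only the coordinates in copies of `σ i` survive; `hb` ensures that the copies
of its dual do not count. -/
lemma finrank_hom_sumRep (i : Fin s) :
    Module.finrank ℂ (IntertwiningMap (σ i) (sumRep σ a b)) = a i := by
  refine finrank_hom_eq_of_components (hσ i) (sumInl σ a b i) (sumFst σ a b i)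
    (sumFst_sumInl i) (fun x y w h => sumFst_sumInl_of_ne i w h) fun φ hφ => ?_
  refine IntertwiningMap.ext_apply fun w => eq_zero_of_coordinates (σ := σ) ?_ ?_
  · intro j x
    by_cases hij : i = j
    · subst hij; exact hφ x w
    · exact intertwining_apply_eq_zero (hσ i) (hσ j) (hne i j hij)
        ((sumFst σ a b j x).comp φ) w
  · intro j x
    have hE : IsEmpty ((σ i).Equiv (σ j).dual) := by
      by_cases hij : i = j
      · subst hij; exact hb i fun h => (h ▸ x : Fin 0).elim0
      · exact hne' i j hij
    exact intertwining_apply_eq_zero (hσ i) (isIrreducible_dual (hσ j)) hE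
      ((sumSnd σ a b j x).comp φ) w

lemma finrank_hom_dual_sumRep {i : Fin s} (hi : b i ≠ 0) :
    Module.finrank ℂ (IntertwiningMap (σ i).dual (sumRep σ a b)) = b i := by
  refine finrank_hom_eq_of_components (isIrreducible_dual (hσ i)) (sumInr σ a b i)
    (sumSnd σ a b i) (sumSnd_sumInr i) (fun x y w h => sumSnd_sumInr_of_ne i w h) fun φ hφ => ?_
  refine IntertwiningMap.ext_apply fun w => eq_zero_of_coordinates (σ := σ) ?_ ?_
  · intro j x
    have hE : IsEmpty ((σ j).Equiv (σ i).dual) := by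
      by_cases hij : j = i
      · subst hij; exact hb j hi
      · exact hne' j i hij
    exact intertwining_apply_eq_zero (isIrreducible_dual (hσ i)) (hσ j)
      ⟨fun e => hE.false e.symm⟩ ((sumFst σ a b j x).comp φ) w
  · intro j x
    by_cases hij : j = i
    · subst hij; exact hφ x w
    · exact intertwining_apply_eq_zero (isIrreducible_dual (hσ i)) (isIrreducible_dual (hσ j))
        (isEmpty_equiv_dual_dual hσ (hne j i hij)) ((sumSnd σ a b j x).comp φ) w

omit hne hne' hb in
/-- Every irreducible constituent is one of the `σ_i` or one of their duals. -/
lemma exists_equiv_of_intertwining_sumRep {U : Type*} [AddCommGroup U] [Module ℂ U]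
    [FiniteDimensional ℂ U] {θ : Representation ℂ Γ U} (hθ : θ.IsIrreducible)
    {φ : IntertwiningMap θ (sumRep σ a b)} (h0 : φ ≠ 0) :
    ∃ i, (a i ≠ 0 ∧ Nonempty (θ.Equiv (σ i))) ∨ (b i ≠ 0 ∧ Nonempty (θ.Equiv (σ i).dual)) := by
  by_contra! hcon
  refine h0 (IntertwiningMap.ext_apply fun u => eq_zero_of_coordinates (σ := σ) ?_ ?_)
  · intro i x
    exact intertwining_apply_eq_zero hθ (hσ i)
      (not_nonempty_iff.1 (not_nonempty_iff.2 ((hcon i).1 fun h => (h ▸ x : Fin 0).elim0)))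
      ((sumFst σ a b i x).comp φ) u
  · intro i x
    exact intertwining_apply_eq_zero hθ (isIrreducible_dual (hσ i))
      (not_nonempty_iff.1 (not_nonempty_iff.2 ((hcon i).2 fun h => (h ▸ x : Fin 0).elim0)))
      ((sumSnd σ a b i x).comp φ) u

/-- A completely reducible representation is determined by its multiplicities. -/
lemma nonempty_equiv_sumRep {V : Type*} [AddCommGroup V] [Module ℂ V] [FiniteDimensional ℂ V]
    {ρ : Representation ℂ Γ V} (hcr : HasProjections ρ)
    (ha : ∀ i, a i = Module.finrank ℂ (IntertwiningMap (σ i) ρ))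
    (hb' : ∀ i, b i ≠ 0 → b i = Module.finrank ℂ (IntertwiningMap (σ i).dual ρ))
    (hc : ∀ U (hU : IsMinimalStable ρ U), ∃ i, Nonempty ((subRep hU.stable).Equiv (σ i)) ∨
      (b i ≠ 0 ∧ Nonempty ((subRep hU.stable).Equiv (σ i).dual))) :
    Nonempty (ρ.Equiv (sumRep σ a b)) := by
  have h1 : ∀ i, Module.finrank ℂ (IntertwiningMap (σ i) ρ) =
      Module.finrank ℂ (IntertwiningMap (σ i) (sumRep σ a b)) := fun i => by
    rw [← ha, finrank_hom_sumRep hσ hne hne' hb]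
  have h2 : ∀ i, b i ≠ 0 → Module.finrank ℂ (IntertwiningMap (σ i).dual ρ) =
      Module.finrank ℂ (IntertwiningMap (σ i).dual (sumRep σ a b)) := fun i hi => by
    rw [← hb' i hi, finrank_hom_dual_sumRep hσ hne hne' hb hi]
  refine nonempty_equiv_of_finrank_hom_eq hcr (hasProjections_sumRep hσ) ?_ ?_
  · intro U hU
    obtain ⟨i, h | ⟨hi, h⟩⟩ := hc U hU <;> obtain ⟨e⟩ := h
    · rw [finrank_hom_congr_left e, finrank_hom_congr_left e, h1]
    · rw [finrank_hom_congr_left e, finrank_hom_congr_left e, h2 i hi]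
  · intro U hU
    have h0 : subRepIncl hU.stable ≠ 0 := fun h => hU.ne_bot ((Submodule.eq_bot_iff _).2
      fun u hu => DFunLike.congr_fun h (⟨u, hu⟩ : U))
    obtain ⟨i, ⟨-, h⟩ | ⟨hi, h⟩⟩ :=
      exists_equiv_of_intertwining_sumRep hσ hU.isIrreducible h0 <;> obtain ⟨e⟩ := h
    · rw [finrank_hom_congr_left e, finrank_hom_congr_left e, h1]
    · rw [finrank_hom_congr_left e, finrank_hom_congr_left e, h2 i hi]

end Multiplicities

end DirectSumRep

/-! ### Types of self-dual representations -/

section SameType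

open Representation

variable {Γ : Type*} [Group Γ] {W : Type*} [AddCommGroup W] [Module ℂ W] [FiniteDimensional ℂ W]
  {σ : Representation ℂ Γ W} {t : DualType}

/-- Both types are expressed by one sign. Alternating and antisymmetric forms agree because `2` is
invertible. -/
lemma isSameType_iff : IsSameType t σ ↔ ∃ β : LinearMap.BilinForm ℂ W, β.Nondegenerate ∧
    (∀ x y, β x y = t.sign * β y x) ∧ IsInvariantForm σ β := by
  have horth : IsOrthogonalRep σ ↔ ∃ β : LinearMap.BilinForm ℂ W, β.Nondegenerate ∧
      (∀ x y, β x y = 1 * β y x) ∧ IsInvariantForm σ β := by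
    refine exists_congr fun β => and_congr_right fun _ => and_congr_left fun _ => ?_
    simp only [one_mul]
    exact ⟨fun h x y => h.eq x y, fun h => ⟨fun x y => h x y⟩⟩
  cases t
  · exact horth
  · refine exists_congr fun β => and_congr_right fun _ => and_congr_left fun _ => ?_
    simp only [DualType.sign, neg_one_mul]
    refine ⟨fun h x y => (h.neg_eq y x).symm, fun h x => ?_⟩
    have h1 : (2 : ℂ) * β x x = 0 := by linear_combination h x x
    exact (mul_eq_zero.1 h1).resolve_left two_ne_zero
  · exact horth

lemma isSameType_of_form (hσ : σ.IsIrreducible) {β : LinearMap.BilinForm ℂ W}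
    (hβ : IsInvariantForm σ β) (h0 : β ≠ 0) (hs : ∀ x y, β x y = t.sign * β y x) :
    IsSameType t σ :=
  isSameType_iff.2 ⟨β, nondegenerate_of_isIrreducible hσ hβ h0, hs, hβ⟩

lemma nonempty_equiv_dual_of_form (hσ : σ.IsIrreducible) {β : LinearMap.BilinForm ℂ W}
    (hβ : IsInvariantForm σ β) (h0 : β ≠ 0) : Nonempty (σ.Equiv σ.dual) :=
  ⟨(pairingIntertwining hβ).ofBijective (pairingIntertwining_bijective hσ hσ hβ h0)⟩

lemma IsSameType.exists_form (hσ : σ.IsIrreducible) (h : IsSameType t σ) :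
    ∃ β : LinearMap.BilinForm ℂ W, β ≠ 0 ∧ (∀ x y, β x y = t.sign * β y x) ∧
      IsInvariantForm σ β := by
  obtain ⟨β, hn, hs, hi⟩ := isSameType_iff.1 h
  have := nontrivial_of_isIrreducible hσ
  exact ⟨β, hn.ne_zero, hs, hi⟩

/-- A self-dual irreducible representation which is not of the given type has a form with the
opposite symmetry. -/
lemma exists_form_of_not_isSameType (hσ : σ.IsIrreducible) (e : σ.Equiv σ.dual)
    (h : ¬ IsSameType t σ) : ∃ (β : LinearMap.BilinForm ℂ W) (η : ℂ), β ≠ 0 ∧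
      (∀ x y, β x y = η * β y x) ∧ IsInvariantForm σ β ∧ t.sign * η = -1 := by
  have := nontrivial_of_isIrreducible hσ
  have hβ : IsInvariantForm σ e.toIntertwiningMap.toLinearMap :=
    isInvariantPairing_of_intertwining e.toIntertwiningMap
  have h0 := equiv_toLinearMap_ne_zero e
  obtain ⟨η, hη, hs⟩ := exists_sign_of_isIrreducible hσ hβ h0
  refine ⟨_, η, h0, hs, hβ, ?_⟩
  have hne : η ≠ t.sign := fun h' => h (isSameType_of_form hσ hβ h0 (h' ▸ hs))
  have h1 : (t.sign * η) * (t.sign * η) = 1 := by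
    linear_combination t.sign * t.sign * hη + t.sign_mul_sign
  rcases mul_self_eq_one_iff.1 h1 with h2 | h2
  · refine absurd ?_ hne
    linear_combination t.sign * h2 - η * t.sign_mul_sign
  · exact h2

end SameType

/-! ### Consequences of a decomposition -/

section Consequences

open Representation

variable {Γ : Type*} [Group Γ] {V : Type*} [AddCommGroup V] [Module ℂ V] [FiniteDimensional ℂ V]
  {ρ : Representation ℂ Γ V} {t : DualType} (D : TypeDecomposition t ρ)

namespace TypeDecomposition

/-- The multiplicity of `ψ_i`. -/
def mult (i : Fin D.s) : ℕ := if i.val < D.p then D.m i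
  else if D.q ≤ i.val ∧ i.val < D.r then 2 * D.m i + 1 else 2 * D.m i

/-- The number of the additional copies of the dual of `ψ_i`. -/
def dualMult (i : Fin D.s) : ℕ := if i.val < D.p then D.m i else 0

/-- The decomposition, with a product in place of the direct sum. -/
def equivSumRep : ρ.Equiv (sumRep D.rep D.mult D.dualMult) :=
  D.equiv.trans (directSumEquiv D.rep D.mult D.dualMult)

lemma lt_of_dualMult_ne_zero {i : Fin D.s} (h : D.dualMult i ≠ 0) : i.val < D.p := by
  by_contra h'
  exact h (if_neg h')

lemma finrank_hom (i : Fin D.s) :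
    Module.finrank ℂ (IntertwiningMap (D.rep i) ρ) = D.mult i := by
  rw [finrank_hom_congr_right D.equivSumRep]
  exact finrank_hom_sumRep D.irreducible D.not_equiv D.not_equiv_dual
    (fun i hi => D.not_selfDual i (D.lt_of_dualMult_ne_zero hi)) i

/-- The indices of the constituents of the same type as the dual group. -/
abbrev TypeIndex : Type := {i : Fin D.s // D.q ≤ i.val}

lemma even_finrank_hom (i : D.TypeIndex) (h : D.r ≤ i.val.val) :
    Even (Module.finrank ℂ (IntertwiningMap (D.rep i) ρ)) := by
  have h1 := D.p_le_q.trans i.2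
  rw [finrank_hom, mult, if_neg (by omega), if_neg (by omega)]
  exact even_two_mul _

lemma finrank_hom_ne_zero (i : D.TypeIndex) (h : D.r ≤ i.val.val) :
    Module.finrank ℂ (IntertwiningMap (D.rep i) ρ) ≠ 0 := by
  have h1 := D.p_le_q.trans i.2
  have h2 := D.m_pos i (Or.inr h)
  rw [finrank_hom, mult, if_neg (by omega), if_neg (by omega)]
  omega

lemma odd_finrank_hom (i : D.TypeIndex) (h : i.val.val < D.r) :
    Odd (Module.finrank ℂ (IntertwiningMap (D.rep i) ρ)) := by
  have h1 := D.p_le_q.trans i.2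
  rw [finrank_hom, mult, if_neg (by omega), if_pos ⟨i.2, h⟩]
  exact odd_two_mul_add_one _

lemma exists_equiv_of_isMinimalStable {U : Submodule ℂ V} (hU : IsMinimalStable ρ U) :
    ∃ i, (Nonempty ((subRep hU.stable).Equiv (D.rep i))) ∨
      (i.val < D.p ∧ Nonempty ((subRep hU.stable).Equiv (D.rep i).dual)) := by
  have h0 : D.equivSumRep.toIntertwiningMap.comp (subRepIncl hU.stable) ≠ 0 := fun h =>
    hU.ne_bot ((Submodule.eq_bot_iff _).2 fun u hu => D.equivSumRep.injective (by
      rw [map_zero]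
      exact DFunLike.congr_fun h (⟨u, hu⟩ : U)))
  obtain ⟨i, ⟨-, h⟩ | ⟨hi, h⟩⟩ :=
    exists_equiv_of_intertwining_sumRep D.irreducible hU.isIrreducible h0
  · exact ⟨i, Or.inl h⟩
  · exact ⟨i, Or.inr ⟨D.lt_of_dualMult_ne_zero hi, h⟩⟩

lemma exists_isTypeFamily {B : LinearMap.BilinForm ℂ V} (hB : IsEpsForm B t.sign)
    (hρ : IsInvariantForm ρ B) :
    ∃ β, IsTypeFamily ρ B t.sign (fun i : D.TypeIndex => D.rep i) β := by
  choose β h0 hs hi using fun i : D.TypeIndex =>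
    (D.sameType i i.2).exists_form (D.irreducible i)
  refine ⟨β, fun i => D.irreducible i, fun i j hij => D.not_equiv _ _ fun h => hij (Subtype.ext h),
    hi, h0, hs, fun U hU hiso => ?_⟩
  have hθ := hU.isIrreducible
  rw [IsIsotropic] at hiso
  push Not at hiso
  obtain ⟨x, hx, y, hy, hxy⟩ := hiso
  obtain ⟨i, ⟨⟨e⟩⟩ | ⟨hip, ⟨e⟩⟩⟩ := D.exists_equiv_of_isMinimalStable hU
  · let φ : IntertwiningMap (D.rep i) ρ :=
      (subRepIncl hU.stable).comp e.symm.toIntertwiningMap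
    have hφ : ∀ w, φ w = (e.symm w : V) := fun w => rfl
    let b : LinearMap.BilinForm ℂ (Fin (D.dim i) → ℂ) := B.compl₁₂ φ.toLinearMap φ.toLinearMap
    have hb : ∀ w w', b w w' = B (φ w) (φ w') := fun _ _ => rfl
    have hb0 : b ≠ 0 := fun h => hxy (by
      have := LinearMap.congr_fun (LinearMap.congr_fun h (e ⟨x, hx⟩)) (e ⟨y, hy⟩)
      rw [hb, hφ, hφ, Representation.Equiv.symm_apply_apply,
        Representation.Equiv.symm_apply_apply] at this
      exact this)
    have hbi : IsInvariantForm (D.rep i) b := fun g w w' => by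
      rw [hb, hb, IntertwiningMap.isIntertwining, IntertwiningMap.isIntertwining, hρ]
    have hbs : ∀ w w', b w w' = t.sign * b w' w := fun w w' => hB.symm _ _
    have hiq : D.q ≤ i.val := by
      by_contra hiq
      by_cases hip : i.val < D.p
      · obtain ⟨e'⟩ := nonempty_equiv_dual_of_form (D.irreducible i) hbi hb0
        exact (D.not_selfDual i hip).false e'
      · exact D.not_sameType i (not_lt.1 hip) (not_le.1 hiq)
          (isSameType_of_form (D.irreducible i) hbi hb0 hbs)
    refine ⟨⟨i, hiq⟩, φ, fun h => hxy ?_, fun w => (e.symm w).2⟩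
    have h1 := DFunLike.congr_fun h (e ⟨x, hx⟩)
    rw [hφ, Representation.Equiv.symm_apply_apply] at h1
    have h2 : x = 0 := h1
    rw [h2, map_zero, LinearMap.zero_apply]
  · exfalso
    let b : LinearMap.BilinForm ℂ U := B.compl₁₂ U.subtype U.subtype
    have hb : IsInvariantForm (subRep hU.stable) b := fun g u u' => hρ g u u'
    have hb0 : b ≠ 0 := fun h => hxy
      (LinearMap.congr_fun (LinearMap.congr_fun h ⟨x, hx⟩) ⟨y, hy⟩)
    obtain ⟨e₁⟩ := nonempty_equiv_dual_symm hθ (D.irreducible i) e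
    obtain ⟨e₂⟩ := nonempty_equiv_dual_of_form hθ hb hb0
    exact (D.not_selfDual i hip).false ((e₁.trans e₂.symm).trans e)

end TypeDecomposition

end Consequences

/-! ### Existence of decompositions -/

section Existence

open Representation

variable {Γ : Type*} [Group Γ] {V : Type*} [AddCommGroup V] [Module ℂ V] [FiniteDimensional ℂ V]
  {ρ : Representation ℂ Γ V}

lemma exists_coordinate_rep {W : Type*} [AddCommGroup W] [Module ℂ W] [FiniteDimensional ℂ W]
    (σ : Representation ℂ Γ W) :
    ∃ τ : Representation ℂ Γ (Fin (Module.finrank ℂ W) → ℂ), Nonempty (σ.Equiv τ) := by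
  let e := (Module.finBasis ℂ W).equivFun
  let τ : Representation ℂ Γ (Fin (Module.finrank ℂ W) → ℂ) :=
    { toFun := fun g => e ∘ₗ σ g ∘ₗ e.symm
      map_one' := LinearMap.ext fun v => by simp
      map_mul' := fun g h => LinearMap.ext fun v => by simp }
  exact ⟨τ, ⟨Representation.Equiv.mk e fun g => LinearMap.ext fun w => by simp [τ]⟩⟩

/-- By the chain condition finitely many minimal stable subspaces span `V`. The projection to any
other one is nonzero on some member of this finite set, hence an isomorphism there. -/
lemma HasProjections.exists_finset (hcr : HasProjections ρ) :
    ∃ T : Finset (Submodule ℂ V), (∀ U ∈ T, IsMinimalStable ρ U) ∧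
      ∀ U (hU : IsMinimalStable ρ U), ∃ U' ∈ T, ∃ hU' : IsMinimalStable ρ U',
        Nonempty ((subRep hU.stable).Equiv (subRep hU'.stable)) := by
  obtain ⟨T, hT, hsup⟩ := CompleteLattice.WellFoundedGT.isSupFiniteCompact (Submodule ℂ V)
    {U | IsMinimalStable ρ U}
  have hst : IsStable ρ (sSup {U | IsMinimalStable ρ U}) := fun g => by
    have : sSup {U | IsMinimalStable ρ U} ≤ (sSup {U | IsMinimalStable ρ U}).comap (ρ g) :=
      sSup_le fun U hU v hv => (le_sSup hU : U ≤ _) (hU.stable g v hv)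
    exact this
  have htop : sSup {U | IsMinimalStable ρ U} = ⊤ := by
    obtain ⟨R, hR, hRR, hr⟩ := hcr _ hst
    by_contra hne
    have hne' : LinearMap.range (1 - R) ≠ ⊥ := fun h => hne (by
      rw [LinearMap.range_eq_bot, sub_eq_zero] at h
      rw [← hr, ← h]
      exact LinearMap.range_eq_top.2 fun x => ⟨x, rfl⟩)
    obtain ⟨U, hUle, hU⟩ :=
      exists_isMinimalStable (IsEquivariant.one.sub hR).isStable_range hne'
    refine hU.ne_bot ((Submodule.eq_bot_iff _).2 fun u hu => ?_)
    have h1 : R u = u := (mem_range_iff_of_idem hRR).1 (hr ▸ (le_sSup hU : U ≤ _) hu)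
    obtain ⟨v, rfl⟩ := hUle hu
    have := congrArg (· v) hRR
    simp only [Module.End.mul_apply] at this
    rw [← h1]
    simp [this]
  refine ⟨T, fun U hU => hT hU, fun U hU => ?_⟩
  obtain ⟨R, hR, hRR, hr⟩ := hcr U hU.stable
  by_contra! hcon
  have hker : (⊤ : Submodule ℂ V) ≤ LinearMap.ker R := by
    rw [← htop, hsup]
    refine Finset.sup_le fun U' hU'T => fun u hu => ?_
    have hU' := hT hU'T
    by_contra hu0
    let φ : IntertwiningMap (subRep hU'.stable) (subRep hU.stable) :=
      { toLinearMap := LinearMap.codRestrict U (R ∘ₗ U'.subtype) fun v => hr ▸ ⟨_, rfl⟩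
        isIntertwining' := fun g => LinearMap.ext fun v => Subtype.ext
          (congrArg (· (v : V)) (hR g).eq) }
    have hφ : φ ≠ 0 := fun h => hu0 (congrArg Subtype.val (DFunLike.congr_fun h (⟨u, hu⟩ : U')))
    obtain ⟨e⟩ := nonempty_equiv_of_ne_zero hU'.isIrreducible hU.isIrreducible hφ
    exact (hcon U' hU'T hU').false e.symm
  refine hU.ne_bot ?_
  rw [← hr, LinearMap.range_eq_bot]
  exact LinearMap.ker_eq_top.1 (top_le_iff.1 hker)

/-- Representatives of the irreducible constituents up to equivalence and duality. -/
lemma HasProjections.exists_representatives (hcr : HasProjections ρ) :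
    ∃ (s : ℕ) (d : Fin s → ℕ) (σ : ∀ i, Representation ℂ Γ (Fin (d i) → ℂ)),
      (∀ i, (σ i).IsIrreducible) ∧ (∀ i, Module.finrank ℂ (IntertwiningMap (σ i) ρ) ≠ 0) ∧
      (∀ i j, i ≠ j → IsEmpty ((σ i).Equiv (σ j))) ∧
      (∀ i j, i ≠ j → IsEmpty ((σ i).Equiv (σ j).dual)) ∧
      ∀ U (hU : IsMinimalStable ρ U), ∃ i, Nonempty ((subRep hU.stable).Equiv (σ i)) ∨
        Nonempty ((subRep hU.stable).Equiv (σ i).dual) := by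
  classical
  obtain ⟨T, hT, hcomp⟩ := hcr.exists_finset
  choose c hc using fun x : T => exists_coordinate_rep (subRep (hT x x.2).stable)
  have hirr : ∀ x, (c x).IsIrreducible := fun x =>
    isIrreducible_of_equiv (hT x x.2).isIrreducible (hc x).some
  let r : T → T → Prop := fun x y =>
    Nonempty ((c x).Equiv (c y)) ∨ Nonempty ((c x).Equiv (c y).dual)
  have hsymm : ∀ x y, r x y → r y x := by
    rintro x y (⟨⟨e⟩⟩ | ⟨⟨e⟩⟩)
    · exact Or.inl ⟨e.symm⟩
    · exact Or.inr (nonempty_equiv_dual_symm (hirr x) (hirr y) e)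
  -- A maximal set of pairwise unrelated constituents; by maximality each constituent is related to
  -- a member.
  obtain ⟨A, hA⟩ := (Set.toFinite {A : Finset T | ∀ x ∈ A, ∀ y ∈ A, x ≠ y → ¬ r x y}).exists_maximal
    ⟨∅, by simp⟩
  have hcov : ∀ x, ∃ y ∈ A, r x y := fun x => by
    by_contra! hx
    have h1 : insert x A ∈ {A : Finset T | ∀ x ∈ A, ∀ y ∈ A, x ≠ y → ¬ r x y} := by
      intro y hy z hz hyz
      rcases Finset.mem_insert.1 hy with rfl | hy' <;>
        rcases Finset.mem_insert.1 hz with rfl | hz'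
      · exact absurd rfl hyz
      · exact hx z hz'
      · exact fun h => hx y hy' (hsymm _ _ h)
      · exact hA.1 y hy' z hz' hyz
    have h2 : x ∈ A := hA.2 h1 (Finset.subset_insert x A) (Finset.mem_insert_self x A)
    exact hx x h2 (Or.inl ⟨Representation.Equiv.refl _⟩)
  let e := A.equivFin.symm
  have hne : ∀ i j, i ≠ j → ¬ r (e i) (e j) := fun i j hij =>
    hA.1 _ (e i).2 _ (e j).2 fun h => hij (e.injective (Subtype.ext h))
  refine ⟨A.card, _, fun i => c (e i), fun i => hirr _, fun i h0 => ?_, fun i j hij =>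
    not_nonempty_iff.1 fun h => hne i j hij (Or.inl h), fun i j hij =>
    not_nonempty_iff.1 fun h => hne i j hij (Or.inr h), fun U hU => ?_⟩
  · have hU := hT (e i).1 (e i).1.2
    rw [← finrank_hom_congr_left (hc (e i)).some, Module.finrank_zero_iff] at h0
    refine hU.ne_bot ((Submodule.eq_bot_iff _).2 fun u hu => ?_)
    exact DFunLike.congr_fun (Subsingleton.elim (subRepIncl hU.stable) 0) ⟨u, hu⟩
  · obtain ⟨U', hU'T, hU', ⟨e₁⟩⟩ := hcomp U hU
    have e₂ := (hc ⟨U', hU'T⟩).some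
    obtain ⟨y, hy, h⟩ := hcov ⟨U', hU'T⟩
    obtain ⟨i, hi⟩ := e.surjective ⟨y, hy⟩
    have h' : r ⟨U', hU'T⟩ (e i).1 := by rw [hi]; exact h
    refine ⟨i, ?_⟩
    rcases h' with ⟨⟨e₃⟩⟩ | ⟨⟨e₃⟩⟩
    · exact Or.inl ⟨(e₁.trans e₂).trans e₃⟩
    · exact Or.inr ⟨(e₁.trans e₂).trans e₃⟩

lemma exists_lt_iff_of_monotone {s : ℕ} {k : Fin s → ℕ} (hk : Monotone k) (c : ℕ) :
    ∃ p ≤ s, ∀ i, k i < c ↔ i.val < p := by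
  classical
  have hex : ∃ p, ∀ i : Fin s, p ≤ i.val → ¬ k i < c := ⟨s, fun i hi => absurd i.2 (not_lt.2 hi)⟩
  refine ⟨Nat.find hex, Nat.find_min' hex fun i hi => absurd i.2 (not_lt.2 hi),
    fun i => ⟨fun h => ?_, fun h => ?_⟩⟩
  · by_contra h'
    exact Nat.find_spec hex i (not_lt.1 h') h
  · have h1 := Nat.find_min hex h
    push Not at h1
    obtain ⟨j, hij, hj⟩ := h1
    exact (hk hij).trans_lt hj

/-- A completely reducible representation is determined by its multiplicities. Those of a
representation and its dual agree through the form, and those of the wrong type are even because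
their multiplicity form is antisymmetric. -/
theorem nonempty_typeDecomposition {t : DualType} {B : LinearMap.BilinForm ℂ V}
    (hB : IsEpsForm B t.sign) (hρ : IsInvariantForm ρ B) (hcr : HasProjections ρ) :
    Nonempty (TypeDecomposition t ρ) := by
  classical
  obtain ⟨s, d₀, σ₀, hirr₀, hmult₀, hne₀, hne'₀, hcomp₀⟩ := hcr.exists_representatives
  let μ₀ : Fin s → ℕ := fun i => Module.finrank ℂ (IntertwiningMap (σ₀ i) ρ)
  -- The four classes: not self-dual, of the wrong type, of the right type with odd multiplicity,
  -- and of the right type with even multiplicity. Sorting by class makes each of them an interval,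
  -- with cut points `p`, `q`, `r`.
  let k₀ : Fin s → ℕ := fun i => if IsEmpty ((σ₀ i).Equiv (σ₀ i).dual) then 0
    else if ¬ IsSameType t (σ₀ i) then 1 else if Odd (μ₀ i) then 2 else 3
  let π := Tuple.sort k₀
  let d : Fin s → ℕ := fun i => d₀ (π i)
  let σ : ∀ i, Representation ℂ Γ (Fin (d i) → ℂ) := fun i => σ₀ (π i)
  let μ : Fin s → ℕ := fun i => Module.finrank ℂ (IntertwiningMap (σ i) ρ)
  let k : Fin s → ℕ := fun i => k₀ (π i)
  have hkdef : ∀ i, k i = if IsEmpty ((σ i).Equiv (σ i).dual) then 0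
    else if ¬ IsSameType t (σ i) then 1 else if Odd (μ i) then 2 else 3 := fun _ => rfl
  have hk : Monotone k := Tuple.monotone_sort k₀
  have hirr : ∀ i, (σ i).IsIrreducible := fun i => hirr₀ _
  have hne : ∀ i j, i ≠ j → IsEmpty ((σ i).Equiv (σ j)) := fun i j h =>
    hne₀ _ _ (π.injective.ne h)
  have hne' : ∀ i j, i ≠ j → IsEmpty ((σ i).Equiv (σ j).dual) := fun i j h =>
    hne'₀ _ _ (π.injective.ne h)
  obtain ⟨p, hps, hp⟩ := exists_lt_iff_of_monotone hk 1
  obtain ⟨q, hqs, hq⟩ := exists_lt_iff_of_monotone hk 2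
  obtain ⟨r, hrs, hr⟩ := exists_lt_iff_of_monotone hk 3
  have hpq : p ≤ q := by
    by_contra! h
    have := (hp ⟨q, h.trans_le hps⟩).2 h
    exact lt_irrefl q ((hq ⟨q, h.trans_le hps⟩).1 (by omega))
  have hqr : q ≤ r := by
    by_contra! h
    have := (hq ⟨r, h.trans_le hqs⟩).2 h
    exact lt_irrefl r ((hr ⟨r, h.trans_le hqs⟩).1 (by omega))
  have hμ0 : ∀ i, μ i ≠ 0 := fun i => hmult₀ _
  have hnsd : ∀ i : Fin s, i.val < p → IsEmpty ((σ i).Equiv (σ i).dual) := fun i hi => by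
    by_contra h
    have h1 := (hp i).2 hi
    rw [hkdef, if_neg h] at h1
    split_ifs at h1 <;> omega
  have hsd : ∀ i : Fin s, p ≤ i.val → Nonempty ((σ i).Equiv (σ i).dual) := fun i hi => by
    by_contra h
    rw [not_nonempty_iff] at h
    exact absurd ((hp i).1 (by rw [hkdef, if_pos h]; omega)) (not_lt.2 hi)
  have hsd' : ∀ i : Fin s, p ≤ i.val → ¬ IsEmpty ((σ i).Equiv (σ i).dual) := fun i hi =>
    not_isEmpty_iff.2 (hsd i hi)
  have hnst : ∀ i : Fin s, p ≤ i.val → i.val < q → ¬ IsSameType t (σ i) := fun i hi hi' h => by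
    have h1 := (hq i).2 hi'
    rw [hkdef, if_neg (hsd' i hi), if_neg (not_not.2 h)] at h1
    split_ifs at h1 <;> omega
  have hst : ∀ i : Fin s, q ≤ i.val → IsSameType t (σ i) := fun i hi => by
    by_contra h
    exact absurd ((hq i).1 (by rw [hkdef, if_neg (hsd' i (hpq.trans hi)), if_pos h]; omega))
      (not_lt.2 hi)
  have hodd : ∀ i : Fin s, q ≤ i.val → i.val < r → Odd (μ i) := fun i hi hi' => by
    by_contra h
    have h1 := (hr i).2 hi'
    rw [hkdef, if_neg (hsd' i (hpq.trans hi)), if_neg (not_not.2 (hst i hi)), if_neg h] at h1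
    omega
  have heven : ∀ i : Fin s, p ≤ i.val → ¬ (q ≤ i.val ∧ i.val < r) → Even (μ i) := fun i hi hi' => by
    by_cases hiq : q ≤ i.val
    · by_contra h
      rw [Nat.not_even_iff_odd] at h
      refine hi' ⟨hiq, (hr i).1 ?_⟩
      rw [hkdef, if_neg (hsd' i hi), if_neg (not_not.2 (hst i hiq)), if_pos h]
      omega
    · obtain ⟨β, η, h0, hs, hβ, hη⟩ := exists_form_of_not_isSameType (hirr i) (hsd i hi).some
        (hnst i hi (not_le.1 hiq))
      exact even_finrank_hom hB hρ hβ h0 hs hcr (hirr i) hη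
  -- For odd multiplicity the rounded half satisfies `μ i = 2 * m i + 1`, and it may be zero.
  let m : Fin s → ℕ := fun i => if i.val < p then μ i else μ i / 2
  let a : Fin s → ℕ := fun i => if i.val < p then m i
    else if q ≤ i.val ∧ i.val < r then 2 * m i + 1 else 2 * m i
  let b : Fin s → ℕ := fun i => if i.val < p then m i else 0
  have ha : ∀ i, a i = μ i := fun i => by
    by_cases hip : i.val < p
    · simp only [a, m, if_pos hip]
    · simp only [a, m, if_neg hip]
      split_ifs with h
      · obtain ⟨x, hx⟩ := hodd i h.1 h.2
        omega
      · obtain ⟨x, hx⟩ := heven i (not_lt.1 hip) h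
        omega
  have hblt : ∀ i, b i ≠ 0 → i.val < p := fun i hi => by
    by_contra h
    exact hi (if_neg h)
  have hb : ∀ i, b i ≠ 0 → b i = Module.finrank ℂ (IntertwiningMap (σ i).dual ρ) := fun i hi => by
    have hip := hblt i hi
    have h1 : b i = μ i := by simp only [b, m, if_pos hip]
    rw [h1]
    have hev : IsInvariantPairing (σ i) (σ i).dual (Module.Dual.eval ℂ (Fin (d i) → ℂ)) :=
      fun g x l => by simp [Module.Dual.transpose_apply]
    have := nontrivial_of_isIrreducible (hirr i)
    have hev0 : Module.Dual.eval ℂ (Fin (d i) → ℂ) ≠ 0 := fun h0 => by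
      obtain ⟨w, hw⟩ := exists_ne (0 : Fin (d i) → ℂ)
      exact hw ((Module.eval_apply_eq_zero_iff ℂ w).1 (LinearMap.congr_fun h0 w))
    exact le_antisymm (finrank_hom_le hB hρ hcr (hirr i) hev hev0)
      (finrank_hom_le hB hρ hcr (isIrreducible_dual (hirr i)) hev.flip (flip_ne_zero hev0))
  obtain ⟨e⟩ := nonempty_equiv_sumRep (a := a) (b := b) hirr hne hne'
    (fun i hi => hnsd i (hblt i hi)) hcr ha hb fun U hU => by
      obtain ⟨i₀, h⟩ := hcomp₀ U hU
      obtain ⟨i, rfl⟩ := π.surjective i₀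
      refine ⟨i, ?_⟩
      rcases h with h | ⟨⟨e⟩⟩
      · exact Or.inl h
      by_cases hip : i.val < p
      · refine Or.inr ⟨?_, ⟨e⟩⟩
        simp only [b, m, if_pos hip]
        exact hμ0 i
      · exact Or.inl ⟨e.trans (hsd i (not_lt.1 hip)).some.symm⟩
  exact ⟨{ p := p, q := q, r := r, s := s, p_le_q := hpq, q_le_r := hqr, r_le_s := hrs
           dim := d, rep := σ, m := m
           m_pos := fun i hi => by
            have h1 := hμ0 i
            by_cases hip : i.val < p
            · simp only [m, if_pos hip]; omega
            · simp only [m, if_neg hip]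
              obtain ⟨x, hx⟩ := heven i (not_lt.1 hip) (by omega)
              omega
           irreducible := hirr, not_equiv := hne, not_equiv_dual := hne'
           not_selfDual := hnsd, selfDual := hsd, not_sameType := hnst, sameType := hst
           equiv := e.trans (directSumEquiv σ a b).symm }⟩

end Existence

/-! ### The component characters -/

section ComponentCharacters

open Representation

variable {F : Type*} [Field F] [ValuativeRel F] [TopologicalSpace F] [IsNonarchimedeanLocalField F]
variable {t : DualType} {n : ℕ} {ψ : ArthurGroup F →* t.dualGroup n}

lemma isometry_mul {V : Type*} [AddCommGroup V] [Module ℂ V] [FiniteDimensional ℂ V]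
    {B : LinearMap.BilinForm ℂ V} {ε : ℂ} (hB : IsEpsForm B ε) {g h : Module.End ℂ V}
    (hg : adj B g * g = 1) (hh : adj B h * h = 1) : adj B (g * h) * (g * h) = 1 := by
  rw [hB.adj_mul, mul_assoc, ← mul_assoc (adj B g), hg, one_mul, hh]

lemma IsMaximalTorus.exists_hom {T : Subgroup (GL (Fin (t.size n)) ℂ)}
    (hT : IsMaximalTorus (identityComponent (centralizerOf ψ)) T) :
    ∃ (k : ℕ) (f : (Fin k → ℂˣ) →* GL (Fin (t.size n)) ℂ), f.range = T ∧
      IsAlgebraicTorusHom f ∧ (∀ g z, Commute (paramGL ψ g) (f z)) ∧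
      IsInvariantForm (glRep f) (t.bilin n) := by
  obtain ⟨k, f, -, hfT, hf⟩ := hT.1.1
  have hmem : ∀ z, f z ∈ centralizerOf ψ := fun z =>
    identityComponent_le _ (hT.1.2 (hfT ▸ ⟨z, rfl⟩))
  refine ⟨k, f, hfT, hf, fun g z => ?_, fun z => ?_⟩
  · exact Subgroup.mem_centralizer_iff.1 (hmem z).2 _ ⟨g, rfl⟩
  · exact (t.isEpsForm n).isometry_iff.1 (mem_centralizerOf_iff.1 (hmem z)).2.1

/-- The determinant of the action on the multiplicity space of the constituent `ψ_i`. -/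
def compChar (D : TypeDecomposition t (paramRep ψ)) (i : D.TypeIndex)
    (g : GL (Fin (t.size n)) ℂ) : ℂ := homDet (D.rep i) (paramRep ψ) (glEnd g)

variable (hψ : IsAParameter ψ) (D : TypeDecomposition t (paramRep ψ))

lemma compChar_mul (i : D.TypeIndex) {g h : GL (Fin (t.size n)) ℂ} (hg : g ∈ centralizerOf ψ)
    (hh : h ∈ centralizerOf ψ) : compChar D i (g * h) = compChar D i g * compChar D i h := by
  rw [compChar, map_mul]
  exact homDet_mul (mem_centralizerOf_iff.1 hg).1 (mem_centralizerOf_iff.1 hh).1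

lemma compChar_one (i : D.TypeIndex) : compChar D i 1 = 1 := by
  rw [compChar, map_one, homDet_one]

include hψ

lemma homDet_mul_self_of_typeIndex (i : D.TypeIndex) (f : Module.End ℂ (Fin (t.size n) → ℂ))
    (hf : IsEquivariant (paramRep ψ) f) (hfi : adj (t.bilin n) f * f = 1) :
    homDet (D.rep i) (paramRep ψ) f * homDet (D.rep i) (paramRep ψ) f = 1 := by
  obtain ⟨β, hσ⟩ := D.exists_isTypeFamily (t.isEpsForm n) (isInvariantForm_paramRep ψ)
  exact homDet_mul_self (t.isEpsForm n) (isInvariantForm_paramRep ψ) (hσ.invariant i) (hσ.ne_zero i)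
    (hσ.symm i) hψ.hasProjections (hσ.irreducible i) hf hfi

lemma homDet_eq_one_of_typeIndex (i : D.TypeIndex) (κ : Module.End ℂ (Fin (t.size n) → ℂ))
    (hκ : κ ∈ componentMonoid ψ) : homDet (D.rep i) (paramRep ψ) κ = 1 :=
  homDet_eq_one_of_mem_componentMonoid (homDet_mul_self_of_typeIndex hψ D i) hκ

lemma compChar_mul_self (i : D.TypeIndex) {g : GL (Fin (t.size n)) ℂ}
    (hg : g ∈ centralizerOf ψ) : compChar D i g * compChar D i g = 1 :=
  homDet_mul_self_of_typeIndex hψ D i _ (mem_centralizerOf_iff.1 hg).1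
    (mem_centralizerOf_iff.1 hg).2.1

lemma compChar_eq_one_of_mem_identityComponent (i : D.TypeIndex) {g : GL (Fin (t.size n)) ℂ}
    (hg : g ∈ identityComponent (centralizerOf ψ)) : compChar D i g = 1 :=
  homDet_eq_one_of_typeIndex hψ D i _ (glEnd_mem_componentMonoid.2 hg)

variable {T : Subgroup (GL (Fin (t.size n)) ℂ)}
  (hT : IsMaximalTorus (identityComponent (centralizerOf ψ)) T)
include hT

/-- The component characters of the constituents of even multiplicity are trivial on the centralizer
of a maximal torus. -/
lemma compChar_eq_one_of_mem_relCentralizer {i : D.TypeIndex} (hi : D.r ≤ i.val.val)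
    {g : GL (Fin (t.size n)) ℂ} (hg : g ∈ relCentralizer (centralizerOf ψ) T) :
    compChar D i g = 1 := by
  have hB := t.isEpsForm n
  have hρ := isInvariantForm_paramRep ψ
  obtain ⟨β, hσ⟩ := D.exists_isTypeFamily hB hρ
  obtain ⟨k, f, hfT, hfa, hc, hf⟩ := hT.exists_hom
  have h : ∀ g z, Commute (paramRep ψ g) (glRep f z) := commute_glRep hc
  have hcr' : HasProjections (prodRep h) := hψ.hasProjections_prodRep hfa hc
  have hmax : ∀ Q, IsHyp (t.bilin n) Q → IsEquivariant (prodRep h) Q → Q ≠ 0 →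
      (∀ z, ∃ c : ℂ, glRep f z * Q = c • Q) → ∀ w, hypScale (t.bilin n) Q w ∈ Set.range (glRep f) :=
    fun Q hQ hQρ hQ0 hsc => hypScale_mem_range_of_isMaximalTorus hψ hT hfT hfa hc hf hQ hQρ hQ0 hsc
  obtain ⟨P, hP, hPρ, hfix, han⟩ := exists_fixed_proj hB hρ h hf hcr' exists_torus_mul_self hmax
  have hgS := mem_centralizerOf_iff.1 hg.1
  refine homDet_eq_one_of_commute hB hρ (isCayleyMonoid_componentMonoid ψ) hσ h hf hcr'
    exists_torus_mul_self hmax hP hPρ hfix han (homDet_eq_one_of_typeIndex hψ D)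
    (D.even_finrank_hom i hi) hgS.1 hgS.2.1 fun z => ?_
  have h1 := Subgroup.mem_centralizer_iff.1 hg.2 (f z) (by rw [← hfT]; exact ⟨z, rfl⟩)
  have h2 := congrArg glEnd h1
  rw [map_mul, map_mul] at h2
  exact h2.symm

/-- An element of the kernel of the component characters of the constituents of even multiplicity
lies in the identity component up to the centralizer of a maximal torus. -/
lemma exists_relCentralizer_mul_mem {g : GL (Fin (t.size n)) ℂ} (hg : g ∈ centralizerOf ψ)
    (hg1 : ∀ i : D.TypeIndex, D.r ≤ i.val.val → compChar D i g = 1) :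
    ∃ z ∈ relCentralizer (centralizerOf ψ) T, g * z ∈ identityComponent (centralizerOf ψ) := by
  classical
  have hB := t.isEpsForm n
  have hρ := isInvariantForm_paramRep ψ
  obtain ⟨β, hσ⟩ := D.exists_isTypeFamily hB hρ
  obtain ⟨k, f, hfT, hfa, hc, hf⟩ := hT.exists_hom
  have h : ∀ g z, Commute (paramRep ψ g) (glRep f z) := commute_glRep hc
  have hcr' : HasProjections (prodRep h) := hψ.hasProjections_prodRep hfa hc
  have hmax : ∀ Q, IsHyp (t.bilin n) Q → IsEquivariant (prodRep h) Q → Q ≠ 0 →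
      (∀ z, ∃ c : ℂ, glRep f z * Q = c • Q) → ∀ w, hypScale (t.bilin n) Q w ∈ Set.range (glRep f) :=
    fun Q hQ hQρ hQ0 hsc => hypScale_mem_range_of_isMaximalTorus hψ hT hfT hfa hc hf hQ hQρ hQ0 hsc
  obtain ⟨P, hP, hPρ, hfix, han⟩ := exists_fixed_proj hB hρ h hf hcr' exists_torus_mul_self hmax
  have hK := isCayleyMonoid_componentMonoid ψ
  have hK1 := homDet_eq_one_of_typeIndex hψ D
  have hprod : ∀ s : Finset D.TypeIndex, (∀ i ∈ s, i.val.val < D.r) →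
      ∃ z, IsEquivariant (paramRep ψ) z ∧ adj (t.bilin n) z * z = 1 ∧ IsEquivariant (glRep f) z ∧
        ∀ j : D.TypeIndex, homDet (D.rep j) (paramRep ψ) z = if j ∈ s then -1 else 1 := by
    intro s
    induction s using Finset.induction_on with
    | empty => exact fun _ => ⟨1, IsEquivariant.one, by rw [hB.adj_one, one_mul], IsEquivariant.one,
        fun j => by simp [homDet_one]⟩
    | insert i s his ih =>
      intro hs
      obtain ⟨z, hz1, hz2, hz3, hz4⟩ := ih fun j hj => hs j (Finset.mem_insert_of_mem hj)
      obtain ⟨y, hy1, hy2, hy3, hy4⟩ := exists_commute_homDet hB hρ hK hσ h hf hcr'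
        exists_torus_mul_self hmax hP hPρ hfix han hK1
        (D.odd_finrank_hom i (hs i (Finset.mem_insert_self i s)))
      refine ⟨y * z, hy1.mul hz1, isometry_mul hB hy2 hz2, hy3.mul hz3, fun j => ?_⟩
      rw [homDet_mul hy1 hz1, hy4, hz4]
      by_cases hji : j = i
      · subst hji
        simp [his]
      · simp [hji]
  -- The correction `z` is nontrivial on exactly those odd characters on which `g` is `-1`. Then all
  -- characters of `g * z` are `1`.
  obtain ⟨z, hz1, hz2, hz3, hz4⟩ := hprod (Finset.univ.filter fun i => i.val.val < D.r ∧
    compChar D i g = -1) fun i hi => (Finset.mem_filter.1 hi).2.1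
  have hgS := mem_centralizerOf_iff.1 hg
  have hmem : glEnd g * z ∈ componentMonoid ψ := by
    refine mem_of_homDet_eq_one hB hρ hK hσ hψ.hasProjections hK1 (hgS.1.mul hz1)
      (isometry_mul hB hgS.2.1 hz2) fun j => ?_
    rw [homDet_mul hgS.1 hz1, hz4]
    change compChar D j g * _ = 1
    by_cases hj : D.r ≤ j.val.val
    · rw [hg1 j hj, if_neg (by simp [hj]), one_mul]
    · rcases mul_self_eq_one_iff.1 (compChar_mul_self hψ D j hg) with h1 | h1
      · rw [h1, if_neg, one_mul]
        simp only [Finset.mem_filter, Finset.mem_univ, true_and, h1, not_and]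
        intro _ h2
        norm_num at h2
      · rw [h1, if_pos, neg_mul_neg, one_mul]
        simp [h1, not_le.1 hj]
  obtain ⟨z', rfl⟩ := exists_glEnd_eq hz2
  rw [← map_mul, glEnd_mem_componentMonoid] at hmem
  refine ⟨z', ⟨?_, Subgroup.mem_centralizer_iff.2 fun y hy => ?_⟩, hmem⟩
  · have := mul_mem (inv_mem hg) (identityComponent_le _ hmem)
    rwa [inv_mul_cancel_left] at this
  · rw [← hfT] at hy
    obtain ⟨x, rfl⟩ := hy
    refine glEnd_injective ?_
    rw [map_mul, map_mul]
    exact (hz3 x).eq.symm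

/-- The swap supplied by `exists_normalize_homDet` might have determinant `-1` in the odd special
orthogonal case. Then its negative has determinant `1`, because `N` is odd, and the same characters
of even multiplicity, because `-1` has determinant `1` on spaces of even dimension. -/
lemma exists_relNormalizer_compChar {i : D.TypeIndex} (hi : D.r ≤ i.val.val) :
    ∃ g ∈ relNormalizer (centralizerOf ψ) T, ∀ j : D.TypeIndex, D.r ≤ j.val.val →
      (j = i → compChar D j g = -1) ∧ (j ≠ i → compChar D j g = 1) := by
  classical
  have hB := t.isEpsForm n
  have hρ := isInvariantForm_paramRep ψ
  obtain ⟨β, hσ⟩ := D.exists_isTypeFamily hB hρ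
  obtain ⟨k, f, hfT, hfa, hc, hf⟩ := hT.exists_hom
  have h : ∀ g z, Commute (paramRep ψ g) (glRep f z) := commute_glRep hc
  have hcr' : HasProjections (prodRep h) := hψ.hasProjections_prodRep hfa hc
  have hmax : ∀ Q, IsHyp (t.bilin n) Q → IsEquivariant (prodRep h) Q → Q ≠ 0 →
      (∀ z, ∃ c : ℂ, glRep f z * Q = c • Q) → ∀ w, hypScale (t.bilin n) Q w ∈ Set.range (glRep f) :=
    fun Q hQ hQρ hQ0 hsc => hypScale_mem_range_of_isMaximalTorus hψ hT hfT hfa hc hf hQ hQρ hQ0 hsc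
  obtain ⟨P, hP, hPρ, hfix, han⟩ := exists_fixed_proj hB hρ h hf hcr' exists_torus_mul_self hmax
  obtain ⟨_, hg1, hg2, hg3, hg4, hg5⟩ := exists_normalize_homDet hB hρ
    (isCayleyMonoid_componentMonoid ψ) hσ h hf hcr' exists_torus_mul_self hmax hP hPρ hfix han
    (homDet_eq_one_of_typeIndex hψ D) hψ.hasProjections (D.even_finrank_hom i hi)
    (D.finrank_hom_ne_zero i hi)
  obtain ⟨g, rfl⟩ := exists_glEnd_eq hg2
  -- For an involution one inclusion suffices for normalizing.
  have hnorm : ∀ y : GL (Fin (t.size n)) ℂ, y * y = 1 → (∀ x ∈ T, y * x * y⁻¹ ∈ T) →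
      y ∈ Subgroup.normalizer (T : Set (GL (Fin (t.size n)) ℂ)) := fun y hy hyT => by
    refine Subgroup.mem_normalizer_iff.2 fun x => ⟨hyT x, fun hx => ?_⟩
    have h1 := hyT _ hx
    have hyi : y⁻¹ = y := inv_eq_of_mul_eq_one_right hy
    rw [hyi] at h1
    have h2 : y * (y * x * y) * y = (y * y) * x * (y * y) := by group
    rwa [h2, hy, one_mul, mul_one] at h1
  have hgg : g * g = 1 := glEnd_injective (by rw [map_mul, hg3, map_one])
  have hgT : ∀ x ∈ T, g * x * g⁻¹ ∈ T := fun x hx => by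
    rw [← hfT] at hx ⊢
    obtain ⟨z, rfl⟩ := hx
    obtain ⟨z', hz'⟩ := hg4 z
    have h1 : g * f z = f z' * g := glEnd_injective (by rw [map_mul, map_mul]; exact hz')
    exact ⟨z', by rw [h1, mul_inv_cancel_right]⟩
  by_cases hdet : t = .oddSpecialOrthogonal → g.val.det = 1
  · refine ⟨g, ⟨mem_centralizerOf_iff.2 ⟨hg1, hg2, hdet⟩, hnorm g hgg hgT⟩, fun j _ =>
      ⟨fun hji => ?_, fun hji => ?_⟩⟩
    · exact (hg5 j).trans (if_pos hji)
    · exact (hg5 j).trans (if_neg hji)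
  · have hneg : glEnd (-g) = -1 * glEnd g := by
      refine LinearMap.ext fun v => ?_
      rw [glEnd_apply, Module.End.mul_apply, LinearMap.neg_apply, Module.End.one_apply, glEnd_apply,
        Units.val_neg, neg_mulVec]
    have hm1 : IsEquivariant (paramRep ψ) (-1) := fun γ =>
      LinearMap.ext fun v => by simp
    have hmi : adj (t.bilin n) (-1) * -1 = 1 := hB.isometry_iff.2 fun x y => by simp
    push Not at hdet
    have hd1 : g.val.det = -1 := by
      have h1 := congrArg det (adj_glEnd_mul_iff.1 hg2)
      rw [det_mul, det_mul, det_transpose] at h1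
      have h2 : g.val.det * g.val.det = 1 :=
        mul_right_cancel₀ (t.det_form_ne_zero n) (by linear_combination h1)
      exact (mul_self_eq_one_iff.1 h2).resolve_left hdet.2
    have hmem : -g ∈ centralizerOf ψ := by
      refine mem_centralizerOf_iff.2 ⟨?_, ?_, fun ht => ?_⟩
      · rw [hneg]; exact hm1.mul hg1
      · rw [hneg]; exact isometry_mul hB hmi hg2
      · rw [Units.val_neg, det_neg, hd1, Fintype.card_fin]
        subst ht
        simp [DualType.size, pow_succ, pow_mul]
    have hval : ∀ j : D.TypeIndex, D.r ≤ j.val.val →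
        compChar D j (-g) = homDet (D.rep j) (paramRep ψ) (glEnd g) := fun j hj => by
      rw [compChar, hneg, homDet_mul hm1 hg1, homDet_neg_one, (D.even_finrank_hom j hj).neg_one_pow,
        one_mul]
    refine ⟨-g, ⟨hmem, hnorm _ (by rw [neg_mul_neg, hgg]) fun x hx => ?_⟩, fun j hj =>
      ⟨fun hji => ?_, fun hji => ?_⟩⟩
    · have : -g * x * (-g)⁻¹ = g * x * g⁻¹ := by
        rw [inv_neg, neg_mul, neg_mul_neg]
      rw [this]
      exact hgT x hx
    · rw [hval j hj]; exact (hg5 j).trans (if_pos hji)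
    · rw [hval j hj]; exact (hg5 j).trans (if_neg hji)

end ComponentCharacters

/-! ### The R-group -/

section RGroup

/-- The class of a sign in `ℤ/2`. -/
def signClass (x : ℂ) : ZMod 2 := open Classical in if x = 1 then 0 else 1

lemma signClass_one : signClass 1 = 0 := if_pos rfl

lemma signClass_neg_one : signClass (-1) = 1 := if_neg (by norm_num)

lemma signClass_mul {x y : ℂ} (hx : x * x = 1) (hy : y * y = 1) :
    signClass (x * y) = signClass x + signClass y := by
  rcases mul_self_eq_one_iff.1 hx with rfl | rfl <;> rcases mul_self_eq_one_iff.1 hy with rfl | rfl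
  · simp [signClass_one]
  · simp [signClass_one]
  · simp [signClass_one]
  · rw [neg_mul_neg, one_mul, signClass_one, signClass_neg_one]
    decide

lemma eq_one_of_signClass {x : ℂ} (h : signClass x = 0) : x = 1 := by
  by_contra hx
  rw [signClass, if_neg hx] at h
  exact one_ne_zero h

variable {Γ : Type*} [Group Γ] [TopologicalSpace Γ] [IsTopologicalGroup Γ] {S T : Subgroup Γ}

/-- An element `g` of the kernel of `χ` has the same class in `W(S, T)` as `g * z`. Since `z`
centralizes `T`, this product still normalizes `T`, and it lies in `S⁰`. -/
lemma nonempty_rGroup_equiv {A : Type*} [Group A] (χ : relNormalizer S T →* A)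
    (hsurj : Function.Surjective χ) (hZ : ∀ g, g.val ∈ relCentralizer S T → χ g = 1)
    (h0 : ∀ g, g.val ∈ identityComponent S → χ g = 1)
    (hker : ∀ g, χ g = 1 → ∃ z ∈ relCentralizer S T, g.val * z ∈ identityComponent S) :
    Nonempty (RGroup S T ≃* A) := by
  let χ₁ : WeylGroup S T →* A := QuotientGroup.lift _ χ fun g hg =>
    hZ g (Subgroup.mem_subgroupOf.1 hg)
  let χ₂ : RGroup S T →* A := QuotientGroup.lift _ χ₁ (by
    rintro _ ⟨x, rfl⟩
    induction x using QuotientGroup.induction_on with | _ x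
    exact h0 ⟨x.val, _⟩ x.2.1)
  refine ⟨MulEquiv.ofBijective χ₂ ⟨(injective_iff_map_eq_one χ₂).2 fun x hx => ?_, fun a => ?_⟩⟩
  · induction x using QuotientGroup.induction_on with | _ x
    induction x using QuotientGroup.induction_on with | _ g
    obtain ⟨z, hz, hgz⟩ := hker g hx
    have hzN : z ∈ relNormalizer S T := ⟨hz.1, Subgroup.centralizer_le_normalizer _ hz.2⟩
    let z' : relNormalizer S T := ⟨z, hzN⟩
    have hz' : (QuotientGroup.mk z' : WeylGroup S T) = 1 :=
      (QuotientGroup.eq_one_iff z').2 (Subgroup.mem_subgroupOf.2 hz)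
    have h1 : (QuotientGroup.mk g : WeylGroup S T) = QuotientGroup.mk (g * z') := by
      rw [QuotientGroup.mk_mul, hz', mul_one]
    refine (QuotientGroup.eq_one_iff _).2 ?_
    rw [h1]
    exact ⟨QuotientGroup.mk ⟨g.val * z, hgz, (g * z').2.2⟩, rfl⟩
  · obtain ⟨g, rfl⟩ := hsurj a
    exact ⟨QuotientGroup.mk (QuotientGroup.mk g), rfl⟩

end RGroup

/-! ### The isomorphism of the R-group with a power of `ℤ/2` -/

section Main

variable {F : Type*} [Field F] [ValuativeRel F] [TopologicalSpace F] [IsNonarchimedeanLocalField F]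
variable {t : DualType} {n : ℕ} {ψ : ArthurGroup F →* t.dualGroup n}

theorem nonempty_rGroup_equiv_of_isAParameter (hψ : IsAParameter ψ)
    (D : TypeDecomposition t (paramRep ψ)) {T : Subgroup (GL (Fin (t.size n)) ℂ)}
    (hT : IsMaximalTorus (identityComponent (centralizerOf ψ)) T) :
    Nonempty (RGroup (centralizerOf ψ) T ≃* Multiplicative (Fin (D.s - D.r) → ZMod 2)) := by
  classical
  let idx : Fin (D.s - D.r) → D.TypeIndex := fun a =>
    ⟨⟨D.r + a.val, by omega⟩, D.q_le_r.trans (Nat.le_add_right _ _)⟩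
  have hidx : ∀ a, D.r ≤ (idx a).val.val := fun a => Nat.le_add_right _ _
  have hidx_inj : Function.Injective idx := fun a b hab => by
    have h1 : D.r + a.val = D.r + b.val := congrArg (fun i : D.TypeIndex => i.val.val) hab
    exact Fin.ext (by omega)
  have hidx_surj : ∀ i : D.TypeIndex, D.r ≤ i.val.val → ∃ a, idx a = i := fun i hi =>
    ⟨⟨i.val.val - D.r, by omega⟩, Subtype.ext (Fin.ext (by simp only [idx]; omega))⟩
  let χ : relNormalizer (centralizerOf ψ) T →* Multiplicative (Fin (D.s - D.r) → ZMod 2) :=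
    { toFun := fun g => Multiplicative.ofAdd fun a => signClass (compChar D (idx a) g.val)
      map_one' := by
        rw [← ofAdd_zero]
        congr 1
        funext a
        rw [Subgroup.coe_one, compChar_one, signClass_one]
        rfl
      map_mul' := fun g h => by
        rw [← ofAdd_add]
        congr 1
        funext a
        rw [Subgroup.coe_mul, compChar_mul D _ g.2.1 h.2.1,
          signClass_mul (compChar_mul_self hψ D _ g.2.1) (compChar_mul_self hψ D _ h.2.1)]
        rfl }
  have hχ : ∀ g a, Multiplicative.toAdd (χ g) a = signClass (compChar D (idx a) g.val) :=
    fun _ _ => rfl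
  have hone : ∀ g, (∀ a, compChar D (idx a) g.val = 1) → χ g = 1 := fun g hg => by
    refine Multiplicative.toAdd.injective (funext fun a => ?_)
    rw [hχ, hg a, signClass_one]
    rfl
  refine nonempty_rGroup_equiv χ ?_ ?_ ?_ ?_
  -- The normalizer elements `y a` map to the standard basis vectors, and their products give every
  -- vector of `(ℤ/2)^(s - r)`.
  · choose y hyN hy using fun a => exists_relNormalizer_compChar hψ D hT (hidx a)
    have hgen : ∀ s : Finset (Fin (D.s - D.r)), ∃ g, ∀ a,
        Multiplicative.toAdd (χ g) a = if a ∈ s then 1 else 0 := fun s => by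
      induction s using Finset.induction_on with
      | empty => exact ⟨1, fun a => by rw [map_one]; simp⟩
      | insert b s hbs ih =>
        obtain ⟨g, hg⟩ := ih
        refine ⟨⟨y b, hyN b⟩ * g, fun a => ?_⟩
        rw [map_mul, toAdd_mul, Pi.add_apply, hg, hχ]
        by_cases hab : a = b
        · subst hab
          rw [((hy a) (idx a) (hidx a)).1 rfl, signClass_neg_one]
          simp [hbs]
        · rw [((hy b) (idx a) (hidx a)).2 fun h => hab (hidx_inj h), signClass_one]
          simp [hab]
    intro x
    obtain ⟨g, hg⟩ := hgen (Finset.univ.filter fun a => Multiplicative.toAdd x a = 1)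
    refine ⟨g, Multiplicative.toAdd.injective (funext fun a => ?_)⟩
    rw [hg]
    have h2 : ∀ c : ZMod 2, (if c = 1 then 1 else 0) = c := by decide
    simpa using h2 (Multiplicative.toAdd x a)
  · exact fun g hg => hone g fun a =>
      compChar_eq_one_of_mem_relCentralizer hψ D hT (hidx a) hg
  · exact fun g hg => hone g fun a =>
      compChar_eq_one_of_mem_identityComponent hψ D (idx a) hg
  · intro g hg
    refine exists_relCentralizer_mul_mem hψ D hT g.2.1 fun i hi => ?_
    obtain ⟨a, rfl⟩ := hidx_surj i hi
    refine eq_one_of_signClass ?_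
    rw [← hχ, hg]
    rfl

end Main

end

theorem mainTheorem3 {F : Type*} [Field F] [CharZero F] [ValuativeRel F] [TopologicalSpace F]
    [IsNonarchimedeanLocalField F] (t : DualType) (n : ℕ)
    (ψ : ArthurGroup F →* t.dualGroup n) (hψ : IsAParameter ψ) :
    Nonempty (TypeDecomposition t (paramRep ψ)) ∧
      ∀ (D : TypeDecomposition t (paramRep ψ)) (T : Subgroup (GL (Fin (t.size n)) ℂ)),
        IsMaximalTorus (identityComponent (centralizerOf ψ)) T →
          Nonempty (RGroup (centralizerOf ψ) T ≃* Multiplicative (Fin (D.s - D.r) → ZMod 2)) := by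
  exact ⟨nonempty_typeDecomposition (t.isEpsForm n) (isInvariantForm_paramRep ψ)
    hψ.hasProjections, fun D _ hT => nonempty_rGroup_equiv_of_isAParameter hψ D hT⟩
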